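/- **Conventions.** Let $T:V\to W$ be a linear map of finite-dimensional real vector spaces and $\omega$ a skew-symmetric bilinear form on $W$. A linear complex structure $J$ on $V$ is $(\omega,T)$-*tame* if $T^*\omega(v,Jv)>0$ for all $v\in V-\ker T$, and $(\omega,T)$-*compatible* if, in addition, $T^*\omega$ is $J$-invariant; for $T=\mathrm{id}$ one says $\omega$-tame. If $J$ is $(\omega,T)$-tame, then $\ker T$ is $J$-invariant, and $T_*J$ denotes the complex structure on $T(V)$ with $T_*J\circ T=T\circ J$. Complex structures on an oriented bundle are continuous and induce the given orientation. A 2-form on a bundle is a continuous choice of a skew-symmetric bilinear form on each fiber. **Setting.** Let $E,F\to X$ be real vector bundles with fiber orientations over a metrizable space, of fiber dimensions $2n$ and $2n-2$ ($n\ge1$), and let $T$ be a continuous section of $\mathrm{Hom}(E,F)$. A point $x\in X$ is *regular* if $T_x$ is onto and *critical* otherwise. Let $P\subset E$ be the closure of $\bigcup\ker T_x$ over the regular points $x$, and $P_x=P\cap E_x$; $x$ is *wrapped* if $\mathrm{span}\,P_x$ has real codimension at most $2$ in $\ker T_x$. Let $C\subset D\subset X$ be closed subsets such that the regular points in $X-C$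 are dense in $X-C$, and let $\omega_F$ be a nondegenerate 2-form on $F$ inducing the given fiber orientation. Let $J_C$ be an $(\omega_F,T)$-compatible complex structure on $E|U$ for some open neighborhood $U$ of $C$. For each $x\in X-U$ let an open neighborhood $W_x$ of $x$ and an $(\omega_F,T)$-compatible complex structure on $E|W_x$ be given, such that for some open neighborhood $V$ of $D$ the structures with $x\in V-U$ induce structures on $T(E|W_x)\subset F|W_x$ that agree with each other and with $T_*J_C$ wherever the domains overlap. Let $J_D$ be the resulting complex structure on the fibers of $T(E|V)$. **Lemma 3.2.** (a) If $n\ge3$, assume that each critical point of $T$ in $X-D$ is wrapped. Then $J_C|C$ extends to an $(\omega_F,T)$-compatible complex structure $J$ on $E$ with $T_*J|D=J_D$. (b) Suppose $D=X$ and $\omega_E$ is a 2-form on $E$. If the given local complex structures on $E$ (including $J_C$) are $\omega_E$-tame, then there is a $J$ as in (a) that is also $\omega_E$-tame. (c) Let $X_0=X-\mathrm{int}\,C$, and suppose that $\partial C\subset X_0$ and (if $D\ne C$) $\partial D\subset X-\mathrm{int}\,D$ have disjoint compatible collars (defined below). Then, in both cases (a) and (b), the space $\mathcal J$ of all complex structures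 $J$ satisfying the given conclusions, with the compact-open topology, is weakly contractible (nonempty, and every map $S^m\to\mathcal J$, $m\ge0$, is nullhomotopic) when $X_0$ is locally compact, and contractible when $X_0$ is compact. All of the above remains true if compatibility is replaced by taming everywhere, provided that $D=X$. A *compatible collar* of $\partial S$ in $X-\mathrm{int}\,S$ ($S=C$ or $D$) is a subset $K\subset X-\mathrm{int}\,S$ with a homeomorphism $I\times\partial S\to K$, $I=[0,1]$, sending $(0,y)$ to $y$ and mapping $\{1\}\times\partial S$ onto the boundary of $K$ in $X-\mathrm{int}\,S$, together with identifications of $E|K$ and $F|K$ with $I\times(E|\partial S)$ and $I\times(F|\partial S)$ (the identity over $\{0\}\times\partial S$) such that $T$ and $\omega_F$ are constant along each $I\times\{y\}$. For $S=C$ it is also required that, along each $I\times\{y\}$, $\omega_E$ is constant in case (b), and $J_D$ is constant if $D\ne C$ (in which case disjointness of the collars forces $K\subset\mathrm{int}\,D$). **Addendum.** Let $n=3$ and, instead of assuming that the critical points in $X-D$ are wrapped, fix for each unwrapped critical point of $T$ in $X-D$ a sequence of regular points converging to it. An $(\omega_F,T)$-compatible complex structure $J$ on $E|W$, $W\subset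 X$ open, is *extendible* along these sequences if for each such sequence $x_i\to x$ with $x\in W$ the complex structures $T_*J$ on $F_{x_i}$ (defined for all large $i$) converge to an $\omega_F$-tame complex structure on $F_x$. Suppose that all the given local complex structures on $E$ (including $J_C$) are extendible along these sequences. Then the lemma still holds with the structures $J$ (those in (a) and those comprising $\mathcal J$) required to be extendible along the given sequences, provided that in (c) the collar of $\partial C$ (if $D=C$) or of $\partial D$ (if $D\ne C$) contains no unwrapped critical points. -/

import Mathlib

open Bundle Topology Set Filter Module
open scoped unitInterval

noncomputable section

namespace Splice

/-! ### Linear algebra -/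

section Linear

variable {V W : Type*} [AddCommGroup V] [Module ℝ V] [TopologicalSpace V]
  [AddCommGroup W] [Module ℝ W] [TopologicalSpace W]

/-- `J` is `(ω, T)`-tame: `T^*ω(v, Jv) > 0` for all `v ∉ ker T`. -/
def IsTame (ω : W →L[ℝ] W →L[ℝ] ℝ) (T : V →L[ℝ] W) (J : V →L[ℝ] V) : Prop :=
  ∀ v, T v ≠ 0 → 0 < ω (T v) (T (J v))

/-- `J` is `(ω, T)`-compatible: it is `(ω, T)`-tame and `T^*ω` is `J`-invariant. -/
def IsCompatible (ω : W →L[ℝ] W →L[ℝ] ℝ) (T : V →L[ℝ] W) (J : V →L[ℝ] V) : Prop :=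
  IsTame ω T J ∧ ∀ v w, ω (T (J v)) (T (J w)) = ω (T v) (T w)

/-- The complex structure `J` induces the orientation `o`: some real basis
`(v₁, J v₁, …, vₙ, J vₙ)`, the image of the standard basis of `ℂ × ⋯ × ℂ` under a complex
isomorphism, is positively oriented. (Families of `2n` vectors are indexed by `Fin n × Fin 2`.) -/
def InducesOrientation {n : ℕ} (o : Orientation ℝ V (Fin n × Fin 2)) (J : V →L[ℝ] V) : Prop :=
  ∃ b : Basis (Fin n × Fin 2) ℝ V, (∀ i, b (i, 1) = J (b (i, 0))) ∧ b.orientation = o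

/-- The skew form `ω` induces the orientation `o`: some symplectic basis `(e₁, f₁, …, eₘ, fₘ)`
is positively oriented (on such a basis the top exterior power of `ω` is positive). -/
def FormInducesOrientation {m : ℕ} (o : Orientation ℝ V (Fin m × Fin 2))
    (ω : V →L[ℝ] V →L[ℝ] ℝ) : Prop :=
  ∃ b : Basis (Fin m × Fin 2) ℝ V,
    (∀ i j, ω (b (i, 0)) (b (j, 1)) = if i = j then 1 else 0) ∧
    (∀ i j, ω (b (i, 0)) (b (j, 0)) = 0) ∧ (∀ i j, ω (b (i, 1)) (b (j, 1)) = 0) ∧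
    b.orientation = o

/-- The structure `T_*J` induced on the image of `T`, i.e. `T_*J (T v) = T (J v)`; see
`pushforward_apply`. -/
def pushforward (T : V →L[ℝ] W) (J : V →L[ℝ] V) : range T → range T :=
  fun w => ⟨T (J w.2.choose), mem_range_self _⟩

theorem pushforward_apply {ω : W →L[ℝ] W →L[ℝ] ℝ}
    {T : V →L[ℝ] W} {J : V →L[ℝ] V} (hJ : ∀ v, J (J v) = -v) (h : IsTame ω T J) (v : V) :
    (pushforward T J ⟨T v, mem_range_self v⟩ : W) = T (J v) := by
  have hker : ∀ u, T u = 0 → T (J u) = 0 := by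
    intro u hu
    by_contra hne
    have h1 := h (J u) hne
    rw [hJ, map_neg, hu, neg_zero, map_zero] at h1
    exact lt_irrefl _ h1
  have hs : T (Exists.choose (mem_range_self (f := T) v)) = T v :=
    Exists.choose_spec (mem_range_self (f := T) v)
  have h0 := hker (Exists.choose (mem_range_self (f := T) v) - v) (by rw [map_sub, hs, sub_self])
  rw [map_sub, map_sub, sub_eq_zero] at h0
  exact h0

end Linear

/-! ### Weak contractibility -/

/-- `Y` is nonempty and every map `S^m → Y`, `m ≥ 0`, is nullhomotopic. -/
def IsWeaklyContractible (Y : Type*) [TopologicalSpace Y] : Prop :=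
  Nonempty Y ∧ ∀ (m : ℕ) (f : C(Metric.sphere (0 : EuclideanSpace ℝ (Fin (m + 1))) 1, Y)),
    f.Nullhomotopic

/-! ### Bundles -/

variable {X : Type*} [TopologicalSpace X]
  {ME : Type*} [NormedAddCommGroup ME] [NormedSpace ℝ ME]
  {E : X → Type*} [∀ x, AddCommGroup (E x)] [∀ x, Module ℝ (E x)]
  [TopologicalSpace (TotalSpace ME E)] [∀ x, TopologicalSpace (E x)]
  [∀ x, IsTopologicalAddGroup (E x)] [∀ x, ContinuousSMul ℝ (E x)]
  [FiberBundle ME E] [VectorBundle ℝ ME E]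
  {MF : Type*} [NormedAddCommGroup MF] [NormedSpace ℝ MF]
  {F : X → Type*} [∀ x, AddCommGroup (F x)] [∀ x, Module ℝ (F x)]
  [TopologicalSpace (TotalSpace MF F)] [∀ x, TopologicalSpace (F x)]
  [∀ x, IsTopologicalAddGroup (F x)] [∀ x, ContinuousSMul ℝ (F x)]
  [FiberBundle MF F] [VectorBundle ℝ MF F]

/-- A fiber orientation of the bundle: orientations of the fibers that are locally constant in
local trivializations. -/
def IsFiberOrientation (ME : Type*) [NormedAddCommGroup ME] [NormedSpace ℝ ME]
    {E : X → Type*} [∀ x, AddCommGroup (E x)] [∀ x, Module ℝ (E x)]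
    [TopologicalSpace (TotalSpace ME E)] [∀ x, TopologicalSpace (E x)]
    [FiberBundle ME E] [VectorBundle ℝ ME E] {n : ℕ}
    (o : ∀ x, Orientation ℝ (E x) (Fin n × Fin 2)) : Prop :=
  ∀ x, ∃ s ∈ 𝓝 x, ∃ o₀ : Orientation ℝ ME (Fin n × Fin 2), ∀ y ∈ s,
    ∃ hy : y ∈ (trivializationAt ME E x).baseSet,
      Orientation.map (Fin n × Fin 2)
        ((trivializationAt ME E x).continuousLinearEquivAt ℝ y hy).toLinearEquiv (o y) = o₀

/-- A 2-form on the bundle: a continuous section of skew-symmetric bilinear forms. -/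
structure IsTwoForm (ME : Type*) [NormedAddCommGroup ME] [NormedSpace ℝ ME]
    {E : X → Type*} [∀ x, AddCommGroup (E x)] [∀ x, Module ℝ (E x)]
    [TopologicalSpace (TotalSpace ME E)] [∀ x, TopologicalSpace (E x)]
    [FiberBundle ME E] [VectorBundle ℝ ME E]
    (ω : ∀ x, E x →L[ℝ] E x →L[ℝ] ℝ) : Prop where
  continuous : Continuous fun x => TotalSpace.mk' (ME →L[ℝ] ME →L[ℝ] ℝ) x (ω x)
  alternating : ∀ x v, ω x v v = 0

/-- Complex structure on the oriented bundle `E|S`: continuous on `S`, fiberwise of square `-1`,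
and inducing the given orientation. Values of `J` off `S` are irrelevant. -/
structure IsComplexStructureOn (ME : Type*) [NormedAddCommGroup ME] [NormedSpace ℝ ME]
    {E : X → Type*} [∀ x, AddCommGroup (E x)] [∀ x, Module ℝ (E x)]
    [TopologicalSpace (TotalSpace ME E)] [∀ x, TopologicalSpace (E x)]
    [∀ x, IsTopologicalAddGroup (E x)] [∀ x, ContinuousSMul ℝ (E x)]
    [FiberBundle ME E] [VectorBundle ℝ ME E] {n : ℕ}
    (oE : ∀ x, Orientation ℝ (E x) (Fin n × Fin 2)) (S : Set X)
    (J : ∀ x, E x →L[ℝ] E x) : Prop where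
  continuousOn : ContinuousOn (fun x => TotalSpace.mk' (ME →L[ℝ] ME) x (J x)) S
  sq : ∀ x ∈ S, ∀ v, J x (J x v) = -v
  orientation : ∀ x ∈ S, InducesOrientation (oE x) (J x)

/-- `x` is regular if `T_x` is onto. -/
def IsRegular (T : ∀ x, E x →L[ℝ] F x) (x : X) : Prop := Function.Surjective (T x)

/-- The closure `P`, in the total space of `E`, of the union of the kernels of `T` at regular
points. -/
def limitKernel (ME : Type*) {E : X → Type*} [∀ x, AddCommGroup (E x)] [∀ x, Module ℝ (E x)]
    [TopologicalSpace (TotalSpace ME E)] [∀ x, TopologicalSpace (E x)]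
    (T : ∀ x, E x →L[ℝ] F x) : Set (TotalSpace ME E) :=
  closure {v | IsRegular T v.proj ∧ T v.proj v.2 = 0}

/-- `x` is wrapped if the span of `P_x` has real codimension at most 2 in `ker T_x` (in which it is
contained). -/
def IsWrapped (ME : Type*) {E : X → Type*} [∀ x, AddCommGroup (E x)] [∀ x, Module ℝ (E x)]
    [TopologicalSpace (TotalSpace ME E)] [∀ x, TopologicalSpace (E x)]
    (T : ∀ x, E x →L[ℝ] F x) (x : X) : Prop :=
  finrank ℝ (LinearMap.ker (T x : E x →ₗ[ℝ] F x)) ≤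
    finrank ℝ (Submodule.span ℝ {v : E x | TotalSpace.mk' ME x v ∈ limitKernel ME T}) + 2

/-- The set of unwrapped critical points. -/
def unwrappedCritical (ME : Type*) {E : X → Type*} [∀ x, AddCommGroup (E x)]
    [∀ x, Module ℝ (E x)] [TopologicalSpace (TotalSpace ME E)] [∀ x, TopologicalSpace (E x)]
    (T : ∀ x, E x →L[ℝ] F x) : Set X :=
  {x | ¬ IsRegular T x ∧ ¬ IsWrapped ME T x}

/-- The given local structures: a structure `JC` on `E|U`, for each `a ∉ U` an open neighborhood
`W a` with a structure `Jloc a` on `E|W a`, all satisfying the fiberwise condition `R`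
(compatibility or taming), such that those with `a ∈ V` induce structures on the image of `T`
that agree with each other and with that of `JC` wherever the domains overlap. -/
structure IsLocalData (ME : Type*) [NormedAddCommGroup ME] [NormedSpace ℝ ME]
    {E : X → Type*} [∀ x, AddCommGroup (E x)] [∀ x, Module ℝ (E x)]
    [TopologicalSpace (TotalSpace ME E)] [∀ x, TopologicalSpace (E x)]
    [∀ x, IsTopologicalAddGroup (E x)] [∀ x, ContinuousSMul ℝ (E x)]
    [FiberBundle ME E] [VectorBundle ℝ ME E] {n : ℕ}
    (oE : ∀ x, Orientation ℝ (E x) (Fin n × Fin 2)) (T : ∀ x, E x →L[ℝ] F x)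
    (R : ∀ x, (E x →L[ℝ] E x) → Prop) (C D U V : Set X) (W : X → Set X)
    (JC : ∀ x, E x →L[ℝ] E x) (Jloc : X → ∀ x, E x →L[ℝ] E x) : Prop where
  isOpen_U : IsOpen U
  subset_U : C ⊆ U
  isOpen_V : IsOpen V
  subset_V : D ⊆ V
  complex_C : IsComplexStructureOn ME oE U JC
  rel_C : ∀ x ∈ U, R x (JC x)
  isOpen_W : ∀ a ∉ U, IsOpen (W a)
  mem_W : ∀ a ∉ U, a ∈ W a
  complex_W : ∀ a ∉ U, IsComplexStructureOn ME oE (W a) (Jloc a)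
  rel_W : ∀ a ∉ U, ∀ x ∈ W a, R x (Jloc a x)
  agree_C : ∀ a ∈ V \ U, ∀ x ∈ W a ∩ U, pushforward (T x) (Jloc a x) = pushforward (T x) (JC x)
  agree_W : ∀ a ∈ V \ U, ∀ b ∈ V \ U, ∀ x ∈ W a ∩ W b,
    pushforward (T x) (Jloc a x) = pushforward (T x) (Jloc b x)

open Classical in
/-- The complex structure `J_D` on the fibers of `T(E|V)` resulting from the local structures (its
values off `V` are irrelevant): the one induced by `JC` over `U`, and by any `Jloc a` over `W a`,
for instance by `Jloc x` at `x ∈ V \ U`. -/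
def imageStructure (T : ∀ x, E x →L[ℝ] F x) (U : Set X)
    (JC : ∀ x, E x →L[ℝ] E x) (Jloc : X → ∀ x, E x →L[ℝ] E x) (x : X) :
    range (T x) → range (T x) :=
  pushforward (T x) (if x ∈ U then JC x else Jloc x x)

/-- All the given local structures are `ωE`-tame. -/
def LocallyTame (ωE : ∀ x, E x →L[ℝ] E x →L[ℝ] ℝ) (U : Set X) (W : X → Set X)
    (JC : ∀ x, E x →L[ℝ] E x) (Jloc : X → ∀ x, E x →L[ℝ] E x) : Prop :=
  (∀ x ∈ U, IsTame (ωE x) (ContinuousLinearMap.id ℝ (E x)) (JC x)) ∧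
  ∀ a ∉ U, ∀ x ∈ W a, IsTame (ωE x) (ContinuousLinearMap.id ℝ (E x)) (Jloc a x)

/-- `J` is a complex structure on `E` satisfying the fiberwise condition `R`, extending `JC|C`, and
with `T_*J|D = JD`. -/
structure IsGlobal (ME : Type*) [NormedAddCommGroup ME] [NormedSpace ℝ ME]
    {E : X → Type*} [∀ x, AddCommGroup (E x)] [∀ x, Module ℝ (E x)]
    [TopologicalSpace (TotalSpace ME E)] [∀ x, TopologicalSpace (E x)]
    [∀ x, IsTopologicalAddGroup (E x)] [∀ x, ContinuousSMul ℝ (E x)]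
    [FiberBundle ME E] [VectorBundle ℝ ME E] {n : ℕ}
    (oE : ∀ x, Orientation ℝ (E x) (Fin n × Fin 2)) (T : ∀ x, E x →L[ℝ] F x)
    (R : ∀ x, (E x →L[ℝ] E x) → Prop) (C D : Set X)
    (JC : ∀ x, E x →L[ℝ] E x) (JD : ∀ x, range (T x) → range (T x))
    (J : ∀ x, E x →L[ℝ] E x) : Prop where
  complex : IsComplexStructureOn ME oE univ J
  rel : ∀ x, R x (J x)
  eq_C : ∀ x ∈ C, J x = JC x
  eq_D : ∀ x ∈ D, pushforward (T x) (J x) = JD x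

/-- `J` is `ωE`-tame on all of `E`. -/
def GloballyTame (ωE : ∀ x, E x →L[ℝ] E x →L[ℝ] ℝ) (J : ∀ x, E x →L[ℝ] E x) : Prop :=
  ∀ x, IsTame (ωE x) (ContinuousLinearMap.id ℝ (E x)) (J x)

/-- The space of continuous sections `J` of `End E` with property `P`, as a subspace of the space of
maps from `X` to the total space of `End E` in the compact-open topology. -/
def sectionSpace (ME : Type*) [NormedAddCommGroup ME] [NormedSpace ℝ ME]
    {E : X → Type*} [∀ x, AddCommGroup (E x)] [∀ x, Module ℝ (E x)]
    [TopologicalSpace (TotalSpace ME E)] [∀ x, TopologicalSpace (E x)]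
    [∀ x, IsTopologicalAddGroup (E x)] [∀ x, ContinuousSMul ℝ (E x)]
    [FiberBundle ME E] [VectorBundle ℝ ME E] (P : (∀ x, E x →L[ℝ] E x) → Prop) :
    Set C(X, TotalSpace (ME →L[ℝ] ME) fun x => E x →L[ℝ] E x) :=
  {f | ∃ J : ∀ x, E x →L[ℝ] E x, (∀ x, f x = TotalSpace.mk' (ME →L[ℝ] ME) x (J x)) ∧ P J}

/-- With `X₀ = X - int C`: the space of all `J` with property `P` is weakly contractible when `X₀`
is locally compact, and contractible when `X₀` is compact. -/
def SectionsContractible (ME : Type*) [NormedAddCommGroup ME] [NormedSpace ℝ ME]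
    {E : X → Type*} [∀ x, AddCommGroup (E x)] [∀ x, Module ℝ (E x)]
    [TopologicalSpace (TotalSpace ME E)] [∀ x, TopologicalSpace (E x)]
    [∀ x, IsTopologicalAddGroup (E x)] [∀ x, ContinuousSMul ℝ (E x)]
    [FiberBundle ME E] [VectorBundle ℝ ME E] (C : Set X)
    (P : (∀ x, E x →L[ℝ] E x) → Prop) : Prop :=
  (LocallyCompactSpace ↥(interior C)ᶜ → IsWeaklyContractible (sectionSpace ME P)) ∧
  (CompactSpace ↥(interior C)ᶜ → ContractibleSpace (sectionSpace ME P))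

/-- A collar neighborhood `K` of `∂S` in `X - int S`, together with identifications of `E|K` and
`F|K` with `I × (E|∂S)` and `I × (F|∂S)` for which `T` and `ωF` are constant along each
`I × {y}`. -/
structure Collar (ME : Type*) [NormedAddCommGroup ME] [NormedSpace ℝ ME]
    {E : X → Type*} [∀ x, AddCommGroup (E x)] [∀ x, Module ℝ (E x)]
    [TopologicalSpace (TotalSpace ME E)] [∀ x, TopologicalSpace (E x)]
    (MF : Type*) [NormedAddCommGroup MF] [NormedSpace ℝ MF]
    {F : X → Type*} [∀ x, AddCommGroup (F x)] [∀ x, Module ℝ (F x)]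
    [TopologicalSpace (TotalSpace MF F)] [∀ x, TopologicalSpace (F x)]
    (T : ∀ x, E x →L[ℝ] F x) (ωF : ∀ x, F x →L[ℝ] F x →L[ℝ] ℝ) (S : Set X) where
  /-- the parametrization of `K` by `I × ∂S` -/
  toFun : I × frontier S → X
  isEmbedding : IsEmbedding toFun
  map_zero : ∀ y, toFun (0, y) = y
  range_subset : range toFun ⊆ (interior S)ᶜ
  map_one : frontier (((↑) : ↥(interior S)ᶜ → X) ⁻¹' range toFun) =
    ((↑) : ↥(interior S)ᶜ → X) ⁻¹' (toFun '' ({1} ×ˢ univ))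
  /-- the identification of `I × (E|∂S)` with `E|K` -/
  idE : ∀ p : I × frontier S, E p.2 ≃L[ℝ] E (toFun p)
  idE_continuous : Continuous fun q : I × {v : TotalSpace ME E // v.proj ∈ frontier S} =>
    TotalSpace.mk' ME (toFun (q.1, ⟨q.2.1.proj, q.2.2⟩)) (idE (q.1, ⟨q.2.1.proj, q.2.2⟩) q.2.1.2)
  idE_zero : ∀ (y : frontier S) (v : E y),
    TotalSpace.mk' ME (toFun (0, y)) (idE (0, y) v) = TotalSpace.mk' ME (y : X) v
  /-- the identification of `I × (F|∂S)` with `F|K` -/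
  idF : ∀ p : I × frontier S, F p.2 ≃L[ℝ] F (toFun p)
  idF_continuous : Continuous fun q : I × {v : TotalSpace MF F // v.proj ∈ frontier S} =>
    TotalSpace.mk' MF (toFun (q.1, ⟨q.2.1.proj, q.2.2⟩)) (idF (q.1, ⟨q.2.1.proj, q.2.2⟩) q.2.1.2)
  idF_zero : ∀ (y : frontier S) (v : F y),
    TotalSpace.mk' MF (toFun (0, y)) (idF (0, y) v) = TotalSpace.mk' MF (y : X) v
  T_const : ∀ p v, T (toFun p) (idE p v) = idF p (T p.2 v)
  ωF_const : ∀ p v w, ωF (toFun p) (idF p v) (idF p w) = ωF p.2 v w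

/-- The form `ωE` is constant along the collar lines. -/
def Collar.FormConst {T : ∀ x, E x →L[ℝ] F x} {ωF : ∀ x, F x →L[ℝ] F x →L[ℝ] ℝ} {S : Set X}
    (K : Collar ME MF T ωF S) (ωE : ∀ x, E x →L[ℝ] E x →L[ℝ] ℝ) : Prop :=
  ∀ p v w, ωE (K.toFun p) (K.idE p v) (K.idE p w) = ωE p.2 v w

/-- The structure `JD` on the image of `T` is constant along the collar lines. -/
def Collar.ImageConst {T : ∀ x, E x →L[ℝ] F x} {ωF : ∀ x, F x →L[ℝ] F x →L[ℝ] ℝ} {S : Set X}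
    (K : Collar ME MF T ωF S) (JD : ∀ x, range (T x) → range (T x)) : Prop :=
  ∀ (p : I × frontier S) (u : range (T p.2)) (u' : range (T (K.toFun p))),
    (u' : F (K.toFun p)) = K.idF p u → (JD (K.toFun p) u' : F (K.toFun p)) = K.idF p (JD p.2 u)

/-- `∂C ⊂ X - int C` and, if `D ≠ C`, `∂D ⊂ X - int D` have disjoint compatible collars, such that
the collar of `∂C` satisfies `Q`, and the collar of `∂C` (if `D = C`) or of `∂D` (if `D ≠ C`)
misses the set `A`. If `D ≠ C` then disjointness forces the collar of `∂C` into `int D`, where `JD`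
has to be constant along it; the collar of `∂D` meets `D` only in `∂D`. -/
def HasCollars (ME : Type*) [NormedAddCommGroup ME] [NormedSpace ℝ ME]
    {E : X → Type*} [∀ x, AddCommGroup (E x)] [∀ x, Module ℝ (E x)]
    [TopologicalSpace (TotalSpace ME E)] [∀ x, TopologicalSpace (E x)]
    (MF : Type*) [NormedAddCommGroup MF] [NormedSpace ℝ MF]
    {F : X → Type*} [∀ x, AddCommGroup (F x)] [∀ x, Module ℝ (F x)]
    [TopologicalSpace (TotalSpace MF F)] [∀ x, TopologicalSpace (F x)]
    (T : ∀ x, E x →L[ℝ] F x) (ωF : ∀ x, F x →L[ℝ] F x →L[ℝ] ℝ) (C D : Set X)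
    (JD : ∀ x, range (T x) → range (T x))
    (Q : Collar ME MF T ωF C → Prop) (A : Set X) : Prop :=
  ∃ K : Collar ME MF T ωF C, Q K ∧ (D = C → Disjoint (range K.toFun) A) ∧
    (D ≠ C → K.ImageConst JD ∧ ∃ L : Collar ME MF T ωF D,
      Disjoint (range K.toFun) (range L.toFun) ∧ Disjoint (range L.toFun) A)

/-- The `(ωF, T)`-compatible structure `J` on `E|N` (`N` open) is `(ωF, T)`-extendible along the
sequences of regular points `q x 0, q x 1, …` converging to `x`, one for each `x ∈ A`: for
`x ∈ A ∩ N` the structures `T_*J` on `F` at `q x i`, defined for large `i`, converge in the bundle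
`End F` to an `ωF`-tame complex structure on `F x`. -/
def IsExtendible (MF : Type*) [NormedAddCommGroup MF] [NormedSpace ℝ MF]
    {F : X → Type*} [∀ x, AddCommGroup (F x)] [∀ x, Module ℝ (F x)]
    [TopologicalSpace (TotalSpace MF F)] [∀ x, TopologicalSpace (F x)]
    [∀ x, IsTopologicalAddGroup (F x)] [∀ x, ContinuousSMul ℝ (F x)]
    [FiberBundle MF F] [VectorBundle ℝ MF F]
    (T : ∀ x, E x →L[ℝ] F x) (ωF : ∀ x, F x →L[ℝ] F x →L[ℝ] ℝ) (A : Set X) (q : X → ℕ → X)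
    (N : Set X) (J : ∀ x, E x →L[ℝ] E x) : Prop :=
  ∀ x ∈ A ∩ N, ∃ (B : ∀ i, F (q x i) →L[ℝ] F (q x i)) (B' : F x →L[ℝ] F x),
    (∀ᶠ i in atTop, ∀ v, B i (T (q x i) v) = T (q x i) (J (q x i) v)) ∧
    Tendsto (fun i => TotalSpace.mk' (MF →L[ℝ] MF) (E := fun y => F y →L[ℝ] F y) (q x i) (B i))
      atTop (𝓝 (TotalSpace.mk' (MF →L[ℝ] MF) (E := fun y => F y →L[ℝ] F y) x B')) ∧
    (∀ w, B' (B' w) = -w) ∧ IsTame (ωF x) (ContinuousLinearMap.id ℝ (F x)) B'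

end Splice

end

/-!
The set of complex structures on a vector space is not convex, but an operator `A` without real
eigenvalues determines a complex structure, its *phase* `A (-A²)^(-1/2)`. The phase depends
continuously on `A`, equals `A` if `A² = -1`, and is natural: if `T A = B T`, then `T` intertwines
the phases of `A` and `B` (`IsPhase.intertwine`). It is given by an integral whose integrand shows
that the phase inherits from `A` the property of being tame, and that it is skew with respect to a
form if `A` is (`IsPhase.tame`, `IsPhase.skew`). So local complex structures `J i` are spliced by
taking the phase of `∑ ρ i • J i` for a partition of unity `ρ` (`isGlobal_fiberPhase`,
`IsLocalData.exists_isGlobal`), and the space of all solutions is contracted to one solution `J₀`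
by the phases of `(1 - r) J₀ + r J` (`contractibleSpace_sectionSpace`). No compactness is needed for
the latter, since the phase is applied fiberwise and composition is continuous for the compact-open
topology.

The point is therefore that convex combinations `A` of tame complex structures inducing the same
orientation have no real eigenvalues (`IsControlled.noRealEigenvalue`). By tameness an eigenvector
with a real eigenvalue lies in `ker T`. At a regular point this is a plane, and it is preserved by
all structures. Two complex structures `J`, `J'` of the same orientation on a plane satisfy
`J J' + J' J = -2c` with `c ≥ 1`, so `A² = -d` with `d ≥ 1` on the plane
(`Cooriented.exists_anticommutator_eq`, `exists_sq_add_smul_mem`). That the orientations agree on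
`ker T` as well follows from their agreement on the whole fiber. This uses the condition
`det (L - J' L J) ≥ 0` for all `L`, which passes to a subspace if the segment from `J` to `J'` is
nonsingular on the quotient, and vice versa (`Cooriented.restrict`, `Cooriented.mapQ`).

At a critical point the structures are limits of structures at regular points.

* At a wrapped point `A²` has eigenvalues at most `-1` on the span of the limits of the kernels, and
  the argument for planes applies to the quotient of `ker T` by this span.
* In the other cases `|det (A² - t²)|` has a positive lower bound at regular points arbitrarily close
  to the critical one. The determinant is the product of one factor on `ker T`, which is at least `1`
  in absolute value, and the determinant on the fiber of `F`. The latter is likewise at least `1` in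
  absolute value if the fiber of `F` is a plane or if all structures induce the same complex
  structure on it, as they do over `D`. Along a sequence on which the induced structures converge to
  tame ones it has a nonzero limit.

For contractibility the structures are known to agree on the image of `T` only over `D` and not near
it. A collar shows that the frontier points of `D` are wrapped, too
(`Collar.isWrapped_of_forall_notMem`).
-/

noncomputable section

namespace Splice

/-! ### Pairs of complex structures on a vector space -/

section EndLinear

variable {V W : Type*} [AddCommGroup V] [Module ℝ V] [AddCommGroup W] [Module ℝ W]

/-- A map that commutes with `J` is complex linear, so its real determinant is the square of the absolute value of
its complex determinant. -/
theorem det_nonneg_of_commute [FiniteDimensional ℝ V] (J h : V →ₗ[ℝ] V) (hJ : ∀ v, J (J v) = -v)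
    (hc : ∀ v, h (J v) = J (h v)) : 0 ≤ LinearMap.det h := by
  have hJ' : (J : Module.End ℝ V) * J = -1 := LinearMap.ext fun v => by simp [hJ]
  let φ : ℂ →ₐ[ℝ] Module.End ℝ V := Complex.lift ⟨J, hJ'⟩
  let _ : Module ℂ V := Module.compHom V φ.toRingHom
  have hsmul : ∀ (z : ℂ) (v : V), z • v = z.re • v + z.im • J v := by
    intro z v
    change φ z v = _
    simp [φ, Complex.liftAux_apply, Algebra.algebraMap_eq_smul_one]
  have : IsScalarTower ℝ ℂ V := ⟨fun r z v => by
    rw [hsmul, hsmul, smul_add, smul_smul, smul_smul]; simp⟩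
  have : Module.Finite ℂ V := Module.Finite.of_restrictScalars_finite ℝ ℂ V
  let h' : V →ₗ[ℂ] V :=
    { toFun := h, map_add' := h.map_add, map_smul' := fun z v => by
        simp only [hsmul, RingHom.id_apply, map_add, map_smul, hc] }
  have : h = (h'.restrictScalars ℝ) := rfl
  rw [this, LinearMap.det_restrictScalars, Algebra.norm_complex_apply]
  exact Complex.normSq_nonneg _

/-- `det (L - J' L J) ≥ 0` for all `L`. For complex structures the maps `L - J' L J` are exactly the
maps `g` with `g J = J' g`, so this says that `J` and `J'` induce the same orientation. In this form the
condition passes to invariant subspaces and quotients. -/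
def Cooriented (J J' : V →ₗ[ℝ] V) : Prop :=
  ∀ L : V →ₗ[ℝ] V, 0 ≤ LinearMap.det (L - J' ∘ₗ L ∘ₗ J)

/-- No proper convex combination of `J` and `J'` has a kernel. -/
def NonsingularSegment (J J' : V →ₗ[ℝ] V) : Prop :=
  ∀ a b : ℝ, 0 ≤ a → 0 ≤ b → a + b = 1 → ∀ v, a • J v + b • J' v = 0 → v = 0

/-- The determinant of `(2 - s) - s J' J` is positive for `s = 0` and has no zeros for
`0 ≤ s ≤ 1`. -/
theorem NonsingularSegment.det_pos [FiniteDimensional ℝ V] {J J' : V →ₗ[ℝ] V}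
    (hJ : ∀ v, J (J v) = -v)
    (h : NonsingularSegment J J') : 0 < LinearMap.det (LinearMap.id - J' ∘ₗ J) := by
  let f : ℝ → (V →ₗ[ℝ] V) := fun s => (2 - s) • LinearMap.id - s • (J' ∘ₗ J)
  have hf : Continuous fun s => LinearMap.det (f s) := by
    let b := Module.finBasis ℝ V
    simp only [← LinearMap.det_toMatrix b, f, map_sub, map_smul]
    refine Continuous.matrix_det ?_
    fun_prop
  have hne : ∀ s ∈ Icc (0 : ℝ) 1, LinearMap.det (f s) ≠ 0 := by
    intro s hs h0
    obtain ⟨v, hv, hfv⟩ := Submodule.exists_mem_ne_zero_of_ne_bot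
      (LinearMap.bot_lt_ker_of_det_eq_zero h0).ne'
    refine hfv (?_ : v = 0)
    have h1 : (2 - s) • v = s • J' (J v) := by
      have := LinearMap.mem_ker.1 hv
      simpa [f, sub_eq_zero] using this
    have h2 := h ((2 - s) / 2) (s / 2) (by linarith [hs.2]) (by linarith [hs.1]) (by ring) (J v)
      (by
        rw [hJ, smul_neg, neg_add_eq_zero]
        have := congrArg (fun w => (2⁻¹ : ℝ) • w) h1
        simpa [smul_smul, div_eq_inv_mul] using this)
    have := hJ v
    rw [h2, map_zero] at this
    simpa using this.symm
  have h0 : 0 < LinearMap.det (f 0) := by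
    have : f 0 = (2 : ℝ) • LinearMap.id := by ext; simp [f]
    rw [this, LinearMap.det_smul, LinearMap.det_id]
    positivity
  have h1 : f 1 = LinearMap.id - J' ∘ₗ J := by
    ext v; simp only [f]; norm_num
  rw [← h1]
  by_contra hcon
  obtain ⟨s, hs, hs0⟩ := intermediate_value_Icc' zero_le_one hf.continuousOn
    (show (0 : ℝ) ∈ Icc _ _ from ⟨not_lt.1 hcon, h0.le⟩)
  exact hne s hs hs0

/-- A map `L` on `K` extends to a map on `V` that induces the identity on `V / K`. The determinant
of `L - J' L J` on `V` is the product of those on `K` and `V / K`, and the latter is positive. -/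
theorem Cooriented.restrict [FiniteDimensional ℝ V] {J J' : V →ₗ[ℝ] V} (h : Cooriented J J')
    (hsq : ∀ v, J (J v) = -v) (K : Submodule ℝ V) (hJ : ∀ v ∈ K, J v ∈ K) (hJ' : ∀ v ∈ K, J' v ∈ K)
    (hK : ∀ a b : ℝ, 0 ≤ a → 0 ≤ b → a + b = 1 → ∀ v, a • J v + b • J' v ∈ K → v ∈ K) :
    Cooriented (J.restrict hJ) (J'.restrict hJ') := by
  intro L
  obtain ⟨p, hp⟩ := K.subtype.exists_leftInverse_of_injective K.ker_subtype
  have hp' : ∀ (v : V) (hv : v ∈ K), p v = ⟨v, hv⟩ := fun v hv =>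
    LinearMap.congr_fun hp ⟨v, hv⟩
  let Lh : V →ₗ[ℝ] V := K.subtype ∘ₗ L ∘ₗ p + (LinearMap.id - K.subtype ∘ₗ p)
  have hLK : ∀ (v : V) (hv : v ∈ K), Lh v = L ⟨v, hv⟩ := by
    intro v hv
    simp [Lh, hp' v hv]
  have hLq : ∀ v, Lh v - v ∈ K := by
    intro v
    have : Lh v - v = L (p v) - p v := by simp [Lh]; abel
    rw [this]
    exact K.sub_mem (L (p v)).2 (p v).2
  set g := Lh - J' ∘ₗ Lh ∘ₗ J with hg
  have hgK : K ≤ K.comap g := fun v hv => by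
    simp only [Submodule.mem_comap, hg, LinearMap.sub_apply, LinearMap.comp_apply]
    rw [hLK v hv, hLK _ (hJ v hv)]
    exact K.sub_mem (L _).2 (hJ' _ (L _).2)
  have hdet := LinearMap.det_eq_det_mul_det K g hgK
  have e1 : g.restrict hgK = L - (J'.restrict hJ') ∘ₗ L ∘ₗ (J.restrict hJ) := by
    ext v
    simp [hg, hLK v v.2, hLK _ (hJ v v.2), LinearMap.restrict_apply]
  have e2 : K.mapQ K g hgK = LinearMap.id - (K.mapQ K J' hJ') ∘ₗ (K.mapQ K J hJ) := by
    ext v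
    simp only [LinearMap.comp_apply, Submodule.mkQ_apply, Submodule.mapQ_apply, LinearMap.sub_apply,
      LinearMap.id_apply, hg, ← Submodule.Quotient.mk_sub]
    rw [Submodule.Quotient.eq]
    have : Lh v - J' (Lh (J v)) - (v - J' (J v)) = (Lh v - v) - J' (Lh (J v) - J v) := by
      rw [map_sub]; abel
    rw [this]
    exact K.sub_mem (hLq _) (hJ' _ (hLq _))
  have hpos : 0 < LinearMap.det (K.mapQ K g hgK) := by
    rw [e2]
    refine NonsingularSegment.det_pos ?_ ?_
    · intro v
      obtain ⟨v, rfl⟩ := K.mkQ_surjective v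
      simp [hsq]
    · intro a b ha hb hab v hv
      obtain ⟨v, rfl⟩ := K.mkQ_surjective v
      simp only [Submodule.mkQ_apply, Submodule.mapQ_apply, ← Submodule.Quotient.mk_smul,
        ← Submodule.Quotient.mk_add, Submodule.Quotient.mk_eq_zero] at hv ⊢
      exact hK a b ha hb hab v hv
  have := h Lh
  rw [← hg, hdet, e1] at this
  exact nonneg_of_mul_nonneg_left this hpos

/-- A map `L` on `V / S` lifts to a map on `V` that is the identity on `S`. The determinant of
`L - J' L J` on `V` is the product of those on `S` and `V / S`, and the former is positive. -/
theorem Cooriented.mapQ [FiniteDimensional ℝ V] {J J' : V →ₗ[ℝ] V} (h : Cooriented J J')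
    (hsq : ∀ v, J (J v) = -v) (S : Submodule ℝ V) (hJ : S ≤ S.comap J) (hJ' : S ≤ S.comap J')
    (hS : ∀ a b : ℝ, 0 ≤ a → 0 ≤ b → a + b = 1 → ∀ v ∈ S, a • J v + b • J' v = 0 → v = 0) :
    Cooriented (S.mapQ S J hJ) (S.mapQ S J' hJ') := by
  intro L
  obtain ⟨r, hr⟩ := S.mkQ.exists_rightInverse_of_surjective S.range_mkQ
  have hr' : ∀ q, S.mkQ (r q) = q := fun q => LinearMap.congr_fun hr q
  let Lh : V →ₗ[ℝ] V := r ∘ₗ L ∘ₗ S.mkQ + (LinearMap.id - r ∘ₗ S.mkQ)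
  have hLS : ∀ v ∈ S, Lh v = v := by
    intro v hv
    have : S.mkQ v = 0 := by simpa using hv
    simp [Lh, LinearMap.comp_apply, this]
  have hLq : ∀ v, S.mkQ (Lh v) = L (S.mkQ v) := by
    intro v
    simp only [Lh, LinearMap.add_apply, LinearMap.comp_apply, map_add, LinearMap.sub_apply,
      LinearMap.id_apply, map_sub, hr']
    abel
  set g := Lh - J' ∘ₗ Lh ∘ₗ J with hg
  have hgS' : ∀ v ∈ S, g v = v - J' (J v) := fun v hv => by
    simp only [hg, LinearMap.sub_apply, LinearMap.comp_apply]
    rw [hLS v hv, hLS _ (hJ hv)]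
  have hgS : S ≤ S.comap g := fun v hv => by
    rw [Submodule.mem_comap, hgS' v hv]
    exact S.sub_mem hv (hJ' (hJ hv))
  have hdet := LinearMap.det_eq_det_mul_det S g hgS
  have e1 : S.mapQ S g hgS = L - (S.mapQ S J' hJ') ∘ₗ L ∘ₗ (S.mapQ S J hJ) := by
    have hcomm : ∀ v, S.mapQ S J' hJ' (S.mkQ v) = S.mkQ (J' v) := fun v => by simp
    refine Submodule.linearMap_qext _ (LinearMap.ext fun v => ?_)
    have h1 : (S.mapQ S J hJ) (S.mkQ v) = S.mkQ (J v) := by simp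
    have h2 : (S.mapQ S g hgS) (S.mkQ v) = S.mkQ (g v) := by simp
    simp only [LinearMap.comp_apply, LinearMap.sub_apply]
    rw [h1, h2, ← hLq, ← hLq, hcomm, ← map_sub]
    simp [hg]
  have e2 : g.restrict hgS =
      LinearMap.id - (J'.restrict hJ') ∘ₗ (J.restrict hJ) := by
    ext v
    simp [hgS' v v.2, LinearMap.restrict_apply]
  have hpos : 0 < LinearMap.det (g.restrict hgS) := by
    rw [e2]
    refine NonsingularSegment.det_pos ?_ ?_
    · intro v
      ext
      simp [LinearMap.restrict_apply, hsq]
    · intro a b ha hb hab v hv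
      ext
      refine hS a b ha hb hab v v.2 ?_
      simpa [LinearMap.restrict_apply] using congrArg Subtype.val hv
  have := h Lh
  rw [← hg, hdet, e1] at this
  exact nonneg_of_mul_nonneg_right this hpos

/-- In real dimension two, `c ≥ 1` is the reverse Cauchy-Schwarz inequality for the Lorentzian
form `det` on trace zero matrices, in which the two components of the hyperboloid `det = 1` are the
complex structures of either orientation. -/
theorem Cooriented.exists_anticommutator_eq [FiniteDimensional ℝ V] {J J' : V →ₗ[ℝ] V}
    (h : Cooriented J J') (hJ : ∀ v, J (J v) = -v) (hJ' : ∀ v, J' (J' v) = -v)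
    (hd : finrank ℝ V ≤ 2) :
    ∃ c : ℝ, 1 ≤ c ∧ ∀ v, J (J' v) + J' (J v) + (2 * c) • v = 0 := by
  by_cases hV : ∀ v : V, v = 0
  · exact ⟨1, le_rfl, fun v => hV _⟩
  push Not at hV
  obtain ⟨e, he⟩ := hV
  have hli : LinearIndependent ℝ ![e, J e] := by
    rw [LinearIndependent.pair_iff]
    intro s t hst
    have h2 : s • J e - t • e = 0 := by
      have := congrArg J hst
      simpa [hJ, sub_eq_add_neg] using this
    have h3 : (s * s + t * t) • e = 0 := by
      have h4 : (s * s + t * t) • e = s • (s • e + t • J e) - t • (s • J e - t • e) := by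
        simp only [smul_add, smul_sub, smul_smul, add_smul]
        rw [mul_comm t s]
        abel
      rw [h4, hst, h2]; simp
    rcases smul_eq_zero.1 h3 with h4 | h4
    · constructor <;> nlinarith [mul_self_nonneg s, mul_self_nonneg t]
    · exact absurd h4 he
  have hcard : Fintype.card (Fin 2) = finrank ℝ V := by
    have := hli.fintype_card_le_finrank
    simp at this ⊢; omega
  let b := basisOfLinearIndependentOfCardEqFinrank hli hcard
  have hb0 : b 0 = e := by simp [b]
  have hb1 : b 1 = J e := by simp [b]
  have hspan : ∀ v, v = b.repr v 0 • e + b.repr v 1 • J e := by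
    intro v
    conv_lhs => rw [← b.sum_repr v]
    rw [Fin.sum_univ_two, hb0, hb1]
  set α := b.repr (J' e) 0
  set β := b.repr (J' e) 1
  have hJe : J' e = α • e + β • J e := hspan _
  have hβ : 0 ≤ β := by
    -- this `L` carries `J` to `J'`, and `β` is its determinant
    let L : V →ₗ[ℝ] V := b.constr ℝ ![e, J' e]
    have hL0 : L e = e := by
      have := b.constr_basis ℝ ![e, J' e] 0
      rwa [hb0] at this
    have hL1 : L (J e) = J' e := by
      have := b.constr_basis ℝ ![e, J' e] 1
      rwa [hb1] at this
    have hg : L - J' ∘ₗ L ∘ₗ J = (2 : ℝ) • L := by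
      refine b.ext fun i => ?_
      fin_cases i
      · simp [hb0, hL0, hL1, hJ', two_smul]
      · simp [hb1, hL0, hL1, hJ, two_smul]
    have h1 := h L
    rw [hg, LinearMap.det_smul, ← LinearMap.det_toMatrix b, Matrix.det_fin_two] at h1
    simp only [LinearMap.toMatrix_apply, hb0, hb1, hL0, hL1] at h1
    have e0 : b.repr e = Finsupp.single 0 1 := by rw [← hb0, b.repr_self]
    have h2 : b.repr e 0 = 1 := by rw [e0]; simp
    have h3 : b.repr e 1 = 0 := by rw [e0]; simp
    rw [h2, h3] at h1
    have h5 : (0 : ℝ) < 2 ^ finrank ℝ V := by positivity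
    have := nonneg_of_mul_nonneg_right h1 h5
    simpa using this
  have hsq : J' (J' e) = -e := hJ' e
  have hβJ : β • J' (J e) = (-(1 + α * α)) • e - (α * β) • J e := by
    rw [hJe, map_add, map_smul, map_smul, hJe] at hsq
    have : β • J' (J e) = -e - α • (α • e + β • J e) := by rw [← hsq]; abel
    rw [this, smul_add, smul_smul, smul_smul, neg_smul, add_smul, one_smul]
    abel
  have hβ0 : β ≠ 0 := by
    intro h0
    rw [h0] at hβJ
    simp only [zero_smul, mul_zero, sub_zero] at hβJ
    rcases smul_eq_zero.1 hβJ.symm with h4 | h4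
    · nlinarith [mul_self_nonneg α]
    · exact he h4
  have hβ1 : 0 < β := lt_of_le_of_ne hβ (Ne.symm hβ0)
  have hJJ : J' (J e) = (-((1 + α * α) / β)) • e - α • J e := by
    have := congrArg (fun w => β⁻¹ • w) hβJ
    simp only [smul_smul, smul_sub, inv_mul_cancel₀ hβ0, one_smul] at this
    rw [this]
    congr 2
    · field_simp
    · field_simp
  refine ⟨(β + (1 + α * α) / β) / 2, ?_, fun v => ?_⟩
  · rw [le_div_iff₀ two_pos, one_mul, ← sub_nonneg]
    have : β + (1 + α * α) / β - 2 = ((β - 1) ^ 2 + α ^ 2) / β := by field_simp; ring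
    rw [this]; positivity
  · have key : J ∘ₗ J' + J' ∘ₗ J + (2 * ((β + (1 + α * α) / β) / 2)) • LinearMap.id = 0 := by
      refine b.ext fun i => ?_
      fin_cases i
      · simp only [Fin.zero_eta, hb0, LinearMap.add_apply, LinearMap.comp_apply, hJe, hJJ,
          LinearMap.smul_apply, LinearMap.id_apply, map_add, map_smul, hJ, LinearMap.zero_apply]
        module
      · simp only [Fin.mk_one, hb1, LinearMap.add_apply, LinearMap.comp_apply, hJe, hJJ, map_neg,
          LinearMap.smul_apply, LinearMap.id_apply, map_sub, map_smul, hJ, LinearMap.zero_apply]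
        module
    exact LinearMap.congr_fun key v

/-- The relative form of `Cooriented.exists_anticommutator_eq`, on an invariant subquotient `K / S`
of dimension at most two. -/
theorem Cooriented.exists_anticommutator_mem [FiniteDimensional ℝ V] {J J' : V →ₗ[ℝ] V}
    (h : Cooriented J J') (hsq : ∀ v, J (J v) = -v) (hsq' : ∀ v, J' (J' v) = -v)
    {S K : Submodule ℝ V} (hSK : S ≤ K) (hd : finrank ℝ K ≤ finrank ℝ S + 2)
    (hJS : ∀ v ∈ S, J v ∈ S) (hJS' : ∀ v ∈ S, J' v ∈ S)
    (hJK : ∀ v ∈ K, J v ∈ K) (hJK' : ∀ v ∈ K, J' v ∈ K)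
    (hS : ∀ a b : ℝ, 0 ≤ a → 0 ≤ b → a + b = 1 → ∀ v ∈ S, a • J v + b • J' v = 0 → v = 0)
    (hK : ∀ a b : ℝ, 0 ≤ a → 0 ≤ b → a + b = 1 → ∀ v, a • J v + b • J' v ∈ K → v ∈ K) :
    ∃ c : ℝ, 1 ≤ c ∧ ∀ v ∈ K, J (J' v) + J' (J v) + (2 * c) • v ∈ S := by
  have h1 := h.restrict hsq K hJK hJK' hK
  let S' : Submodule ℝ K := S.comap K.subtype
  have hS1 : S' ≤ S'.comap (J.restrict hJK) := fun v hv => hJS _ hv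
  have hS2 : S' ≤ S'.comap (J'.restrict hJK') := fun v hv => hJS' _ hv
  have h2 := h1.mapQ (fun v => Subtype.ext (hsq v)) S' hS1 hS2
    (fun a b ha hb hab v hv hv0 => Subtype.ext (hS a b ha hb hab v hv (congrArg Subtype.val hv0)))
  have hfin : finrank ℝ (K ⧸ S') ≤ 2 := by
    have e1 := S'.finrank_quotient_add_finrank
    have e2 : finrank ℝ S' = finrank ℝ S :=
      (Submodule.comapSubtypeEquivOfLe hSK).finrank_eq
    omega
  have hq : ∀ (G : V →ₗ[ℝ] V) (hG : ∀ v, G (G v) = -v) (hGK : ∀ v ∈ K, G v ∈ K)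
      (hGS : S' ≤ S'.comap (G.restrict hGK)) (v : K ⧸ S'),
      S'.mapQ S' (G.restrict hGK) hGS (S'.mapQ S' (G.restrict hGK) hGS v) = -v := by
    intro G hG hGK hGS v
    obtain ⟨v, rfl⟩ := S'.mkQ_surjective v
    simp only [Submodule.mkQ_apply, Submodule.mapQ_apply, ← Submodule.Quotient.mk_neg]
    congr 1
    exact Subtype.ext (hG v)
  obtain ⟨c, hc, hcv⟩ := h2.exists_anticommutator_eq (hq J hsq hJK hS1) (hq J' hsq' hJK' hS2) hfin
  refine ⟨c, hc, fun v hv => ?_⟩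
  have := hcv (S'.mkQ ⟨v, hv⟩)
  simp only [Submodule.mkQ_apply, Submodule.mapQ_apply, ← Submodule.Quotient.mk_smul,
    ← Submodule.Quotient.mk_add, Submodule.Quotient.mk_eq_zero] at this
  exact this

/-- If all pairs of the `J i` have anticommutators `-2c`, `c ≥ 1`, modulo `S`, then a convex
combination of the `J i` has square `-d`, `d ≥ 1`, modulo `S`. -/
theorem exists_sq_add_smul_mem {ι : Type*} {s : Finset ι} {w : ι → ℝ} (hw : ∀ i ∈ s, 0 ≤ w i)
    (hw1 : ∑ i ∈ s, w i = 1) {J : ι → V →ₗ[ℝ] V} {S K : Submodule ℝ V}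
    (h : ∀ i ∈ s, ∀ j ∈ s,
      ∃ c : ℝ, 1 ≤ c ∧ ∀ v ∈ K, J i (J j v) + J j (J i v) + (2 * c) • v ∈ S) :
    ∃ d : ℝ, 1 ≤ d ∧ ∀ v ∈ K,
      (∑ i ∈ s, w i • J i) ((∑ i ∈ s, w i • J i) v) + d • v ∈ S := by
  choose! c hc1 hc using h
  have hww : ∑ i ∈ s, ∑ j ∈ s, w i * w j = 1 := by
    rw [← Finset.sum_mul_sum, hw1, one_mul]
  refine ⟨∑ i ∈ s, ∑ j ∈ s, w i * w j * c i j, ?_, fun v hv => ?_⟩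
  · rw [← hww]
    refine Finset.sum_le_sum fun i hi => Finset.sum_le_sum fun j hj => ?_
    exact le_mul_of_one_le_right (mul_nonneg (hw i hi) (hw j hj)) (hc1 i hi j hj)
  · have e1 : (∑ i ∈ s, w i • J i) ((∑ i ∈ s, w i • J i) v) =
        ∑ i ∈ s, ∑ j ∈ s, (w i * w j) • J i (J j v) := by
      simp only [LinearMap.sum_apply, LinearMap.smul_apply, map_sum, map_smul, Finset.smul_sum,
        smul_smul]
      rw [Finset.sum_comm]
      refine Finset.sum_congr rfl fun i _ => Finset.sum_congr rfl fun j _ => ?_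
      rw [mul_comm]
    have e2 : ∑ i ∈ s, ∑ j ∈ s, (w i * w j) • J i (J j v) =
        ∑ i ∈ s, ∑ j ∈ s, (w i * w j) • J j (J i v) := by
      rw [Finset.sum_comm]
      refine Finset.sum_congr rfl fun i _ => Finset.sum_congr rfl fun j _ => ?_
      rw [mul_comm]
    have e3 : (∑ i ∈ s, w i • J i) ((∑ i ∈ s, w i • J i) v) +
        (∑ i ∈ s, ∑ j ∈ s, w i * w j * c i j) • v =
        ∑ i ∈ s, ∑ j ∈ s, (2⁻¹ * (w i * w j)) •
          (J i (J j v) + J j (J i v) + (2 * c i j) • v) := by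
      have e4 : (∑ i ∈ s, w i • J i) ((∑ i ∈ s, w i • J i) v) =
          (2⁻¹ : ℝ) • (∑ i ∈ s, ∑ j ∈ s, (w i * w j) • J i (J j v) +
            ∑ i ∈ s, ∑ j ∈ s, (w i * w j) • J j (J i v)) := by
        rw [e1, ← e2, ← two_smul ℝ, smul_smul]; norm_num
      rw [e4]
      simp only [smul_add, Finset.smul_sum, Finset.sum_smul, Finset.sum_add_distrib, smul_smul]
      congr 1
      refine Finset.sum_congr rfl fun i _ => Finset.sum_congr rfl fun j _ => ?_
      congr 1; ring
    rw [e3]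
    exact S.sum_mem fun i hi => S.sum_mem fun j hj => S.smul_mem _ (hc i hi j hj v hv)

/-- Eigenvectors of `B` with negative eigenvalues span no eigenvector with eigenvalue `r ≥ 0`. -/
theorem eq_zero_of_mem_span_of_eigenvectors {B : V →ₗ[ℝ] V} {P : Set V}
    (hP : ∀ v ∈ P, ∃ d : ℝ, 1 ≤ d ∧ B v = -(d • v)) {w : V} (hw : w ∈ Submodule.span ℝ P) {r : ℝ}
    (hr : 0 ≤ r) (hB : B w = r • w) : w = 0 := by
  have hind := (Module.End.eigenspaces_iSupIndep B) r
  refine (Submodule.disjoint_def.1 hind) w (Module.End.mem_eigenspace_iff.2 hB) ?_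
  refine (Submodule.span_le.2 fun v hv => ?_) hw
  obtain ⟨d, hd, hBv⟩ := hP v hv
  have hne : -d ≠ r := by intro h; linarith
  refine Submodule.mem_iSup_of_mem (-d) (Submodule.mem_iSup_of_mem hne ?_)
  exact Module.End.mem_eigenspace_iff.2 (by rw [hBv, neg_smul])

/-- The determinant of a map that covers `g` and is multiplication by `r` on the kernel. -/
theorem det_eq_det_ker_mul_det [FiniteDimensional ℝ V] [FiniteDimensional ℝ W] {T : V →ₗ[ℝ] W}
    (hT : Function.Surjective T)
    {f : V →ₗ[ℝ] V} {g : W →ₗ[ℝ] W} (h : ∀ v, T (f v) = g (T v)) {r : ℝ}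
    (hr : ∀ v, T v = 0 → f v = r • v) :
    LinearMap.det f = r ^ finrank ℝ (LinearMap.ker T) * LinearMap.det g := by
  have hK : ∀ v ∈ LinearMap.ker T, f v ∈ LinearMap.ker T := fun v hv => by
    rw [LinearMap.mem_ker, h, LinearMap.mem_ker.1 hv, map_zero]
  rw [LinearMap.det_eq_det_mul_det _ f hK]
  congr 1
  · have : f.restrict hK = r • LinearMap.id := by
      ext v
      simp [LinearMap.restrict_apply, hr v v.2]
    rw [this, LinearMap.det_smul, LinearMap.det_id, mul_one]
  · let e := T.quotKerEquivOfSurjective hT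
    rw [← LinearMap.det_conj _ e]
    congr 1
    refine LinearMap.ext fun w => ?_
    obtain ⟨v, rfl⟩ := hT w
    have : e.symm (T v) = (LinearMap.ker T).mkQ v := by
      rw [LinearEquiv.symm_apply_eq]; rfl
    simp only [LinearMap.comp_apply, LinearEquiv.coe_coe, this]
    change T (f v) = _
    rw [h]

/-- `A` has no real eigenvalues. -/
def NoRealEigenvalue (A : V →ₗ[ℝ] V) : Prop := ∀ (t : ℝ) (v : V), A v = t • v → v = 0

theorem noRealEigenvalue_of_sq {J : V →ₗ[ℝ] V} (hJ : ∀ v, J (J v) = -v) : NoRealEigenvalue J := by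
  intro t v hv
  have h := hJ v
  rw [hv, map_smul, hv, smul_smul, ← sub_eq_zero, sub_neg_eq_add] at h
  have h2 : (t * t + 1) • v = 0 := by rw [add_smul, one_smul, h]
  exact (smul_eq_zero.1 h2).resolve_left (by nlinarith [mul_self_nonneg t])

theorem noRealEigenvalue_of_det_ne_zero [FiniteDimensional ℝ V] {A : V →ₗ[ℝ] V}
    (h : ∀ t : ℝ, LinearMap.det (A ∘ₗ A - (t ^ 2) • LinearMap.id) ≠ 0) : NoRealEigenvalue A := by
  intro t v hv
  by_contra hne
  refine h t ?_
  by_contra h0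
  have hker : LinearMap.ker (A ∘ₗ A - (t ^ 2) • LinearMap.id) = ⊥ := by
    by_contra hk
    exact h0 (LinearMap.det_eq_zero_iff_ker_ne_bot.2 hk)
  refine hne ((LinearMap.ker_eq_bot'.1 hker) v ?_)
  simp [hv, smul_smul, pow_two]

theorem NoRealEigenvalue.eq_zero_of_sq {A : V →ₗ[ℝ] V} (h : NoRealEigenvalue A) {t : ℝ} {v : V}
    (hv : A (A v) = (t ^ 2) • v) : v = 0 := by
  -- `A v + t v` is an eigenvector with eigenvalue `t`, so it vanishes
  have h1 : A v + t • v = 0 := h t _ (by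
    rw [map_add, map_smul, hv, smul_add, smul_smul, pow_two, add_comm])
  exact h (-t) v (by rw [neg_smul]; exact eq_neg_of_add_eq_zero_left h1)

theorem NoRealEigenvalue.det_ne_zero [FiniteDimensional ℝ V] {A : V →ₗ[ℝ] V}
    (h : NoRealEigenvalue A) (t : ℝ) : LinearMap.det (A ∘ₗ A - (t ^ 2) • LinearMap.id) ≠ 0 := by
  intro h0
  obtain ⟨v, hv, hne⟩ := Submodule.exists_mem_ne_zero_of_ne_bot
    (LinearMap.bot_lt_ker_of_det_eq_zero h0).ne'
  exact hne (h.eq_zero_of_sq (t := t) (by simpa [sub_eq_zero] using LinearMap.mem_ker.1 hv))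

/-- The operators `a - b A²` on the segment from `1` to `-A²` are injective. -/
theorem NoRealEigenvalue.eq_zero_of_pencil {A : V →ₗ[ℝ] V} (hA : NoRealEigenvalue A) {a b : ℝ}
    (ha : 0 ≤ a) (hb : 0 ≤ b) (hab : a + b = 1) {v : V} (hv : a • v - b • A (A v) = 0) :
    v = 0 := by
  rw [sub_eq_zero] at hv
  rcases hb.eq_or_lt with hb0 | hb0
  · rw [← hb0, zero_smul] at hv
    refine (smul_eq_zero.1 hv).resolve_left ?_
    rw [← hb0] at hab; intro h0; rw [h0] at hab; norm_num at hab
  · refine hA.eq_zero_of_sq (t := Real.sqrt (a / b)) ?_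
    rw [Real.sq_sqrt (div_nonneg ha hb0.le), div_eq_inv_mul, mul_smul, hv, smul_smul,
      inv_mul_cancel₀ hb0.ne', one_smul]

end EndLinear

/-! ### Orientations induced by complex structures -/

section Orientation

variable {V : Type*} [AddCommGroup V] [Module ℝ V] [TopologicalSpace V] [FiniteDimensional ℝ V]
  {n : ℕ}

theorem orientation_eq_of_adapted {J : V →L[ℝ] V} (hJ : ∀ v, J (J v) = -v)
    {b b' : Basis (Fin n × Fin 2) ℝ V} (hb : ∀ i, b (i, 1) = J (b (i, 0)))
    (hb' : ∀ i, b' (i, 1) = J (b' (i, 0))) : b.orientation = b'.orientation := by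
  let h : V ≃ₗ[ℝ] V := b.equiv b' (Equiv.refl _)
  have hh : ∀ i, h (b i) = b' i := fun i => by simp [h]
  have hcomm : ∀ v, h (J v) = J (h v) := by
    intro v
    refine LinearMap.congr_fun (f := (h : V →ₗ[ℝ] V) ∘ₗ (J : V →ₗ[ℝ] V))
      (g := (J : V →ₗ[ℝ] V) ∘ₗ (h : V →ₗ[ℝ] V)) (b.ext ?_) v
    rintro ⟨i, k⟩
    fin_cases k
    · change h (J (b (i, 0))) = J (h (b (i, 0)))
      rw [← hb, hh, hh, hb']
    · change h (J (b (i, 1))) = J (h (b (i, 1)))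
      rw [hh, hb, hJ, hb', hJ, map_neg, hh]
  have hdet : 0 < LinearMap.det (h : V →ₗ[ℝ] V) :=
    lt_of_le_of_ne (det_nonneg_of_commute (J : V →ₗ[ℝ] V) h hJ hcomm)
      (LinearEquiv.isUnit_det' h).ne_zero.symm
  have hmap : b' = b.map h := Basis.eq_of_apply_eq fun i => by simp [hh]
  rw [hmap, Basis.orientation_map, eq_comm, Orientation.map_eq_iff_det_pos]
  · exact hdet
  · rw [finrank_eq_card_basis b]

theorem InducesOrientation.of_intertwine {o : Orientation ℝ V (Fin n × Fin 2)} {J J' : V →L[ℝ] V}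
    (h : InducesOrientation o J) {g : V →ₗ[ℝ] V} (hg : ∀ v, g (J v) = J' (g v))
    (hdet : 0 < LinearMap.det g) : InducesOrientation o J' := by
  obtain ⟨b, hb, hbo⟩ := h
  let e := LinearEquiv.ofIsUnitDet (f := g) (v := b) (v' := b) (by
    rw [LinearMap.det_toMatrix]; exact isUnit_iff_ne_zero.2 hdet.ne')
  have he : ∀ v, e v = g v := fun v => rfl
  refine ⟨b.map e, fun i => ?_, ?_⟩
  · simp only [Basis.map_apply, he, hb, hg]
  · rw [Basis.orientation_map, hbo, Orientation.map_eq_iff_det_pos]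
    · exact hdet
    · rw [finrank_eq_card_basis b]

/-- A map `g = L - J' L J` of negative determinant would carry a basis adapted to `J` to one adapted to
`J'` of the opposite orientation. -/
theorem InducesOrientation.cooriented {o : Orientation ℝ V (Fin n × Fin 2)} {J J' : V →L[ℝ] V}
    (h : InducesOrientation o J) (h' : InducesOrientation o J') (hJ : ∀ v, J (J v) = -v)
    (hJ' : ∀ v, J' (J' v) = -v) :
    Cooriented (J : V →ₗ[ℝ] V) (J' : V →ₗ[ℝ] V) := by
  intro L
  set g := L - (J' : V →ₗ[ℝ] V) ∘ₗ L ∘ₗ (J : V →ₗ[ℝ] V) with hgdef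
  by_contra hneg
  push Not at hneg
  have hg : ∀ v, g (J v) = J' (g v) := fun v => by
    simp only [hgdef, LinearMap.sub_apply, LinearMap.comp_apply, ContinuousLinearMap.coe_coe, hJ,
      map_neg, map_sub, hJ']
    abel
  obtain ⟨b, hb, hbo⟩ := h
  obtain ⟨b', hb', hbo'⟩ := h'
  let e := LinearEquiv.ofIsUnitDet (f := g) (v := b) (v' := b) (by
    rw [LinearMap.det_toMatrix]; exact isUnit_iff_ne_zero.2 hneg.ne)
  have he : ∀ v, e v = g v := fun v => rfl
  have h1 : (b.map e).orientation = b'.orientation :=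
    orientation_eq_of_adapted hJ' (fun i => by simp only [Basis.map_apply, he, hb, hg]) hb'
  rw [Basis.orientation_map, hbo, hbo', Orientation.map_eq_iff_det_pos] at h1
  · exact lt_asymm h1 hneg
  · rw [finrank_eq_card_basis b]

end Orientation

/-! ### The inverse square root as an integral -/

section InverseSquareRoot

variable {R : Type*} [NormedRing R] [NormedAlgebra ℝ R]

/-- The segment from `M` to `1`, parametrized by an angle. -/
def pencil (M : R) (θ : ℝ) : R := (Real.sin θ ^ 2) • (1 : R) + (Real.cos θ ^ 2) • M

/-- The segment from `M` to `1` consists of invertible elements. -/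
def SegmentUnits (M : R) : Prop := ∀ a b : ℝ, 0 ≤ a → 0 ≤ b → a + b = 1 → IsUnit (a • (1 : R) + b • M)

theorem SegmentUnits.pencil {M : R} (h : SegmentUnits M) (θ : ℝ) : IsUnit (pencil M θ) :=
  h _ _ (sq_nonneg _) (sq_nonneg _) (Real.sin_sq_add_cos_sq θ)

/-- The integral `∫ (sin² θ + cos² θ M)⁻¹ dθ` over `[0, π/2]`. The substitution `t = tan θ` turns it
into `∫ (t² + M)⁻¹ dt` over `[0, ∞)`, so it is `π / 2` times the inverse of the principal square
root of `M`. -/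
def invSqrtIntegral (M : R) : R := ∫ θ in (0 : ℝ)..(Real.pi / 2), Ring.inverse (pencil M θ)

theorem Continuous.pencil {X : Type*} [TopologicalSpace X] {f : X → R} {g : X → ℝ}
    (hf : Continuous f) (hg : Continuous g) : Continuous fun x => Splice.pencil (f x) (g x) := by
  have h1 : Continuous fun x => (Real.sin (g x) ^ 2) • (1 : R) :=
    ((Real.continuous_sin.comp hg).pow 2).smul continuous_const
  have h2 : Continuous fun x => (Real.cos (g x) ^ 2) • f x :=
    ((Real.continuous_cos.comp hg).pow 2).smul hf
  exact h1.add h2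

theorem continuous_inverse_comp {R : Type*} [NormedRing R] [CompleteSpace R]
    {X : Type*} [TopologicalSpace X] {f : X → R} (hf : Continuous f)
    (hu : ∀ x, IsUnit (f x)) : Continuous fun x => Ring.inverse (f x) := by
  rw [continuous_iff_continuousAt]
  intro x
  obtain ⟨u, hu'⟩ := hu x
  have := NormedRing.inverse_continuousAt u
  rw [hu'] at this
  exact ContinuousAt.comp (f := f) (g := Ring.inverse) this hf.continuousAt

theorem continuous_inverse_pencil [CompleteSpace R] {M : R} (h : SegmentUnits M) :
    Continuous fun θ => Ring.inverse (pencil M θ) :=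
  continuous_inverse_comp (Continuous.pencil continuous_const continuous_id) h.pencil

theorem continuousOn_invSqrtIntegral [CompleteSpace R] :
    ContinuousOn (invSqrtIntegral (R := R)) {M | SegmentUnits M} := by
  rw [continuousOn_iff_continuous_domRestrict]
  refine intervalIntegral.continuous_parametric_intervalIntegral_of_continuous'
    (f := fun (M : {M : R | SegmentUnits M}) θ => Ring.inverse (pencil (M : R) θ)) ?_ _ _
  exact continuous_inverse_comp
    (f := fun p : {M : R | SegmentUnits M} × ℝ => pencil (p.1 : R) p.2)
    (Continuous.pencil (continuous_subtype_val.comp continuous_fst) continuous_snd)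
    (fun p => p.1.2.pencil _)

theorem Commute.invSqrtIntegral [CompleteSpace R] {M B : R} (h : SegmentUnits M) (hB : Commute B M) :
    Commute B (invSqrtIntegral M) := by
  have hi : IntervalIntegrable (fun θ => Ring.inverse (pencil M θ)) MeasureTheory.volume 0
      (Real.pi / 2) := (continuous_inverse_pencil h).intervalIntegrable _ _
  have e1 := (ContinuousLinearMap.mul ℝ R B).intervalIntegral_comp_comm hi
  have e2 := ((ContinuousLinearMap.mul ℝ R).flip B).intervalIntegral_comp_comm hi
  simp only [ContinuousLinearMap.mul_apply', ContinuousLinearMap.flip_apply] at e1 e2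
  change B * Splice.invSqrtIntegral M = Splice.invSqrtIntegral M * B
  rw [Splice.invSqrtIntegral, ← e1, ← e2]
  refine intervalIntegral.integral_congr fun θ _ => ?_
  have : Commute B (Splice.pencil M θ) := by
    unfold Splice.pencil
    exact ((Commute.one_right B).smul_right _).add_right (hB.smul_right _)
  obtain ⟨u, hu⟩ := h.pencil θ
  simp only [← hu, Ring.inverse_unit] at this ⊢
  exact this.units_inv_right

theorem SegmentUnits.segment {M : R} (h : SegmentUnits M) {r : ℝ} (hr : r ∈ Icc (0 : ℝ) 1) :
    SegmentUnits ((1 - r) • (1 : R) + r • M) := by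
  intro a b ha hb hab
  have := h (a + b * (1 - r)) (b * r) (add_nonneg ha (mul_nonneg hb (by linarith [hr.2])))
    (mul_nonneg hb hr.1) (by linear_combination hab)
  convert this using 1
  module

/-- With `N = sin² θ + cos² θ M` the derivative of `sin θ cos θ N⁻¹` is
`2 cos² θ M N⁻² - N⁻¹`, and its integral over `[0, π/2]` is zero. -/
theorem two_smul_mul_integral [CompleteSpace R] {M : R} (h : SegmentUnits M) :
    (2 : ℝ) • (M * ∫ θ in (0 : ℝ)..(Real.pi / 2),
      (Real.cos θ ^ 2) • (Ring.inverse (pencil M θ) * Ring.inverse (pencil M θ))) =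
      invSqrtIntegral M := by
  have hc := continuous_inverse_pencil h
  have hcs : Continuous fun θ =>
      (Real.cos θ ^ 2) • (Ring.inverse (pencil M θ) * Ring.inverse (pencil M θ)) :=
    (Real.continuous_cos.pow 2).smul (hc.mul hc)
  have hder : ∀ θ, HasDerivAt (fun θ => (Real.sin θ * Real.cos θ) • Ring.inverse (pencil M θ))
      ((2 : ℝ) • (M * ((Real.cos θ ^ 2) • (Ring.inverse (pencil M θ) * Ring.inverse (pencil M θ))))
        - Ring.inverse (pencil M θ)) θ := by
    intro θ
    obtain ⟨u, hu⟩ := h.pencil θ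
    have hp : HasDerivAt (pencil M) ((2 * Real.sin θ * Real.cos θ) • (1 - M)) θ := by
      have h1 := ((Real.hasDerivAt_sin θ).pow 2).smul_const (1 : R)
      have h2 := ((Real.hasDerivAt_cos θ).pow 2).smul_const M
      refine (h1.add h2).congr_deriv ?_
      norm_num
      module
    have hinv : HasFDerivAt (𝕜 := ℝ) Ring.inverse _ (pencil M θ) := hu ▸ hasFDerivAt_ringInverse u
    have h3 := hinv.comp_hasDerivAt θ hp
    have h4 := ((Real.hasDerivAt_sin θ).mul (Real.hasDerivAt_cos θ)).smul h3
    refine h4.congr_deriv ?_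
    have hcomm : Commute M (↑u⁻¹ : R) := by
      refine Commute.units_inv_right ?_
      rw [hu]; unfold pencil
      exact ((Commute.one_right M).smul_right _).add_right ((Commute.refl M).smul_right _)
    have hN : (↑u⁻¹ : R) = ((Real.sin θ ^ 2) • (1 : R) + (Real.cos θ ^ 2) • M) *
        ((↑u⁻¹ : R) * ↑u⁻¹) := by
      have : (Real.sin θ ^ 2) • (1 : R) + (Real.cos θ ^ 2) • M = u := hu.symm
      rw [this, Units.mul_inv_cancel_left]
    simp only [Function.comp_apply, ← hu, Ring.inverse_unit, neg_apply, Pi.mul_apply,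
      ContinuousLinearMap.mulLeftRight_apply]
    have hMM : (↑u⁻¹ : R) * ((2 * Real.sin θ * Real.cos θ) • (1 - M)) * ↑u⁻¹ =
        (2 * Real.sin θ * Real.cos θ) • ((↑u⁻¹ : R) * ↑u⁻¹ - M * (↑u⁻¹ * ↑u⁻¹)) := by
      rw [mul_smul_comm, smul_mul_assoc, mul_sub, sub_mul, mul_one, ← hcomm.eq, mul_assoc M]
    rw [hMM]
    set w : R := (↑u⁻¹ : R) * ↑u⁻¹
    rw [add_mul, smul_mul_assoc, one_mul, smul_mul_assoc] at hN
    rw [hN, mul_smul_comm]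
    have h1 := Real.sin_sq_add_cos_sq θ
    match_scalars
    · linear_combination (-Real.sin θ ^ 2) * h1
    · linear_combination (Real.cos θ ^ 2) * h1
  have hcs2 : Continuous fun θ => (2 : ℝ) •
      (M * ((Real.cos θ ^ 2) • (Ring.inverse (pencil M θ) * Ring.inverse (pencil M θ)))) :=
    (continuous_const.mul hcs).const_smul (2 : ℝ)
  have hi : IntervalIntegrable (fun θ =>
      (Real.cos θ ^ 2) • (Ring.inverse (pencil M θ) * Ring.inverse (pencil M θ)))
      MeasureTheory.volume 0 (Real.pi / 2) := hcs.intervalIntegrable _ _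
  have e1 := (ContinuousLinearMap.mul ℝ R M).intervalIntegral_comp_comm hi
  simp only [ContinuousLinearMap.mul_apply'] at e1
  have e2 := intervalIntegral.integral_eq_sub_of_hasDerivAt (a := 0) (b := Real.pi / 2)
    (fun θ _ => hder θ)
    ((hcs2.sub hc).intervalIntegrable _ _)
  rw [intervalIntegral.integral_sub (hcs2.intervalIntegrable _ _)
    (hc.intervalIntegrable _ _), intervalIntegral.integral_smul, e1] at e2
  simp only [Real.sin_zero, Real.cos_pi_div_two, mul_zero, zero_mul, zero_smul, sub_zero] at e2
  exact sub_eq_zero.1 e2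

/-- The product is constant along the segment from `M` to `1`: its derivative vanishes by
`two_smul_mul_integral`, and at `1` its value is `(π / 2)²`. -/
theorem invSqrtIntegral_mul_self_mul [CompleteSpace R] {M : R} (h : SegmentUnits M) :
    invSqrtIntegral M * invSqrtIntegral M * M = ((Real.pi / 2) ^ 2) • (1 : R) := by
  let L : ℝ → R := fun r => (1 - r) • (1 : R) + r • M
  have hL : ∀ r ∈ Icc (0 : ℝ) 1, SegmentUnits (L r) := fun r hr => h.segment hr
  have hML : ∀ r, Commute M (L r) := fun r =>
    ((Commute.one_right M).smul_right _).add_right ((Commute.refl M).smul_right _)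
  let F : ℝ → R := fun r => invSqrtIntegral (L r)
  have hMF : ∀ r ∈ Icc (0 : ℝ) 1, Commute M (F r) := fun r hr =>
    Commute.invSqrtIntegral (hL r hr) (hML r)
  let H : ℝ → ℝ → R := fun s r => ∫ θ in (0 : ℝ)..(Real.pi / 2),
    (Real.cos θ ^ 2) • (Ring.inverse (pencil (L r) θ) * Ring.inverse (pencil (L s) θ))
  have hLc : Continuous L := by fun_prop
  have hHc : ∀ s ∈ Icc (0 : ℝ) 1, ContinuousOn (H s) (Icc 0 1) := by
    intro s hs
    rw [continuousOn_iff_continuous_domRestrict]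
    refine intervalIntegral.continuous_parametric_intervalIntegral_of_continuous'
      (f := fun (r : Icc (0 : ℝ) 1) θ => (Real.cos θ ^ 2) •
        (Ring.inverse (pencil (L r) θ) * Ring.inverse (pencil (L s) θ))) ?_ _ _
    have h1 : Continuous fun p : Icc (0 : ℝ) 1 × ℝ => Ring.inverse (pencil (L p.1) p.2) :=
      continuous_inverse_comp (f := fun p : Icc (0 : ℝ) 1 × ℝ => pencil (L p.1) p.2)
        (Continuous.pencil (hLc.comp (continuous_subtype_val.comp continuous_fst)) continuous_snd)
        (fun p => (hL _ p.1.2).pencil _)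
    have h2 : Continuous fun p : Icc (0 : ℝ) 1 × ℝ => Ring.inverse (pencil (L s) p.2) :=
      (continuous_inverse_pencil (hL s hs)).comp continuous_snd
    exact ((Real.continuous_cos.comp continuous_snd).pow 2).smul (h1.mul h2)
  -- the resolvent identity, integrated; it yields the derivative of `F` without differentiating
  -- under the integral sign
  have hdiff : ∀ s ∈ Icc (0 : ℝ) 1, ∀ r ∈ Icc (0 : ℝ) 1,
      F r - F s = (r - s) • ((1 - M) * H s r) := by
    intro s hs r hr
    have hcr := continuous_inverse_pencil (hL r hr)
    have hcs := continuous_inverse_pencil (hL s hs)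
    have hcH : Continuous fun θ => (Real.cos θ ^ 2) •
        (Ring.inverse (pencil (L r) θ) * Ring.inverse (pencil (L s) θ)) :=
      (Real.continuous_cos.pow 2).smul (hcr.mul hcs)
    have e1 := (ContinuousLinearMap.mul ℝ R (1 - M)).intervalIntegral_comp_comm
      (hcH.intervalIntegrable (μ := MeasureTheory.volume) 0 (Real.pi / 2))
    simp only [ContinuousLinearMap.mul_apply'] at e1
    simp only [F, H, invSqrtIntegral]
    rw [← intervalIntegral.integral_sub (hcr.intervalIntegrable _ _) (hcs.intervalIntegrable _ _),
      ← e1, ← intervalIntegral.integral_smul]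
    refine intervalIntegral.integral_congr fun θ _ => ?_
    obtain ⟨u, hu⟩ := (hL r hr).pencil θ
    obtain ⟨v, hv⟩ := (hL s hs).pencil θ
    have hcomm : Commute (1 - M) (↑u⁻¹ : R) := by
      refine Commute.units_inv_right ?_
      rw [hu]; unfold Splice.pencil
      exact ((Commute.one_right _).smul_right _).add_right
        (((Commute.one_left _).sub_left (hML r)).smul_right _)
    have hvu : (v : R) - u = ((r - s) * Real.cos θ ^ 2) • (1 - M) := by
      rw [hu, hv]; simp only [Splice.pencil, L]; module
    have e2 : (↑u⁻¹ : R) - ↑v⁻¹ = ↑u⁻¹ * (v - u) * ↑v⁻¹ := by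
      rw [mul_sub, sub_mul, mul_assoc, Units.mul_inv, mul_one, Units.inv_mul, one_mul]
    simp only [← hu, ← hv, Ring.inverse_unit]
    rw [e2, hvu, mul_smul_comm, smul_mul_assoc, ← hcomm.eq, mul_smul_comm, smul_smul, mul_assoc]
  have hF : ∀ s ∈ Icc (0 : ℝ) 1, HasDerivWithinAt F ((1 - M) * H s s) (Icc 0 1) s := by
    intro s hs
    rw [hasDerivWithinAt_iff_tendsto_slope]
    have h1 : Tendsto (fun r => (1 - M) * H s r) (𝓝[Icc 0 1 \ {s}] s) (𝓝 ((1 - M) * H s s)) :=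
      ((hHc s hs s hs).mono sdiff_subset).tendsto.const_mul _
    refine h1.congr' ?_
    filter_upwards [self_mem_nhdsWithin] with r hr
    have hrs : r - s ≠ 0 := sub_ne_zero.2 hr.2
    rw [slope_def_module, hdiff s hs r hr.1, smul_smul, inv_mul_cancel₀ hrs, one_smul]
  have hG : ∀ s ∈ Icc (0 : ℝ) 1,
      HasDerivWithinAt (fun r => F r * F r * L r) 0 (Icc 0 1) s := by
    intro s hs
    have hLd : HasDerivWithinAt L (M - 1) (Icc 0 1) s := by
      have h1 := ((hasDerivAt_id s).const_sub 1).smul_const (1 : R)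
      have h2 := (hasDerivAt_id s).smul_const M
      refine ((h1.add h2).congr_deriv ?_).hasDerivWithinAt
      module
    refine (((hF s hs).mul (hF s hs)).mul hLd).congr_deriv ?_
    have hH := two_smul_mul_integral (hL s hs)
    change (2 : ℝ) • (L s * H s s) = F s at hH
    have hM1 : ∀ B, Commute M B → Commute (1 - M) B := fun B hB => (Commute.one_left _).sub_left hB
    have c1 : Commute (L s) (F s) := Commute.invSqrtIntegral (hL s hs) (Commute.refl _)
    have c2 : Commute (1 - M) (F s) := hM1 _ (hMF s hs)
    have c3 : Commute (1 - M) (L s) := hM1 _ (hML s)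
    have hX : (2 : ℝ) • (L s * ((1 - M) * H s s)) = (1 - M) * F s := by
      rw [← mul_assoc, ← c3.eq, mul_assoc, ← mul_smul_comm, hH]
    have hcLH : Commute (L s) (H s s) := by
      obtain ⟨l, hl⟩ : IsUnit (L s) := by simpa using hL s hs 0 1 le_rfl zero_le_one (by norm_num)
      have e1 : H s s = ↑l⁻¹ * ((2 : ℝ)⁻¹ • F s) := by
        rw [← hH, smul_smul, inv_mul_cancel₀ two_ne_zero, one_smul, ← hl, Units.inv_mul_cancel_left]
      rw [e1]
      refine Commute.mul_right ?_ (c1.smul_right _)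
      rw [← hl]
      exact Commute.units_inv_right (Commute.refl _)
    have hcXL : (1 - M) * H s s * L s = L s * ((1 - M) * H s s) :=
      (c3.symm.mul_right hcLH).eq.symm
    set X := (1 - M) * H s s
    have hX' : L s * X = (2 : ℝ)⁻¹ • ((1 - M) * F s) := by
      rw [← hX, smul_smul, inv_mul_cancel₀ two_ne_zero, one_smul]
    have e1 : X * F s * L s = (2 : ℝ)⁻¹ • ((1 - M) * F s * F s) := by
      rw [mul_assoc, ← c1.eq, ← mul_assoc, hcXL, hX', smul_mul_assoc]
    have e2 : F s * X * L s = (2 : ℝ)⁻¹ • ((1 - M) * F s * F s) := by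
      rw [mul_assoc, hcXL, hX', mul_smul_comm, ← mul_assoc, c2.eq]
    have e3 : F s * F s * (M - 1) = -((1 - M) * F s * F s) := by
      rw [← neg_sub, mul_neg, mul_assoc, ← c2.eq, ← mul_assoc, ← c2.eq]
    rw [Pi.mul_apply, add_mul, e1, e2, e3, ← two_smul ℝ, smul_smul, mul_inv_cancel₀ two_ne_zero, one_smul,
      add_neg_cancel]
  have hconst := constant_of_derivWithin_zero (fun s hs => (hG s hs).differentiableWithinAt)
    (fun s hs => (hG s ⟨hs.1, hs.2.le⟩).derivWithin
      (uniqueDiffOn_Icc zero_lt_one s ⟨hs.1, hs.2.le⟩)) 1 (right_mem_Icc.2 zero_le_one)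
  have hL0 : L 0 = 1 := by simp [L]
  have hL1 : L 1 = M := by simp [L]
  have hF0 : F 0 = (Real.pi / 2) • (1 : R) := by
    simp only [F, hL0, invSqrtIntegral, Splice.pencil, ← add_smul, Real.sin_sq_add_cos_sq, one_smul,
      Ring.inverse_one, intervalIntegral.integral_const, sub_zero]
  simp only [F, hL1] at hconst
  rw [hconst]
  change F 0 * F 0 * L 0 = _
  rw [hF0, hL0, mul_one, smul_mul_smul_comm, mul_one, pow_two]

end InverseSquareRoot

/-! ### The phase of an operator -/

section Phase

variable {V : Type*} [NormedAddCommGroup V] [NormedSpace ℝ V] [FiniteDimensional ℝ V]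

/-- The complex structure determined by an operator `A` without real eigenvalues: it commutes with
`A`, and its `i`-eigenspace is the sum of the generalized eigenspaces of `A` for the eigenvalues in
the upper half plane. It is `A (-A²)^(-1/2)`, with the principal square root. -/
def phase (A : V →L[ℝ] V) : V →L[ℝ] V := (2 / Real.pi) • (A * invSqrtIntegral (-(A * A)))

theorem NoRealEigenvalue.segmentUnits {A : V →L[ℝ] V}
    (h : NoRealEigenvalue (A : V →ₗ[ℝ] V)) : SegmentUnits (-(A * A)) := by
  have : CompleteSpace V := FiniteDimensional.complete ℝ V
  intro a b ha hb hab
  rw [ContinuousLinearMap.isUnit_iff_bijective]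
  set N : V →L[ℝ] V := a • (1 : V →L[ℝ] V) + b • -(A * A) with hN
  have hinj : Function.Injective (N : V →ₗ[ℝ] V) := by
    rw [injective_iff_map_eq_zero]
    intro v hv
    refine h.eq_zero_of_pencil ha hb hab ?_
    rw [sub_eq_add_neg, ← smul_neg]
    exact hv
  exact ⟨hinj, LinearMap.injective_iff_surjective.1 hinj⟩

theorem phase_apply_phase {A : V →L[ℝ] V} (h : NoRealEigenvalue (A : V →ₗ[ℝ] V)) (v : V) :
    phase A (phase A v) = -v := by
  have : CompleteSpace V := FiniteDimensional.complete ℝ V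
  have hA : Commute A (invSqrtIntegral (-(A * A))) :=
    Commute.invSqrtIntegral h.segmentUnits ((Commute.refl A).mul_right (Commute.refl A)).neg_right
  have key : phase A * phase A = -1 := by
    have h1 := invSqrtIntegral_mul_self_mul h.segmentUnits
    set f := invSqrtIntegral (-(A * A))
    have h2 : A * f * (A * f) = -((Real.pi / 2) ^ 2 • (1 : V →L[ℝ] V)) := by
      rw [← h1, mul_neg, neg_neg, hA.symm.mul_mul_mul_comm]
      exact ((hA.mul_left hA).mul_right (hA.mul_left hA)).eq
    rw [phase, smul_mul_smul_comm, h2, smul_neg, smul_smul]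
    have hpi := Real.pi_ne_zero
    rw [show 2 / Real.pi * (2 / Real.pi) * (Real.pi / 2) ^ 2 = 1 by field_simp, one_smul]
  exact congrArg (fun B : V →L[ℝ] V => B v) key

theorem continuousOn_phase :
    ContinuousOn (phase (V := V)) {A | NoRealEigenvalue (A : V →ₗ[ℝ] V)} := by
  have : CompleteSpace V := FiniteDimensional.complete ℝ V
  have h1 : ContinuousOn (fun A : V →L[ℝ] V => invSqrtIntegral (-(A * A)))
      {A | NoRealEigenvalue (A : V →ₗ[ℝ] V)} :=
    continuousOn_invSqrtIntegral.comp (by fun_prop) fun A hA => hA.segmentUnits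
  exact (continuousOn_id.mul h1).const_smul (2 / Real.pi)

end Phase

/-! ### Naturality, taming and compatibility of the phase -/

section IsPhase

variable {V W : Type*} [AddCommGroup V] [Module ℝ V] [AddCommGroup W] [Module ℝ W]

/-- `J` is given by the integral formula for `phase A`, in the weak sense, with `w θ` a right
inverse of `sin² θ - cos² θ A²`. Unlike `phase` this needs no norm, so that it makes sense on the
fibers of a bundle. -/
def IsPhase (A J : V →ₗ[ℝ] V) : Prop :=
  ∃ w : ℝ → V → V,
    (∀ θ v, (Real.sin θ ^ 2) • w θ v - (Real.cos θ ^ 2) • A (A (w θ v)) = v) ∧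
    ∀ (φ : V →ₗ[ℝ] ℝ) (v : V), Continuous (fun θ => φ (A (w θ v))) ∧
      φ (J v) = 2 / Real.pi * ∫ θ in (0 : ℝ)..(Real.pi / 2), φ (A (w θ v))

theorem NoRealEigenvalue.isPhase {V : Type*} [NormedAddCommGroup V] [NormedSpace ℝ V]
    [FiniteDimensional ℝ V] {A : V →L[ℝ] V} (h : NoRealEigenvalue (A : V →ₗ[ℝ] V)) :
    IsPhase (A : V →ₗ[ℝ] V) (phase A) := by
  have : CompleteSpace V := FiniteDimensional.complete ℝ V
  have hc := continuous_inverse_pencil h.segmentUnits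
  refine ⟨fun θ v => Ring.inverse (pencil (-(A * A)) θ) v, fun θ v => ?_, fun φ v => ?_⟩
  · have := Ring.mul_inverse_cancel _ (h.segmentUnits.pencil θ)
    have := congrArg (fun B : V →L[ℝ] V => B v) this
    simpa [pencil, sub_eq_add_neg] using this
  · let ψ : (V →L[ℝ] V) →L[ℝ] ℝ :=
      (LinearMap.toContinuousLinearMap φ ∘L A) ∘L (ContinuousLinearMap.apply ℝ V v)
    have hψ : ∀ B : V →L[ℝ] V, ψ B = φ (A (B v)) := fun B => rfl
    refine ⟨ψ.continuous.comp hc, ?_⟩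
    have e1 := ψ.intervalIntegral_comp_comm
      (hc.intervalIntegrable (μ := MeasureTheory.volume) 0 (Real.pi / 2))
    simp only [hψ] at e1
    simp only [ContinuousLinearMap.coe_coe]
    rw [e1]
    simp [phase, invSqrtIntegral]

theorem IsPhase.conj {A J : V →ₗ[ℝ] V} (h : IsPhase A J) (e : V ≃ₗ[ℝ] W) :
    IsPhase (e.toLinearMap ∘ₗ A ∘ₗ e.symm.toLinearMap)
      (e.toLinearMap ∘ₗ J ∘ₗ e.symm.toLinearMap) := by
  obtain ⟨w, hw, hφ⟩ := h
  refine ⟨fun θ v => e (w θ (e.symm v)), fun θ v => ?_, fun φ v => ?_⟩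
  · have := congrArg e (hw θ (e.symm v))
    simpa using this
  · simpa using hφ (φ ∘ₗ e.toLinearMap) (e.symm v)

/-- Taking phases is natural: a map that carries `A` to `B` carries the phase of `A` to that of
`B`. -/
theorem IsPhase.intertwine {A J : V →ₗ[ℝ] V} {B K : W →ₗ[ℝ] W} (h : IsPhase A J) (h' : IsPhase B K)
    (hB : NoRealEigenvalue B) {T : V →ₗ[ℝ] W} (hT : ∀ v, T (A v) = B (T v)) (v : V) :
    T (J v) = K (T v) := by
  obtain ⟨w, hw, hφ⟩ := h
  obtain ⟨w', hw', hφ'⟩ := h'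
  rw [← sub_eq_zero, ← Module.forall_dual_apply_eq_zero_iff ℝ]
  intro φ
  have key : ∀ θ, T (w θ v) = w' θ (T v) := by
    intro θ
    rw [← sub_eq_zero]
    refine hB.eq_zero_of_pencil (sq_nonneg (Real.sin θ)) (sq_nonneg (Real.cos θ))
      (Real.sin_sq_add_cos_sq θ) ?_
    have h1 := congrArg T (hw θ v)
    simp only [map_sub, map_smul, hT] at h1
    have h2 := hw' θ (T v)
    simp only [map_sub, smul_sub]
    rw [sub_sub_sub_comm, h1, h2, sub_self]
  rw [map_sub, sub_eq_zero, (hφ' φ (T v)).2]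
  have := (hφ (φ ∘ₗ T) v).2
  simp only [LinearMap.comp_apply, hT, key] at this
  exact this

theorem IsPhase.eq {A J K : V →ₗ[ℝ] V} (h : IsPhase A J) (h' : IsPhase A K)
    (hA : NoRealEigenvalue A) (v : V) : J v = K v :=
  h.intertwine h' hA (T := LinearMap.id) (fun _ => rfl) v

theorem isPhase_self {J : V →ₗ[ℝ] V} (hJ : ∀ v, J (J v) = -v) : IsPhase J J := by
  refine ⟨fun θ v => v, fun θ v => ?_, fun φ v => ⟨continuous_const, ?_⟩⟩
  · rw [hJ, smul_neg, sub_neg_eq_add, ← add_smul, Real.sin_sq_add_cos_sq, one_smul]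
  · have := Real.pi_ne_zero
    rw [intervalIntegral.integral_const, sub_zero, smul_eq_mul]
    field_simp

/-- With `w = (sin² - cos² A²)⁻¹ v`, the integrand of `ω (T v) (T (phase A v))` is
`sin² ω(Tw, TAw) + cos² ω(TAw, TAAw)`. -/
theorem IsPhase.tame {A J : V →ₗ[ℝ] V} (h : IsPhase A J) {T : V →ₗ[ℝ] W}
    {ω : W →ₗ[ℝ] W →ₗ[ℝ] ℝ} (hω : ∀ a b, ω a b = -ω b a)
    (hA : ∀ v, T v ≠ 0 → 0 < ω (T v) (T (A v))) (hker : ∀ v, T v = 0 → T (A v) = 0) {v : V}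
    (hv : T v ≠ 0) : 0 < ω (T v) (T (J v)) := by
  obtain ⟨w, hw, hφ⟩ := h
  obtain ⟨hc, hint⟩ := hφ (ω (T v) ∘ₗ T) v
  simp only [LinearMap.comp_apply] at hc hint
  rw [hint]
  refine mul_pos (div_pos two_pos Real.pi_pos) ?_
  refine intervalIntegral.intervalIntegral_pos_of_pos_on (hc.intervalIntegrable _ _) ?_
    (div_pos Real.pi_pos two_pos)
  intro θ hθ
  have hA0 : ∀ v, 0 ≤ ω (T v) (T (A v)) := fun v => by
    by_cases h0 : T v = 0
    · simp [h0]
    · exact (hA v h0).le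
  have hsin : 0 < Real.sin θ := Real.sin_pos_of_pos_of_lt_pi hθ.1 (by linarith [hθ.2, Real.pi_pos])
  have hTw : T (w θ v) ≠ 0 := by
    intro h0
    apply hv
    rw [← hw θ v, map_sub, map_smul, map_smul, h0, hker _ (hker _ h0)]
    simp
  have e1 : ω (T v) (T (A (w θ v))) = Real.sin θ ^ 2 * ω (T (w θ v)) (T (A (w θ v))) +
      Real.cos θ ^ 2 * ω (T (A (w θ v))) (T (A (A (w θ v)))) := by
    have hTv := congrArg T (hw θ v)
    rw [← hTv]
    simp only [map_sub, map_smul, LinearMap.sub_apply, LinearMap.smul_apply, smul_eq_mul]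
    rw [hω (T (A (A (w θ v)))) (T (A (w θ v)))]
    ring
  rw [e1]
  exact add_pos_of_pos_of_nonneg (mul_pos (pow_pos hsin 2) (hA _ hTw))
    (mul_nonneg (sq_nonneg _) (hA0 _))

/-- If `A` lies in the Lie algebra of the group preserving `T^*ω`, then so does its phase. -/
theorem IsPhase.skew {A J : V →ₗ[ℝ] V} (h : IsPhase A J) {T : V →ₗ[ℝ] W}
    {ω : W →ₗ[ℝ] W →ₗ[ℝ] ℝ} (hω : ∀ a b, ω a b = -ω b a)
    (hA : ∀ u v, ω (T (A u)) (T v) = -ω (T u) (T (A v))) (u v : V) :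
    ω (T (J u)) (T v) = -ω (T u) (T (J v)) := by
  obtain ⟨w, hw, hφ⟩ := h
  have h1 := (hφ (ω (T u) ∘ₗ T) v).2
  have h2 := (hφ (ω (T v) ∘ₗ T) u).2
  simp only [LinearMap.comp_apply] at h1 h2
  rw [hω, h1, h2]
  congr 2
  refine intervalIntegral.integral_congr fun θ _ => ?_
  have e : ∀ a b, ω (T (A (A a))) (T b) = ω (T a) (T (A (A b))) := fun a b => by
    rw [hA, hA, neg_neg]
  have e2 : ω (T v) (T (A (w θ u))) = Real.sin θ ^ 2 * ω (T (w θ v)) (T (A (w θ u))) -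
      Real.cos θ ^ 2 * ω (T (A (A (w θ v)))) (T (A (w θ u))) := by
    have hT := congrArg T (hw θ v)
    rw [← hT]
    simp only [map_sub, map_smul, LinearMap.sub_apply, LinearMap.smul_apply, smul_eq_mul]
  have e3 : ω (T u) (T (A (w θ v))) = Real.sin θ ^ 2 * ω (T (w θ u)) (T (A (w θ v))) -
      Real.cos θ ^ 2 * ω (T (A (A (w θ u)))) (T (A (w θ v))) := by
    have hT := congrArg T (hw θ u)
    rw [← hT]
    simp only [map_sub, map_smul, LinearMap.sub_apply, LinearMap.smul_apply, smul_eq_mul]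
  rw [e2, e3, hω (T (w θ v)), hA (w θ u) (w θ v), e, hω (T (w θ v)) (T (A (A (A (w θ u))))),
    hA (A (A (w θ u))), neg_neg, neg_neg]

end IsPhase

/-! ### Endomorphisms of vector bundles -/

section BundleEndomorphisms

set_option linter.unusedSectionVars false

variable {X : Type*} [TopologicalSpace X]
  {ME : Type*} [NormedAddCommGroup ME] [NormedSpace ℝ ME] [FiniteDimensional ℝ ME]
  {E : X → Type*} [∀ x, AddCommGroup (E x)] [∀ x, Module ℝ (E x)]
  [TopologicalSpace (TotalSpace ME E)] [∀ x, TopologicalSpace (E x)]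
  [∀ x, IsTopologicalAddGroup (E x)] [∀ x, ContinuousSMul ℝ (E x)]
  [FiberBundle ME E] [VectorBundle ℝ ME E]

/-- The fiber of a bundle is isomorphic to the model fiber. -/
def fiberEquiv (ME : Type*) [NormedAddCommGroup ME] [NormedSpace ℝ ME]
    {E : X → Type*} [∀ x, AddCommGroup (E x)] [∀ x, Module ℝ (E x)]
    [TopologicalSpace (TotalSpace ME E)] [∀ x, TopologicalSpace (E x)]
    [FiberBundle ME E] [VectorBundle ℝ ME E] (x₀ x : X)
    (hx : x ∈ (trivializationAt ME E x₀).baseSet) : E x ≃L[ℝ] ME :=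
  (trivializationAt ME E x₀).continuousLinearEquivAt ℝ x hx

/-- `phase` on a fiber of a bundle, computed in the preferred trivialization. -/
def fiberPhase (ME : Type*) [NormedAddCommGroup ME] [NormedSpace ℝ ME]
    {E : X → Type*} [∀ x, AddCommGroup (E x)] [∀ x, Module ℝ (E x)]
    [TopologicalSpace (TotalSpace ME E)] [∀ x, TopologicalSpace (E x)]
    [FiberBundle ME E] [VectorBundle ℝ ME E] (x : X) (A : E x →L[ℝ] E x) : E x →L[ℝ] E x :=
  let e := fiberEquiv ME x x (mem_baseSet_trivializationAt ME E x)
  (e.symm : ME →L[ℝ] E x) ∘L phase ((e : E x →L[ℝ] ME) ∘L A ∘L (e.symm : ME →L[ℝ] E x)) ∘L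
    (e : E x →L[ℝ] ME)

theorem NoRealEigenvalue.conj {V W : Type*} [AddCommGroup V] [Module ℝ V] [AddCommGroup W]
    [Module ℝ W] {A : V →ₗ[ℝ] V} (h : NoRealEigenvalue A) (e : V ≃ₗ[ℝ] W) :
    NoRealEigenvalue (e.toLinearMap ∘ₗ A ∘ₗ e.symm.toLinearMap) := by
  intro t v hv
  have h1 : A (e.symm v) = t • e.symm v := by
    have := congrArg e.symm hv
    simpa using this
  simpa using h t _ h1

theorem fiberPhase_isPhase {x : X} {A : E x →L[ℝ] E x}
    (h : NoRealEigenvalue (A : E x →ₗ[ℝ] E x)) :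
    IsPhase (A : E x →ₗ[ℝ] E x) (fiberPhase ME x A : E x →ₗ[ℝ] E x) := by
  let e := fiberEquiv ME x x (mem_baseSet_trivializationAt ME E x)
  have h1 : NoRealEigenvalue (((e : E x →L[ℝ] ME) ∘L A ∘L (e.symm : ME →L[ℝ] E x) :
      ME →L[ℝ] ME) : ME →ₗ[ℝ] ME) := h.conj e.toLinearEquiv
  have h2 := h1.isPhase.conj e.symm.toLinearEquiv
  convert h2 using 1
  · ext v
    change A v = e.symm (e (A (e.symm (e v))))
    simp
  · rfl

theorem fiberPhase_apply_fiberPhase {x : X} {A : E x →L[ℝ] E x}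
    (h : NoRealEigenvalue (A : E x →ₗ[ℝ] E x)) (v : E x) :
    fiberPhase ME x A (fiberPhase ME x A v) = -v := by
  let e := fiberEquiv ME x x (mem_baseSet_trivializationAt ME E x)
  have h1 : NoRealEigenvalue (((e : E x →L[ℝ] ME) ∘L A ∘L (e.symm : ME →L[ℝ] E x) :
      ME →L[ℝ] ME) : ME →ₗ[ℝ] ME) := h.conj e.toLinearEquiv
  have h2 := phase_apply_phase h1 (e v)
  change e.symm (phase _ (e (e.symm (phase _ (e v))))) = -v
  rw [e.apply_symm_apply, h2, map_neg, e.symm_apply_apply]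

theorem fiberPhase_of_sq {x : X} {J : E x →L[ℝ] E x} (hJ : ∀ v, J (J v) = -v) :
    fiberPhase ME x J = J := by
  have h := noRealEigenvalue_of_sq (J := (J : E x →ₗ[ℝ] E x)) hJ
  ext v
  exact (fiberPhase_isPhase h).eq (isPhase_self hJ) h v

/-- The endomorphism `A` of `E x` in the trivialization at `x₀`. -/
def inCoord (ME : Type*) [NormedAddCommGroup ME] [NormedSpace ℝ ME]
    {E : X → Type*} [∀ x, AddCommGroup (E x)] [∀ x, Module ℝ (E x)]
    [TopologicalSpace (TotalSpace ME E)] [∀ x, TopologicalSpace (E x)]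
    [FiberBundle ME E] [VectorBundle ℝ ME E] (x₀ x : X) (A : E x →L[ℝ] E x) : ME →L[ℝ] ME :=
  ContinuousLinearMap.inCoordinates ME E ME E x₀ x x₀ x A

theorem inCoord_eq {x₀ x : X} (hx : x ∈ (trivializationAt ME E x₀).baseSet) (A : E x →L[ℝ] E x) :
    inCoord ME x₀ x A = (fiberEquiv ME x₀ x hx : E x →L[ℝ] ME) ∘L A ∘L
      ((fiberEquiv ME x₀ x hx).symm : ME →L[ℝ] E x) :=
  ContinuousLinearMap.inCoordinates_eq hx hx

theorem inCoord_sum {ι : Type*} (s : Finset ι) (w : ι → ℝ) {x₀ x : X} (A : ι → E x →L[ℝ] E x) :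
    inCoord ME x₀ x (∑ i ∈ s, w i • A i) = ∑ i ∈ s, w i • inCoord ME x₀ x (A i) := by
  ext v
  simp [inCoord, ContinuousLinearMap.inCoordinates, map_sum]

theorem inCoord_noRealEigenvalue {x₀ x : X} (hx : x ∈ (trivializationAt ME E x₀).baseSet)
    {A : E x →L[ℝ] E x} (h : NoRealEigenvalue (A : E x →ₗ[ℝ] E x)) :
    NoRealEigenvalue (inCoord ME x₀ x A : ME →ₗ[ℝ] ME) := by
  rw [inCoord_eq hx]
  exact h.conj (fiberEquiv ME x₀ x hx).toLinearEquiv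

theorem inCoord_fiberPhase {x₀ x : X} (hx : x ∈ (trivializationAt ME E x₀).baseSet)
    {A : E x →L[ℝ] E x} (h : NoRealEigenvalue (A : E x →ₗ[ℝ] E x)) :
    inCoord ME x₀ x (fiberPhase ME x A) = phase (inCoord ME x₀ x A) := by
  have h1 := (fiberPhase_isPhase (ME := ME) h).conj (fiberEquiv ME x₀ x hx).toLinearEquiv
  have h2 := inCoord_noRealEigenvalue hx h
  have h3 := h2.isPhase
  ext v
  refine IsPhase.eq (A := (inCoord ME x₀ x A : ME →ₗ[ℝ] ME))
    (J := (inCoord ME x₀ x (fiberPhase ME x A) : ME →ₗ[ℝ] ME)) ?_ h3 h2 v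
  rw [inCoord_eq hx, inCoord_eq hx]
  exact h1

theorem det_inCoord {x₀ x : X} (hx : x ∈ (trivializationAt ME E x₀).baseSet) (A : E x →L[ℝ] E x)
    (r : ℝ) :
    LinearMap.det ((A : E x →ₗ[ℝ] E x) ∘ₗ (A : E x →ₗ[ℝ] E x) - r • LinearMap.id) =
      (inCoord ME x₀ x A ∘L inCoord ME x₀ x A - r • ContinuousLinearMap.id ℝ ME).det := by
  rw [← LinearMap.det_conj _ (fiberEquiv ME x₀ x hx).toLinearEquiv, inCoord_eq hx]
  change LinearMap.det _ = LinearMap.det _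
  congr 1
  ext v
  simp

section Tendsto

variable {M : Type*} {l : Filter M} {p : M → X} {x₀ : X}

theorem tendsto_end_iff {A : ∀ m, E (p m) →L[ℝ] E (p m)} {A₀ : E x₀ →L[ℝ] E x₀} :
    Tendsto (fun m => TotalSpace.mk' (ME →L[ℝ] ME) (E := fun y => E y →L[ℝ] E y) (p m) (A m)) l
      (𝓝 (TotalSpace.mk' (ME →L[ℝ] ME) (E := fun y => E y →L[ℝ] E y) x₀ A₀)) ↔
    Tendsto p l (𝓝 x₀) ∧
      Tendsto (fun m => inCoord ME x₀ (p m) (A m)) l (𝓝 (inCoord ME x₀ x₀ A₀)) :=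
  (trivializationAt (ME →L[ℝ] ME) (fun y => E y →L[ℝ] E y) x₀).tendsto_nhds_iff
    (z := TotalSpace.mk' (ME →L[ℝ] ME) (E := fun y => E y →L[ℝ] E y) x₀ A₀)
    ((Trivialization.mem_source _).2 (mem_baseSet_trivializationAt (ME →L[ℝ] ME)
      (fun y => E y →L[ℝ] E y) x₀))

theorem eventually_mem_baseSet (hp : Tendsto p l (𝓝 x₀)) :
    ∀ᶠ m in l, p m ∈ (trivializationAt ME E x₀).baseSet :=
  hp ((trivializationAt ME E x₀).open_baseSet.mem_nhds (mem_baseSet_trivializationAt ME E x₀))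

theorem tendsto_fiberPhase {A : ∀ m, E (p m) →L[ℝ] E (p m)} {A₀ : E x₀ →L[ℝ] E x₀}
    (h : Tendsto (fun m => TotalSpace.mk' (ME →L[ℝ] ME) (E := fun y => E y →L[ℝ] E y) (p m) (A m)) l
      (𝓝 (TotalSpace.mk' (ME →L[ℝ] ME) (E := fun y => E y →L[ℝ] E y) x₀ A₀)))
    (h₀ : NoRealEigenvalue (A₀ : E x₀ →ₗ[ℝ] E x₀))
    (hA : ∀ᶠ m in l, NoRealEigenvalue (A m : E (p m) →ₗ[ℝ] E (p m))) :
    Tendsto (fun m => TotalSpace.mk' (ME →L[ℝ] ME) (E := fun y => E y →L[ℝ] E y) (p m)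
        (fiberPhase ME (p m) (A m))) l
      (𝓝 (TotalSpace.mk' (ME →L[ℝ] ME) (E := fun y => E y →L[ℝ] E y) x₀
        (fiberPhase ME x₀ A₀))) := by
  rw [tendsto_end_iff] at h ⊢
  refine ⟨h.1, ?_⟩
  have hx₀ := mem_baseSet_trivializationAt ME E x₀
  rw [inCoord_fiberPhase hx₀ h₀]
  have h1 := (continuousOn_phase (V := ME)) _ (inCoord_noRealEigenvalue hx₀ h₀)
  have hb := eventually_mem_baseSet (ME := ME) (E := E) h.1
  have h2 : Tendsto (fun m => inCoord ME x₀ (p m) (A m)) l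
      (𝓝[{A | NoRealEigenvalue (A : ME →ₗ[ℝ] ME)}] (inCoord ME x₀ x₀ A₀)) := by
    refine tendsto_nhdsWithin_iff.2 ⟨h.2, ?_⟩
    filter_upwards [hA, hb] with m hm hmb using inCoord_noRealEigenvalue hmb hm
  refine (Tendsto.comp h1 h2).congr' ?_
  filter_upwards [hA, hb] with m hm hmb
  exact (inCoord_fiberPhase hmb hm).symm

theorem tendsto_sum {ι : Type*} {s : Finset ι} {w : ι → M → ℝ} {w₀ : ι → ℝ}
    {A : ι → ∀ m, E (p m) →L[ℝ] E (p m)} {A₀ : ι → E x₀ →L[ℝ] E x₀} (hp : Tendsto p l (𝓝 x₀))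
    (hw : ∀ i ∈ s, Tendsto (w i) l (𝓝 (w₀ i)))
    (h : ∀ i ∈ s, Tendsto
      (fun m => TotalSpace.mk' (ME →L[ℝ] ME) (E := fun y => E y →L[ℝ] E y) (p m) (A i m)) l
      (𝓝 (TotalSpace.mk' (ME →L[ℝ] ME) (E := fun y => E y →L[ℝ] E y) x₀ (A₀ i)))) :
    Tendsto (fun m => TotalSpace.mk' (ME →L[ℝ] ME) (E := fun y => E y →L[ℝ] E y) (p m)
        (∑ i ∈ s, w i m • A i m)) l
      (𝓝 (TotalSpace.mk' (ME →L[ℝ] ME) (E := fun y => E y →L[ℝ] E y) x₀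
        (∑ i ∈ s, w₀ i • A₀ i))) := by
  rw [tendsto_end_iff]
  refine ⟨hp, ?_⟩
  simp only [inCoord_sum]
  refine tendsto_finsetSum _ fun i hi => (hw i hi).smul ?_
  exact (tendsto_end_iff.1 (h i hi)).2

theorem tendsto_det {A : ∀ m, E (p m) →L[ℝ] E (p m)} {A₀ : E x₀ →L[ℝ] E x₀}
    (h : Tendsto (fun m => TotalSpace.mk' (ME →L[ℝ] ME) (E := fun y => E y →L[ℝ] E y) (p m) (A m)) l
      (𝓝 (TotalSpace.mk' (ME →L[ℝ] ME) (E := fun y => E y →L[ℝ] E y) x₀ A₀))) (r : ℝ) :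
    Tendsto (fun m => LinearMap.det ((A m : E (p m) →ₗ[ℝ] E (p m)) ∘ₗ (A m : E (p m) →ₗ[ℝ] E (p m))
        - r • LinearMap.id)) l
      (𝓝 (LinearMap.det ((A₀ : E x₀ →ₗ[ℝ] E x₀) ∘ₗ (A₀ : E x₀ →ₗ[ℝ] E x₀)
        - r • LinearMap.id))) := by
  rw [tendsto_end_iff] at h
  rw [det_inCoord (mem_baseSet_trivializationAt ME E x₀)]
  have hc : Continuous fun B : ME →L[ℝ] ME => (B ∘L B - r • ContinuousLinearMap.id ℝ ME).det := by
    refine (ContinuousLinearMap.continuous_det (E := ME) (𝕜 := ℝ)).comp ?_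
    exact (continuous_id.clm_comp continuous_id).sub continuous_const
  refine ((hc.tendsto _).comp h.2).congr' ?_
  filter_upwards [eventually_mem_baseSet (ME := ME) (E := E) h.1] with m hm
  exact (det_inCoord hm _ _).symm

end Tendsto

theorem finiteDimensional_fiber (ME : Type*) [NormedAddCommGroup ME] [NormedSpace ℝ ME]
    [FiniteDimensional ℝ ME]
    {E : X → Type*} [∀ x, AddCommGroup (E x)] [∀ x, Module ℝ (E x)]
    [TopologicalSpace (TotalSpace ME E)] [∀ x, TopologicalSpace (E x)]
    [FiberBundle ME E] [VectorBundle ℝ ME E] (x : X) : FiniteDimensional ℝ (E x) :=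
  (fiberEquiv ME x x (mem_baseSet_trivializationAt ME E x)).toLinearEquiv.symm.finiteDimensional

theorem finrank_fiber (ME : Type*) [NormedAddCommGroup ME] [NormedSpace ℝ ME]
    {E : X → Type*} [∀ x, AddCommGroup (E x)] [∀ x, Module ℝ (E x)]
    [TopologicalSpace (TotalSpace ME E)] [∀ x, TopologicalSpace (E x)]
    [FiberBundle ME E] [VectorBundle ℝ ME E] (x : X) : finrank ℝ (E x) = finrank ℝ ME :=
  (fiberEquiv ME x x (mem_baseSet_trivializationAt ME E x)).toLinearEquiv.finrank_eq

/-- Along a continuous family of complex structures on a vector space the induced orientation is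
constant, for `1 - J' J` carries `J` to `J'` and is close to `2` if `J'` is close to `J`. -/
theorem inducesOrientation_of_path {V W : Type*} [AddCommGroup V] [Module ℝ V] [TopologicalSpace V]
    [IsTopologicalAddGroup V] [FiniteDimensional ℝ V] [NormedAddCommGroup W] [NormedSpace ℝ W]
    [FiniteDimensional ℝ W] (e : V ≃L[ℝ] W) {n : ℕ} {o : Orientation ℝ V (Fin n × Fin 2)}
    {J : I → V →L[ℝ] V}
    (hc : Continuous fun s => (e : V →L[ℝ] W) ∘L J s ∘L (e.symm : W →L[ℝ] V))
    (hJ : ∀ s v, J s (J s v) = -v) (h0 : InducesOrientation o (J 0)) :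
    InducesOrientation o (J 1) := by
  have hloc : ∀ s, ∀ᶠ r in 𝓝 s, InducesOrientation o (J s) ↔ InducesOrientation o (J r) := by
    intro s
    have hg : ∀ (A B : V →L[ℝ] V) (hA : ∀ v, A (A v) = -v) (hB : ∀ v, B (B v) = -v) (v : V),
        (1 - B * A : V →L[ℝ] V) (A v) = B ((1 - B * A : V →L[ℝ] V) v) := by
      intro A B hA hB v
      simp [hA, hB, add_comm]
    let c : (V →L[ℝ] V) → (W →L[ℝ] W) := fun A => (e : V →L[ℝ] W) ∘L A ∘L (e.symm : W →L[ℝ] V)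
    have hdet : ∀ f : I → V →L[ℝ] V, (Continuous fun r => c (f r)) → f s = 1 - J s * J s →
        ∀ᶠ r in 𝓝 s, 0 < LinearMap.det (f r : V →ₗ[ℝ] V) := by
      intro f hf hfs
      have h1 := ((ContinuousLinearMap.continuous_det (E := W) (𝕜 := ℝ)).comp hf).tendsto s
      have h2 : ∀ r, (c (f r)).det = LinearMap.det (f r : V →ₗ[ℝ] V) := fun r =>
        LinearMap.det_conj (f r : V →ₗ[ℝ] V) e.toLinearEquiv
      simp only [Function.comp_def, h2] at h1
      refine h1.eventually_const_lt ?_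
      have hss : (f s : V →ₗ[ℝ] V) = (2 : ℝ) • LinearMap.id := by
        rw [hfs]; ext v; simp [hJ, two_smul]
      rw [hss, LinearMap.det_smul, LinearMap.det_id]
      positivity
    have hcm : ∀ A B : V →L[ℝ] V, c (1 - A * B) = 1 - c A * c B := fun A B => by
      ext v; simp [c]
    filter_upwards [hdet (fun r => 1 - J r * J s)
        (by simp only [hcm]; exact continuous_const.sub (hc.mul continuous_const)) rfl,
      hdet (fun r => 1 - J s * J r)
        (by simp only [hcm]; exact continuous_const.sub (continuous_const.mul hc)) rfl] with r h1 h2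
    exact ⟨fun h => h.of_intertwine (g := ((1 - J r * J s : V →L[ℝ] V) : V →ₗ[ℝ] V))
        (hg _ _ (hJ s) (hJ r)) h1,
      fun h => h.of_intertwine (g := ((1 - J s * J r : V →L[ℝ] V) : V →ₗ[ℝ] V))
        (hg _ _ (hJ r) (hJ s)) h2⟩
  have hlc : IsLocallyConstant fun s => InducesOrientation o (J s) := by
    rw [IsLocallyConstant.iff_eventually_eq]
    intro s
    filter_upwards [hloc s] with r hr using propext hr.symm
  have := hlc.apply_eq_of_isPreconnected isPreconnected_univ (mem_univ (0 : I)) (mem_univ 1)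
  exact this ▸ h0

end BundleEndomorphisms

/-! ### Convex combinations of tame complex structures -/

section Family

set_option linter.unusedSectionVars false

variable {V W : Type*} [AddCommGroup V] [Module ℝ V] [TopologicalSpace V]
  [IsTopologicalAddGroup V] [ContinuousSMul ℝ V]
  [AddCommGroup W] [Module ℝ W] [TopologicalSpace W] {ι : Type*} {n : ℕ}

/-- Complex structures `J i`, `i ∈ s`, that induce the same orientation and are `(ω, T)`-tame. -/
structure IsTameFamily (o : Orientation ℝ V (Fin n × Fin 2)) (ω : W →L[ℝ] W →L[ℝ] ℝ)
    (T : V →L[ℝ] W) (s : Finset ι) (J : ι → V →L[ℝ] V) : Prop where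
  sq : ∀ i ∈ s, ∀ v, J i (J i v) = -v
  orientation : ∀ i ∈ s, InducesOrientation o (J i)
  tame : ∀ i ∈ s, IsTame ω T (J i)

/-- The weights of a convex combination. -/
structure IsWeight (s : Finset ι) (w : ι → ℝ) : Prop where
  nonneg : ∀ i ∈ s, 0 ≤ w i
  sum_eq_one : ∑ i ∈ s, w i = 1

theorem IsTame.map_eq_zero {ω : W →L[ℝ] W →L[ℝ] ℝ} {T : V →L[ℝ] W} {J : V →L[ℝ] V}
    (h : IsTame ω T J) (hJ : ∀ v, J (J v) = -v) {v : V} (hv : T v = 0) : T (J v) = 0 := by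
  by_contra hne
  have h1 := h (J v) hne
  rw [hJ, map_neg, hv, neg_zero, map_zero] at h1
  exact lt_irrefl _ h1

theorem IsWeight.sum_pos {s : Finset ι} {w : ι → ℝ} (hw : IsWeight s w) {f : ι → ℝ}
    (hf : ∀ i ∈ s, 0 < f i) : 0 < ∑ i ∈ s, w i * f i := by
  have h : ∃ i ∈ s, 0 < w i := by
    by_contra hcon
    push Not at hcon
    have := Finset.sum_nonpos hcon
    rw [hw.sum_eq_one] at this
    linarith
  obtain ⟨i, hi, hwi⟩ := h
  exact Finset.sum_pos' (fun j hj => mul_nonneg (hw.nonneg j hj) (hf j hj).le)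
    ⟨i, hi, mul_pos hwi (hf i hi)⟩

theorem IsWeight.isTame_sum {ω : W →L[ℝ] W →L[ℝ] ℝ} {T : V →L[ℝ] W} {s : Finset ι} {w : ι → ℝ}
    {J : ι → V →L[ℝ] V} (hw : IsWeight s w) (h : ∀ i ∈ s, IsTame ω T (J i)) :
    IsTame ω T (∑ i ∈ s, w i • J i) := by
  intro v hv
  simp only [FunLike.coe_sum, Finset.sum_apply, map_sum,
    FunLike.coe_smul, Pi.smul_apply, map_smul, smul_eq_mul]
  exact hw.sum_pos fun i hi => h i hi v hv

theorem exists_isWeight_pair {s : Finset ι} {i j : ι} (hi : i ∈ s) (hj : j ∈ s) {a b : ℝ}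
    (ha : 0 ≤ a) (hb : 0 ≤ b) (hab : a + b = 1) (J : ι → V →L[ℝ] V) :
    ∃ w, IsWeight s w ∧ ∀ v, (∑ k ∈ s, w k • J k) v = a • J i v + b • J j v := by
  classical
  refine ⟨fun k => (if k = i then a else 0) + (if k = j then b else 0), ⟨fun k _ => ?_, ?_⟩,
    fun v => ?_⟩
  · exact add_nonneg (by split_ifs <;> simp [ha]) (by split_ifs <;> simp [hb])
  · simp [Finset.sum_add_distrib, hi, hj, hab]
  · simp [add_smul, Finset.sum_add_distrib, hi, hj, ite_smul]

namespace IsTameFamily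

variable {o : Orientation ℝ V (Fin n × Fin 2)} {ω : W →L[ℝ] W →L[ℝ] ℝ} {T : V →L[ℝ] W}
  {s : Finset ι} {J : ι → V →L[ℝ] V} {w : ι → ℝ}

theorem map_eq_zero_of_eigenvector (hω : ∀ a, ω a a = 0) (h : IsTameFamily o ω T s J)
    (hw : IsWeight s w) {v : V} {t : ℝ} (hv : T ((∑ i ∈ s, w i • J i) v) = t • T v) : T v = 0 := by
  by_contra hne
  have := hw.isTame_sum h.tame v hne
  rw [hv, map_smul, hω, smul_zero] at this
  exact lt_irrefl _ this

/-- Modulo a subspace `S` of `ker T` of codimension at most two, on which the segments between the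
`J i` are nonsingular, convex combinations of the `J i` have square `-d`, `d ≥ 1`, on `ker T`. -/
theorem exists_sq_mem [FiniteDimensional ℝ V] (hω : ∀ a, ω a a = 0) (h : IsTameFamily o ω T s J)
    (hw : IsWeight s w) {S : Submodule ℝ V} (hST : ∀ v ∈ S, T v = 0)
    (hd : finrank ℝ (LinearMap.ker (T : V →ₗ[ℝ] W)) ≤ finrank ℝ S + 2)
    (hSJ : ∀ i ∈ s, ∀ v ∈ S, J i v ∈ S)
    (hS : ∀ w', IsWeight s w' → ∀ v ∈ S, (∑ i ∈ s, w' i • J i) v = 0 → v = 0) :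
    ∃ d : ℝ, 1 ≤ d ∧ ∀ v, T v = 0 →
      (∑ i ∈ s, w i • J i) ((∑ i ∈ s, w i • J i) v) + d • v ∈ S := by
  have key := exists_sq_add_smul_mem (s := s) (w := w) hw.nonneg hw.sum_eq_one
    (J := fun i => (J i : V →ₗ[ℝ] V)) (S := S) (K := LinearMap.ker (T : V →ₗ[ℝ] W)) ?_
  · obtain ⟨d, hd1, hd2⟩ := key
    refine ⟨d, hd1, fun v hv => ?_⟩
    have := hd2 v hv
    simpa [LinearMap.sum_apply] using this
  · intro i hi j hj
    refine ((h.orientation i hi).cooriented (h.orientation j hj) (h.sq i hi)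
      (h.sq j hj)).exists_anticommutator_mem (h.sq i hi) (h.sq j hj) hST hd (hSJ i hi) (hSJ j hj)
      (fun v hv => (h.tame i hi).map_eq_zero (h.sq i hi) hv)
      (fun v hv => (h.tame j hj).map_eq_zero (h.sq j hj) hv) ?_ ?_
    · intro a b ha hb hab v hv h0
      obtain ⟨w', hw', hv'⟩ := exists_isWeight_pair hi hj ha hb hab J
      exact hS w' hw' v hv ((hv' v).trans h0)
    · intro a b ha hb hab v h0
      obtain ⟨w', hw', hv'⟩ := exists_isWeight_pair hi hj ha hb hab J
      refine h.map_eq_zero_of_eigenvector hω hw' (t := 0) ?_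
      rw [hv', zero_smul]
      exact h0

theorem exists_sq_eq [FiniteDimensional ℝ V] (hω : ∀ a, ω a a = 0) (h : IsTameFamily o ω T s J)
    (hw : IsWeight s w) (hd : finrank ℝ (LinearMap.ker (T : V →ₗ[ℝ] W)) ≤ 2) :
    ∃ d : ℝ, 1 ≤ d ∧ ∀ v, T v = 0 →
      (∑ i ∈ s, w i • J i) ((∑ i ∈ s, w i • J i) v) = -(d • v) := by
  obtain ⟨d, hd1, hd2⟩ := h.exists_sq_mem hω hw (S := ⊥) (by simp) (by simpa using hd) (by simp)
    (by simp)
  exact ⟨d, hd1, fun v hv => eq_neg_of_add_eq_zero_left (by simpa using hd2 v hv)⟩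

/-- The case of wrapped points: `S` is the span of a set `P` of eigenvectors of the squares. -/
theorem noRealEigenvalue_of_span [FiniteDimensional ℝ V] (hω : ∀ a, ω a a = 0)
    (h : IsTameFamily o ω T s J) (hw : IsWeight s w) {P : Set V} (hPT : ∀ v ∈ P, T v = 0)
    (hd : finrank ℝ (LinearMap.ker (T : V →ₗ[ℝ] W)) ≤ finrank ℝ (Submodule.span ℝ P) + 2)
    (hPJ : ∀ i ∈ s, ∀ v ∈ P, J i v ∈ P)
    (hP : ∀ w', IsWeight s w' → ∀ v ∈ P, ∃ d : ℝ, 1 ≤ d ∧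
      (∑ i ∈ s, w' i • J i) ((∑ i ∈ s, w' i • J i) v) = -(d • v)) :
    NoRealEigenvalue ((∑ i ∈ s, w i • J i : V →L[ℝ] V) : V →ₗ[ℝ] V) := by
  have hzero : ∀ w', IsWeight s w' → ∀ v ∈ Submodule.span ℝ P, ∀ t : ℝ,
      (∑ i ∈ s, w' i • J i) v = t • v → v = 0 := by
    intro w' hw' v hv t hvt
    let A : V →L[ℝ] V := ∑ i ∈ s, w' i • J i
    refine eq_zero_of_mem_span_of_eigenvectors (B := (A : V →ₗ[ℝ] V) ∘ₗ (A : V →ₗ[ℝ] V))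
      (hP w' hw') hv (mul_self_nonneg t) ?_
    change A (A v) = _
    have : A v = t • v := hvt
    rw [this, map_smul, this, smul_smul]
  obtain ⟨d, hd1, hd2⟩ := h.exists_sq_mem hω hw (S := Submodule.span ℝ P)
    (fun v hv => by
      have : Submodule.span ℝ P ≤ LinearMap.ker (T : V →ₗ[ℝ] W) := Submodule.span_le.2 hPT
      exact this hv) hd
    (fun i hi v hv => by
      have : Submodule.span ℝ P ≤ (Submodule.span ℝ P).comap (J i : V →ₗ[ℝ] V) :=
        Submodule.span_le.2 fun v hv => Submodule.subset_span (hPJ i hi v hv)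
      exact this hv)
    (fun w' hw' v hv h0 => hzero w' hw' v hv 0 (by rw [h0, zero_smul]))
  intro t v hv
  have hv' : (∑ i ∈ s, w i • J i) v = t • v := hv
  have hTv : T v = 0 := h.map_eq_zero_of_eigenvector hω hw (t := t) (by rw [hv', map_smul])
  have h1 := hd2 v hTv
  rw [hv', map_smul, hv', smul_smul, ← add_smul] at h1
  have h2 : v ∈ Submodule.span ℝ P := by
    have := (Submodule.span ℝ P).smul_mem (t * t + d)⁻¹ h1
    rwa [smul_smul, inv_mul_cancel₀ (by nlinarith [mul_self_nonneg t]), one_smul] at this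
  exact hzero w hw v h2 t hv'

/-- If `V / ker T` has dimension at most two, then convex combinations of the `J i` induce on it
operators of square `-d`, `d ≥ 1`. -/
theorem exists_map_sq_eq [FiniteDimensional ℝ V] (hω : ∀ a, ω a a = 0)
    (h : IsTameFamily o ω T s J) (hw : IsWeight s w)
    (hd : finrank ℝ (LinearMap.ker (T : V →ₗ[ℝ] W)) ≤ 2)
    (hV : finrank ℝ V ≤ finrank ℝ (LinearMap.ker (T : V →ₗ[ℝ] W)) + 2) :
    ∃ d : ℝ, 1 ≤ d ∧ ∀ v,
      T ((∑ i ∈ s, w i • J i) ((∑ i ∈ s, w i • J i) v)) = -(d • T v) := by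
  have key := exists_sq_add_smul_mem (s := s) (w := w) hw.nonneg hw.sum_eq_one
    (J := fun i => (J i : V →ₗ[ℝ] V)) (S := LinearMap.ker (T : V →ₗ[ℝ] W)) (K := ⊤) ?_
  · obtain ⟨d, hd1, hd2⟩ := key
    refine ⟨d, hd1, fun v => ?_⟩
    have := hd2 v trivial
    simp only [LinearMap.mem_ker, map_add, map_smul] at this
    refine eq_neg_of_add_eq_zero_left ?_
    simpa [LinearMap.sum_apply] using this
  · intro i hi j hj
    refine ((h.orientation i hi).cooriented (h.orientation j hj) (h.sq i hi)
      (h.sq j hj)).exists_anticommutator_mem (h.sq i hi) (h.sq j hj) le_top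
      (by rw [finrank_top]; exact hV)
      (fun v hv => (h.tame i hi).map_eq_zero (h.sq i hi) hv)
      (fun v hv => (h.tame j hj).map_eq_zero (h.sq j hj) hv) (fun _ _ => trivial)
      (fun _ _ => trivial) ?_ (fun _ _ _ _ _ _ _ => trivial)
    intro a b ha hb hab v hv h0
    obtain ⟨w', hw', hv'⟩ := exists_isWeight_pair hi hj ha hb hab J
    obtain ⟨d, hd1, hd2⟩ := h.exists_sq_eq hω hw' hd
    have h1 := hd2 v hv
    have h3 : (∑ k ∈ s, w' k • J k) v = 0 := (hv' v).trans h0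
    rw [h3, map_zero, eq_comm, neg_eq_zero] at h1
    exact (smul_eq_zero.1 h1).resolve_left (by linarith)

variable [FiniteDimensional ℝ V] [FiniteDimensional ℝ W]

/-- At a regular point `det (A² - t²)` is at least as large as the determinant of the operator
induced on `W`, for on `ker T` the operator `A² - t²` is multiplication by `-(d + t²)`, `d ≥ 1`. -/
theorem abs_det_le (hω : ∀ a, ω a a = 0) (h : IsTameFamily o ω T s J)
    (hw : IsWeight s w) (hT : Function.Surjective T)
    (hd : finrank ℝ (LinearMap.ker (T : V →ₗ[ℝ] W)) ≤ 2) {t : ℝ} {g : W →ₗ[ℝ] W}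
    (hg : ∀ v, T ((∑ i ∈ s, w i • J i) ((∑ i ∈ s, w i • J i) v)) - (t ^ 2) • T v = g (T v)) :
    |LinearMap.det g| ≤ |LinearMap.det
      (((∑ i ∈ s, w i • J i : V →L[ℝ] V) : V →ₗ[ℝ] V) ∘ₗ
        ((∑ i ∈ s, w i • J i : V →L[ℝ] V) : V →ₗ[ℝ] V) - (t ^ 2) • LinearMap.id)| := by
  obtain ⟨d, hd1, hd2⟩ := h.exists_sq_eq hω hw hd
  have key := det_eq_det_ker_mul_det (T := (T : V →ₗ[ℝ] W)) hT
    (f := ((∑ i ∈ s, w i • J i : V →L[ℝ] V) : V →ₗ[ℝ] V) ∘ₗ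
        ((∑ i ∈ s, w i • J i : V →L[ℝ] V) : V →ₗ[ℝ] V) - (t ^ 2) • LinearMap.id) (g := g)
    (r := -(d + t ^ 2)) (fun v => by
      rw [ContinuousLinearMap.coe_coe, ← hg v]
      simp only [LinearMap.sub_apply, LinearMap.comp_apply, LinearMap.smul_apply,
        LinearMap.id_apply, ContinuousLinearMap.coe_coe, map_sub, map_smul])
    (fun v hv => by
      simp only [LinearMap.sub_apply, LinearMap.comp_apply, LinearMap.smul_apply,
        LinearMap.id_apply, ContinuousLinearMap.coe_coe]
      rw [hd2 v hv, neg_add, add_smul, neg_smul, neg_smul, sub_eq_add_neg])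
  rw [key, abs_mul]
  refine le_mul_of_one_le_left (abs_nonneg _) ?_
  rw [abs_pow, abs_neg]
  refine one_le_pow₀ ?_
  rw [abs_of_nonneg (by positivity)]
  nlinarith [sq_nonneg t]

theorem one_le_abs_det (hω : ∀ a, ω a a = 0) (h : IsTameFamily o ω T s J)
    (hw : IsWeight s w) (hT : Function.Surjective T)
    (hd : finrank ℝ (LinearMap.ker (T : V →ₗ[ℝ] W)) ≤ 2) (t : ℝ) {d : ℝ} (hd1 : 1 ≤ d)
    (hsq : ∀ v, T ((∑ i ∈ s, w i • J i) ((∑ i ∈ s, w i • J i) v)) = -(d • T v)) :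
    1 ≤ |LinearMap.det
      (((∑ i ∈ s, w i • J i : V →L[ℝ] V) : V →ₗ[ℝ] V) ∘ₗ
        ((∑ i ∈ s, w i • J i : V →L[ℝ] V) : V →ₗ[ℝ] V) - (t ^ 2) • LinearMap.id)| := by
  refine le_trans ?_ (h.abs_det_le hω hw hT hd (t := t) (g := (-(d + t ^ 2)) • LinearMap.id)
    fun v => ?_)
  · rw [LinearMap.det_smul, LinearMap.det_id, mul_one, abs_pow, abs_neg]
    refine one_le_pow₀ ?_
    rw [abs_of_nonneg (by positivity)]
    nlinarith [sq_nonneg t]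
  · rw [hsq, LinearMap.smul_apply, LinearMap.id_apply, neg_smul, add_smul, neg_add, sub_eq_add_neg]

end IsTameFamily

end Family

/-! ### Real eigenvalues at critical points -/

section Spectrum

set_option linter.unusedSectionVars false

variable {X : Type*} [TopologicalSpace X]
  {ME : Type*} [NormedAddCommGroup ME] [NormedSpace ℝ ME] [FiniteDimensional ℝ ME]
  {E : X → Type*} [∀ x, AddCommGroup (E x)] [∀ x, Module ℝ (E x)]
  [TopologicalSpace (TotalSpace ME E)] [∀ x, TopologicalSpace (E x)]
  [∀ x, IsTopologicalAddGroup (E x)] [∀ x, ContinuousSMul ℝ (E x)]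
  [FiberBundle ME E] [VectorBundle ℝ ME E]
  {MF : Type*} [NormedAddCommGroup MF] [NormedSpace ℝ MF] [FiniteDimensional ℝ MF]
  {F : X → Type*} [∀ x, AddCommGroup (F x)] [∀ x, Module ℝ (F x)]
  [TopologicalSpace (TotalSpace MF F)] [∀ x, TopologicalSpace (F x)]
  [∀ x, IsTopologicalAddGroup (F x)] [∀ x, ContinuousSMul ℝ (F x)]
  [FiberBundle MF F] [VectorBundle ℝ MF F]

theorem trivializationAt_snd {x₀ x : X} (hx : x ∈ (trivializationAt ME E x₀).baseSet) (v : E x) :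
    (trivializationAt ME E x₀ (TotalSpace.mk' ME x v)).2 = fiberEquiv ME x₀ x hx v := by
  simp [fiberEquiv, Trivialization.continuousLinearEquivAt_apply]

variable {T : ∀ x, E x →L[ℝ] F x}

theorem map_eq_zero_of_mem_limitKernel
    (hT : Continuous fun x => TotalSpace.mk' (ME →L[ℝ] MF) (E := fun y => E y →L[ℝ] F y) x (T x))
    {x₀ : X} {v : E x₀} (hv : TotalSpace.mk' ME x₀ v ∈ limitKernel ME T) : T x₀ v = 0 := by
  rw [limitKernel, mem_closure_iff_frequently] at hv
  have hb := mem_baseSet_trivializationAt MF F x₀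
  have h1 : ContinuousAt (fun τ : TotalSpace ME E => TotalSpace.mk' MF τ.proj (T τ.proj τ.2))
      (TotalSpace.mk' ME x₀ v) := by
    refine ContinuousAt.clm_bundle_apply (F₁ := ME) (ϕ := fun τ : TotalSpace ME E => T τ.proj)
      (v := fun τ : TotalSpace ME E => τ.2) ?_ continuousAt_id
    exact (hT.comp (FiberBundle.continuous_proj ME E)).continuousAt
  have h2 := ((FiberBundle.continuousAt_totalSpace MF _).1 h1).2
  have h3 : ∃ᶠ τ in 𝓝 (TotalSpace.mk' ME x₀ v),
      (trivializationAt MF F x₀ (TotalSpace.mk' MF τ.proj (T τ.proj τ.2))).2 = 0 := by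
    have hev : ∀ᶠ τ in 𝓝 (TotalSpace.mk' ME x₀ v),
        τ.proj ∈ (trivializationAt MF F x₀).baseSet :=
      eventually_mem_baseSet (FiberBundle.continuous_proj ME E).continuousAt
    refine (hv.and_eventually hev).mono fun τ hτ => ?_
    rw [trivializationAt_snd hτ.2, hτ.1.2, map_zero]
  have h4 := tendsto_nhds_unique_of_frequently_eq h2.tendsto tendsto_const_nhds h3
  rw [trivializationAt_snd hb] at h4
  simpa using h4

theorem continuousAt_apply {J : ∀ x, E x →L[ℝ] E x} {x₀ : X}
    (hJ : ContinuousAt (fun x => TotalSpace.mk' (ME →L[ℝ] ME) (E := fun y => E y →L[ℝ] E y) x (J x))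
      x₀) (v : E x₀) :
    ContinuousAt (fun τ : TotalSpace ME E => TotalSpace.mk' ME τ.proj (J τ.proj τ.2))
      (TotalSpace.mk' ME x₀ v) := by
  refine ContinuousAt.clm_bundle_apply (F₁ := ME) (ϕ := fun τ : TotalSpace ME E => J τ.proj)
    (v := fun τ : TotalSpace ME E => τ.2) ?_ continuousAt_id
  exact ContinuousAt.comp (f := TotalSpace.proj) (x := TotalSpace.mk' ME x₀ v) hJ
    (FiberBundle.continuous_proj ME E).continuousAt

theorem apply_mem_limitKernel {J : ∀ x, E x →L[ℝ] E x} {x₀ : X}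
    (hJ : ContinuousAt (fun x => TotalSpace.mk' (ME →L[ℝ] ME) (E := fun y => E y →L[ℝ] E y) x (J x))
      x₀) (hker : ∀ᶠ x in 𝓝 x₀, ∀ v, T x v = 0 → T x (J x v) = 0) {v : E x₀}
    (hv : TotalSpace.mk' ME x₀ v ∈ limitKernel ME T) :
    TotalSpace.mk' ME x₀ (J x₀ v) ∈ limitKernel ME T := by
  rw [limitKernel, mem_closure_iff_frequently] at hv ⊢
  have hev : ∀ᶠ τ in 𝓝 (TotalSpace.mk' ME x₀ v),
      ∀ u, T τ.proj u = 0 → T τ.proj (J τ.proj u) = 0 :=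
    ((FiberBundle.continuous_proj ME E).tendsto (TotalSpace.mk' ME x₀ v)).eventually hker
  refine (continuousAt_apply hJ v).frequently ((hv.and_eventually hev).mono fun τ hτ => ?_)
  exact ⟨hτ.1.1, hτ.2 _ hτ.1.2⟩

/-- If `A² = -d`, `d ≥ 1`, on the kernels of `T` at regular points then each limit of vectors in
these kernels is an eigenvector of `A²` of this sort. -/
theorem exists_sq_eq_of_mem_limitKernel {A : ∀ x, E x →L[ℝ] E x} {x₀ : X}
    (hA : ContinuousAt (fun x => TotalSpace.mk' (ME →L[ℝ] ME) (E := fun y => E y →L[ℝ] E y) x (A x))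
      x₀)
    (hsq : ∀ᶠ x in 𝓝 x₀, IsRegular T x →
      ∃ d : ℝ, 1 ≤ d ∧ ∀ v, T x v = 0 → A x (A x v) = -(d • v)) {v : E x₀}
    (hv : TotalSpace.mk' ME x₀ v ∈ limitKernel ME T) :
    ∃ d : ℝ, 1 ≤ d ∧ A x₀ (A x₀ v) = -(d • v) := by
  by_cases hv0 : v = 0
  · exact ⟨1, le_rfl, by simp [hv0]⟩
  rw [limitKernel, mem_closure_iff_frequently] at hv
  have hb := mem_baseSet_trivializationAt ME E x₀
  let g₁ : TotalSpace ME E → ME := fun τ => (trivializationAt ME E x₀ τ).2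
  let g₂ : TotalSpace ME E → ME := fun τ =>
    (trivializationAt ME E x₀ (TotalSpace.mk' ME τ.proj (A τ.proj (A τ.proj τ.2)))).2
  have hg₁ : ContinuousAt g₁ (TotalSpace.mk' ME x₀ v) :=
    ((FiberBundle.continuousAt_totalSpace ME id).1 continuousAt_id).2
  have hg₂ : ContinuousAt g₂ (TotalSpace.mk' ME x₀ v) := by
    have h1 := (continuousAt_apply hA (A x₀ v)).comp_of_eq (continuousAt_apply hA v) rfl
    exact ((FiberBundle.continuousAt_totalSpace ME _).1 h1).2
  have hev : ∀ᶠ τ in 𝓝 (TotalSpace.mk' ME x₀ v), IsRegular T τ.proj →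
      ∃ d : ℝ, 1 ≤ d ∧ ∀ v, T τ.proj v = 0 → A τ.proj (A τ.proj v) = -(d • v) :=
    ((FiberBundle.continuous_proj ME E).tendsto (TotalSpace.mk' ME x₀ v)).eventually hsq
  have hev2 : ∀ᶠ τ in 𝓝 (TotalSpace.mk' ME x₀ v),
      τ.proj ∈ (trivializationAt ME E x₀).baseSet :=
    eventually_mem_baseSet (FiberBundle.continuous_proj ME E).continuousAt
  have hfr : ∃ᶠ τ in 𝓝 (TotalSpace.mk' ME x₀ v),
      ‖g₁ τ‖ • g₂ τ = -(‖g₂ τ‖ • g₁ τ) ∧ ‖g₁ τ‖ ≤ ‖g₂ τ‖ := by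
    refine (hv.and_eventually (hev.and hev2)).mono ?_
    rintro τ ⟨⟨hreg, hker⟩, h2, hτ⟩
    obtain ⟨d, hd, hd2⟩ := h2 hreg
    have e1 : g₂ τ = -(d • g₁ τ) := by
      simp only [g₁, g₂]
      rw [hd2 _ hker, trivializationAt_snd hτ, map_neg, map_smul]
      congr 2
    rw [e1, norm_neg, norm_smul, Real.norm_of_nonneg (by linarith : (0 : ℝ) ≤ d)]
    refine ⟨?_, le_mul_of_one_le_left (norm_nonneg _) hd⟩
    rw [smul_neg, smul_smul, mul_comm]
  have h1 := tendsto_nhds_unique_of_frequently_eq (hg₁.norm.smul hg₂).tendsto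
    (hg₂.norm.smul hg₁).neg.tendsto (hfr.mono fun τ h => h.1)
  have h2 := le_of_tendsto_of_tendsto_of_frequently hg₁.norm.tendsto hg₂.norm.tendsto
    (hfr.mono fun τ h => h.2)
  let e := fiberEquiv ME x₀ x₀ hb
  have e1 : g₁ (TotalSpace.mk' ME x₀ v) = e v := trivializationAt_snd hb v
  have e2 : g₂ (TotalSpace.mk' ME x₀ v) = e (A x₀ (A x₀ v)) := trivializationAt_snd hb _
  simp only [Pi.smul_apply', Pi.neg_apply, e1, e2] at h1 h2
  have hpos : 0 < ‖e v‖ := norm_pos_iff.2 (by simpa using hv0)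
  refine ⟨‖e v‖⁻¹ * ‖e (A x₀ (A x₀ v))‖, ?_, ?_⟩
  · rw [inv_mul_eq_div, le_div_iff₀ hpos, one_mul]; exact h2
  · apply e.injective
    rw [map_neg, map_smul, mul_smul, ← smul_neg, ← h1, smul_smul, inv_mul_cancel₀ hpos.ne',
      one_smul]

/-- The spectrum at `x₀` is controlled by lower bounds for `det (A² - t²)`, which is continuous,
arbitrarily close to `x₀`. -/
theorem noRealEigenvalue_of_frequently_det {A : ∀ x, E x →L[ℝ] E x} {x₀ : X}
    (hA : ContinuousAt (fun x => TotalSpace.mk' (ME →L[ℝ] ME) (E := fun y => E y →L[ℝ] E y) x (A x))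
      x₀)
    (h : ∀ t : ℝ, ∃ c : ℝ, 0 < c ∧ ∃ᶠ x in 𝓝 x₀, c ≤ |LinearMap.det
      ((A x : E x →ₗ[ℝ] E x) ∘ₗ (A x : E x →ₗ[ℝ] E x) - (t ^ 2) • LinearMap.id)|) :
    NoRealEigenvalue (A x₀ : E x₀ →ₗ[ℝ] E x₀) := by
  have := finiteDimensional_fiber ME (E := E) x₀
  refine noRealEigenvalue_of_det_ne_zero fun t h0 => ?_
  obtain ⟨c, hc, hfr⟩ := h t
  have h1 := (tendsto_det (ME := ME) (p := id) hA.tendsto (t ^ 2)).abs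
  have h2 := le_of_tendsto_of_tendsto_of_frequently tendsto_const_nhds h1 hfr
  rw [h0, abs_zero] at h2
  exact absurd h2 (not_le.2 hc)

theorem finrank_ker_of_isRegular {n : ℕ} (hE : finrank ℝ ME = 2 * n)
    (hF : finrank ℝ MF + 2 = 2 * n) {x : X} (hx : IsRegular T x) :
    finrank ℝ (LinearMap.ker (T x : E x →ₗ[ℝ] F x)) = 2 := by
  have := finiteDimensional_fiber ME (E := E) x
  have h1 := (T x : E x →ₗ[ℝ] F x).finrank_range_add_finrank_ker
  rw [LinearMap.range_eq_top.2 hx, finrank_top, finrank_fiber ME (E := E) x,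
    finrank_fiber MF (E := F) x] at h1
  omega

variable {ωF : ∀ x, F x →L[ℝ] F x →L[ℝ] ℝ}

/-- Along the sequence `q` of regular points the structures `T_*J` converge to a tame complex
structure on `F x`. -/
def ExtendsAlong (MF : Type*) [NormedAddCommGroup MF] [NormedSpace ℝ MF]
    {F : X → Type*} [∀ x, AddCommGroup (F x)] [∀ x, Module ℝ (F x)]
    [TopologicalSpace (TotalSpace MF F)] [∀ x, TopologicalSpace (F x)]
    [∀ x, IsTopologicalAddGroup (F x)] [∀ x, ContinuousSMul ℝ (F x)]
    [FiberBundle MF F] [VectorBundle ℝ MF F]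
    (T : ∀ x, E x →L[ℝ] F x) (ωF : ∀ x, F x →L[ℝ] F x →L[ℝ] ℝ) (q : ℕ → X) (x : X)
    (J : ∀ x, E x →L[ℝ] E x) : Prop :=
  ∃ (B : ∀ i, F (q i) →L[ℝ] F (q i)) (B' : F x →L[ℝ] F x),
    (∀ᶠ i in atTop, ∀ v, B i (T (q i) v) = T (q i) (J (q i) v)) ∧
    Tendsto (fun i => TotalSpace.mk' (MF →L[ℝ] MF) (E := fun y => F y →L[ℝ] F y) (q i) (B i))
      atTop (𝓝 (TotalSpace.mk' (MF →L[ℝ] MF) (E := fun y => F y →L[ℝ] F y) x B')) ∧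
    (∀ w, B' (B' w) = -w) ∧ IsTame (ωF x) (ContinuousLinearMap.id ℝ (F x)) B'

/-- A condition at `x` under which convex combinations of the structures `J i` have no real
eigenvalues at `x`: the point is wrapped, or it is a limit of regular points and the fibers of `E`
have dimension at most four, or the structures induced by the `J i` on `F` agree at regular points
arbitrarily close to `x`, or they converge to tame structures along a sequence of regular points. -/
def IsControlled (ME : Type*) [NormedAddCommGroup ME] [NormedSpace ℝ ME]
    (MF : Type*) [NormedAddCommGroup MF] [NormedSpace ℝ MF]
    {E : X → Type*} [∀ x, AddCommGroup (E x)] [∀ x, Module ℝ (E x)]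
    [TopologicalSpace (TotalSpace ME E)] [∀ x, TopologicalSpace (E x)]
    {F : X → Type*} [∀ x, AddCommGroup (F x)] [∀ x, Module ℝ (F x)]
    [TopologicalSpace (TotalSpace MF F)] [∀ x, TopologicalSpace (F x)]
    [∀ x, IsTopologicalAddGroup (F x)] [∀ x, ContinuousSMul ℝ (F x)]
    [FiberBundle MF F] [VectorBundle ℝ MF F]
    (T : ∀ x, E x →L[ℝ] F x) (ωF : ∀ x, F x →L[ℝ] F x →L[ℝ] ℝ) {ι : Type*} (s : Finset ι)
    (J : ι → ∀ x, E x →L[ℝ] E x) (x : X) : Prop :=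
  IsWrapped ME T x ∨ (finrank ℝ ME ≤ 4 ∧ x ∈ closure {y | IsRegular T y}) ∨
  (∃ᶠ y in 𝓝 x, IsRegular T y ∧ ∀ i ∈ s, ∀ j ∈ s, ∀ v, T y (J i y v) = T y (J j y v)) ∨
  ∃ q : ℕ → X, (∀ k, IsRegular T (q k)) ∧ Tendsto q atTop (𝓝 x) ∧
    ∀ i ∈ s, ExtendsAlong MF T ωF q x (J i)

theorem IsTame.noRealEigenvalue {V : Type*} [AddCommGroup V] [Module ℝ V] [TopologicalSpace V]
    {ω : V →L[ℝ] V →L[ℝ] ℝ} (hω : ∀ v, ω v v = 0) {A : V →L[ℝ] V}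
    (h : IsTame ω (ContinuousLinearMap.id ℝ V) A) : NoRealEigenvalue (A : V →ₗ[ℝ] V) := by
  intro t v hv
  by_contra hne
  have h1 := h v hne
  have h2 : A v = t • v := hv
  simp [h2, hω] at h1

/-- Convex combinations of tame complex structures have no real eigenvalues at controlled points. -/
theorem IsControlled.noRealEigenvalue {n : ℕ} (hE : finrank ℝ ME = 2 * n)
    (hF : finrank ℝ MF + 2 = 2 * n) {oE : ∀ x, Orientation ℝ (E x) (Fin n × Fin 2)}
    (hT : Continuous fun x => TotalSpace.mk' (ME →L[ℝ] MF) (E := fun y => E y →L[ℝ] F y) x (T x))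
    (hω : ∀ x v, ωF x v v = 0) {ι : Type*} {s : Finset ι} {J : ι → ∀ x, E x →L[ℝ] E x} {x₀ : X}
    (hfam : ∀ᶠ x in 𝓝 x₀, IsTameFamily (oE x) (ωF x) (T x) s (fun i => J i x))
    (hJ : ∀ i ∈ s, ContinuousAt
      (fun x => TotalSpace.mk' (ME →L[ℝ] ME) (E := fun y => E y →L[ℝ] E y) x (J i x)) x₀)
    (h : IsControlled ME MF T ωF s J x₀) {w : ι → ℝ} (hw : IsWeight s w) :
    NoRealEigenvalue ((∑ i ∈ s, w i • J i x₀ : E x₀ →L[ℝ] E x₀) : E x₀ →ₗ[ℝ] E x₀) := by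
  have hfd := finiteDimensional_fiber ME (E := E)
  have hfd' := finiteDimensional_fiber MF (E := F)
  have hcont : ∀ w : ι → ℝ, ContinuousAt (fun x => TotalSpace.mk' (ME →L[ℝ] ME)
      (E := fun y => E y →L[ℝ] E y) x (∑ i ∈ s, w i • J i x)) x₀ := fun w =>
    tendsto_sum (p := id) (w := fun i _ => w i) tendsto_id (fun i _ => tendsto_const_nhds)
      fun i hi => (hJ i hi).tendsto
  rcases h with h | ⟨h4, hcl⟩ | h | ⟨q, hq, hqx, hext⟩
  -- at a wrapped point the limits of kernels are eigenvectors of the squares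
  · have hfam₀ := hfam.self_of_nhds
    refine hfam₀.noRealEigenvalue_of_span (hω x₀) hw
      (P := {v | TotalSpace.mk' ME x₀ v ∈ limitKernel ME T})
      (fun v hv => map_eq_zero_of_mem_limitKernel hT hv) h (fun i hi v hv => ?_)
      fun w' hw' v hv => ?_
    · refine apply_mem_limitKernel (hJ i hi) ?_ hv
      filter_upwards [hfam] with x hx v hv using (hx.tame i hi).map_eq_zero (hx.sq i hi) hv
    · refine exists_sq_eq_of_mem_limitKernel (A := fun x => ∑ i ∈ s, w' i • J i x) (hcont w') ?_ hv
      filter_upwards [hfam] with x hx hreg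
      exact hx.exists_sq_eq (hω x) hw' (finrank_ker_of_isRegular hE hF hreg).le
  -- if the fibers of `F` have dimension at most two, `A²` induces `-d`, `d ≥ 1`, on them
  · refine noRealEigenvalue_of_frequently_det (A := fun x => ∑ i ∈ s, w i • J i x) (hcont w)
      fun t => ⟨1, one_pos, ?_⟩
    refine ((mem_closure_iff_frequently.1 hcl).and_eventually hfam).mono fun x hx => ?_
    have hk := finrank_ker_of_isRegular hE hF hx.1
    obtain ⟨d, hd1, hd2⟩ := hx.2.exists_map_sq_eq (hω x) hw hk.le
      (by rw [hk, finrank_fiber ME x]; exact h4)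
    exact hx.2.one_le_abs_det (hω x) hw hx.1 hk.le t hd1 hd2
  -- if the induced structures agree, `A²` induces `-1`
  · refine noRealEigenvalue_of_frequently_det (A := fun x => ∑ i ∈ s, w i • J i x) (hcont w)
      fun t => ⟨1, one_pos, ?_⟩
    refine (h.and_eventually hfam).mono fun x hx => ?_
    have hk := finrank_ker_of_isRegular hE hF hx.1.1
    refine hx.2.one_le_abs_det (hω x) hw hx.1.1 hk.le t le_rfl fun v => ?_
    have hTA : ∀ i ∈ s, ∀ v, T x ((∑ i ∈ s, w i • J i x) v) = T x (J i x v) := by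
      intro i hi v
      simp only [FunLike.coe_sum, Finset.sum_apply, map_sum,
        FunLike.coe_smul, Pi.smul_apply, map_smul]
      rw [Finset.sum_congr rfl fun j hj => by rw [hx.1.2 j hj i hi v], ← Finset.sum_smul,
        hw.sum_eq_one, one_smul]
    obtain ⟨i, hi⟩ : s.Nonempty := by
      rw [Finset.nonempty_iff_ne_empty]
      rintro rfl
      simpa using hw.sum_eq_one
    have h1 : T x (J i x ((∑ i ∈ s, w i • J i x) v - J i x v)) = 0 :=
      (hx.2.tame i hi).map_eq_zero (hx.2.sq i hi) (by rw [map_sub, hTA i hi, sub_self])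
    rw [map_sub, map_sub, sub_eq_zero, hx.2.sq i hi] at h1
    rw [hTA i hi, h1, one_smul, map_neg]
  -- along the sequence the operators induced by `A` converge to a tame one, which has no real
  -- eigenvalues
  · refine noRealEigenvalue_of_frequently_det (A := fun x => ∑ i ∈ s, w i • J i x) (hcont w)
      fun t => ?_
    choose! B B' hB hBt hB' hBtame using hext
    have hlim := tendsto_sum (ME := MF) (E := F) (p := q) (w := fun i _ => w i) (A := B) hqx
      (fun i _ => tendsto_const_nhds) hBt
    have htame := hw.isTame_sum hBtame
    have hno := htame.noRealEigenvalue (hω x₀)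
    have h1 := (tendsto_det hlim (t ^ 2)).abs
    have h2 := abs_pos.2 (hno.det_ne_zero t)
    refine ⟨_, half_pos h2, hqx.frequently ?_⟩
    have hBall : ∀ᶠ k in atTop, ∀ i ∈ s, ∀ v, B i k (T (q k) v) = T (q k) (J i (q k) v) :=
      (Filter.eventually_all_finset s).2 hB
    refine Eventually.frequently ?_
    filter_upwards [h1.eventually_const_le (half_lt_self h2), hBall, hqx.eventually hfam] with
      k hk1 hk2 hk3
    refine hk1.trans (hk3.abs_det_le (hω _) hw (hq k)
      (finrank_ker_of_isRegular hE hF (hq k)).le fun v => ?_)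
    have hTA : ∀ v, T (q k) ((∑ i ∈ s, w i • J i (q k)) v) =
        (∑ i ∈ s, w i • B i k) (T (q k) v) := by
      intro v
      simp only [FunLike.coe_sum, Finset.sum_apply, map_sum,
        FunLike.coe_smul, Pi.smul_apply, map_smul]
      exact Finset.sum_congr rfl fun i hi => by rw [hk2 i hi]
    rw [hTA, hTA]
    rfl

end Spectrum

/-! ### Phases of convex combinations in a fiber -/

section Fiber

set_option linter.unusedSectionVars false

variable {X : Type*} [TopologicalSpace X]
  {ME : Type*} [NormedAddCommGroup ME] [NormedSpace ℝ ME] [FiniteDimensional ℝ ME]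
  {E : X → Type*} [∀ x, AddCommGroup (E x)] [∀ x, Module ℝ (E x)]
  [TopologicalSpace (TotalSpace ME E)] [∀ x, TopologicalSpace (E x)]
  [∀ x, IsTopologicalAddGroup (E x)] [∀ x, ContinuousSMul ℝ (E x)]
  [FiberBundle ME E] [VectorBundle ℝ ME E]
  {MF : Type*} [NormedAddCommGroup MF] [NormedSpace ℝ MF] [FiniteDimensional ℝ MF]
  {F : X → Type*} [∀ x, AddCommGroup (F x)] [∀ x, Module ℝ (F x)]
  [TopologicalSpace (TotalSpace MF F)] [∀ x, TopologicalSpace (F x)]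
  [∀ x, IsTopologicalAddGroup (F x)] [∀ x, ContinuousSMul ℝ (F x)]
  [FiberBundle MF F] [VectorBundle ℝ MF F]

theorem IsWeight.sum_mem_convexHull {V ι : Type*} [AddCommGroup V] [Module ℝ V] {s : Finset ι}
    {w : ι → ℝ} (hw : IsWeight s w) {J : ι → V} {S : Set V} (h : ∀ i ∈ s, J i ∈ S) :
    ∑ i ∈ s, w i • J i ∈ convexHull ℝ S :=
  (convex_convexHull ℝ S).sum_mem hw.nonneg hw.sum_eq_one fun i hi =>
    subset_convexHull ℝ S (h i hi)

/-- The fiberwise condition `R` passes from complex structures to the phases of their convex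
combinations. -/
def IsPhaseStable (ME : Type*) [NormedAddCommGroup ME] [NormedSpace ℝ ME]
    {E : X → Type*} [∀ x, AddCommGroup (E x)] [∀ x, Module ℝ (E x)]
    [TopologicalSpace (TotalSpace ME E)] [∀ x, TopologicalSpace (E x)]
    [∀ x, IsTopologicalAddGroup (E x)] [∀ x, ContinuousSMul ℝ (E x)]
    [FiberBundle ME E] [VectorBundle ℝ ME E] (R : ∀ x, (E x →L[ℝ] E x) → Prop) : Prop :=
  ∀ x, ∀ A ∈ convexHull ℝ {J : E x →L[ℝ] E x | (∀ v, J (J v) = -v) ∧ R x J},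
    NoRealEigenvalue (A : E x →ₗ[ℝ] E x) → R x (fiberPhase ME x A)

theorem IsPhaseStable.and {R R' : ∀ x, (E x →L[ℝ] E x) → Prop} (h : IsPhaseStable ME R)
    (h' : IsPhaseStable ME R') : IsPhaseStable ME fun x J => R x J ∧ R' x J := by
  refine fun x A hA hno => ⟨h x A (convexHull_mono ?_ hA) hno, h' x A (convexHull_mono ?_ hA) hno⟩
  · rintro J ⟨h1, h2, h3⟩
    exact ⟨h1, h2⟩
  · rintro J ⟨h1, h2, h3⟩
    exact ⟨h1, h3⟩

theorem skew_of_alternating {V : Type*} [AddCommGroup V] [Module ℝ V] [TopologicalSpace V]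
    {ω : V →L[ℝ] V →L[ℝ] ℝ} (hω : ∀ v, ω v v = 0) (a b : V) : ω a b = -ω b a := by
  have := hω (a + b)
  simp only [map_add, FunLike.coe_add, Pi.add_apply, hω, zero_add, add_zero] at this
  linarith

/-- The form `ω` as an algebraic bilinear form. -/
def toBilin {W : Type*} [AddCommGroup W] [Module ℝ W] [TopologicalSpace W]
    (ω : W →L[ℝ] W →L[ℝ] ℝ) : W →ₗ[ℝ] W →ₗ[ℝ] ℝ :=
  LinearMap.mk₂ ℝ (fun a b => ω a b) (by simp) (by simp) (by simp) (by simp)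

theorem isPhaseStable_isTame {G : X → Type*} [∀ x, AddCommGroup (G x)] [∀ x, Module ℝ (G x)]
    [∀ x, TopologicalSpace (G x)] {T : ∀ x, E x →L[ℝ] G x} {ω : ∀ x, G x →L[ℝ] G x →L[ℝ] ℝ}
    (hω : ∀ x v, ω x v v = 0) : IsPhaseStable ME fun x => IsTame (ω x) (T x) := by
  intro x A hA hno v hv
  have h1 : IsTame (ω x) (T x) A ∧ ∀ v, T x v = 0 → T x (A v) = 0 := by
    refine convexHull_min (s := {J : E x →L[ℝ] E x | (∀ v, J (J v) = -v) ∧ IsTame (ω x) (T x) J})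
      (t := {A : E x →L[ℝ] E x | IsTame (ω x) (T x) A ∧ ∀ v, T x v = 0 → T x (A v) = 0})
      (fun J hJ => ⟨hJ.2, fun v hv => hJ.2.map_eq_zero hJ.1 hv⟩) ?_ hA
    rintro A ⟨hA, hA'⟩ B ⟨hB, hB'⟩ a b ha hb hab
    refine ⟨fun v hv => ?_, fun v hv => ?_⟩
    · have e : ω x (T x v) (T x ((a • A + b • B) v)) =
          a * ω x (T x v) (T x (A v)) + b * ω x (T x v) (T x (B v)) := by
        simp [smul_eq_mul]
      rw [e]
      have hA1 := hA v hv
      have hB1 := hB v hv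
      rcases ha.eq_or_lt with h0 | h0
      · rw [← h0, zero_add] at hab
        rw [← h0, hab]
        simpa using hB1
      · have := mul_pos h0 hA1
        have := mul_nonneg hb hB1.le
        linarith
    · simp [hA' v hv, hB' v hv]
  exact (fiberPhase_isPhase hno).tame (T := (T x : E x →ₗ[ℝ] G x)) (ω := toBilin (ω x))
    (skew_of_alternating (hω x)) h1.1 h1.2 hv

theorem IsCompatible.skew {V W : Type*} [AddCommGroup V] [Module ℝ V] [TopologicalSpace V]
    [AddCommGroup W] [Module ℝ W] [TopologicalSpace W] {ω : W →L[ℝ] W →L[ℝ] ℝ} {T : V →L[ℝ] W}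
    {J : V →L[ℝ] V} (hJ : ∀ v, J (J v) = -v) :
    (∀ v w, ω (T (J v)) (T (J w)) = ω (T v) (T w)) ↔
      ∀ u v, ω (T (J u)) (T v) = -ω (T u) (T (J v)) := by
  refine ⟨fun h u v => ?_, fun h v w => ?_⟩
  · rw [← h u (J v), hJ]; simp
  · rw [h, hJ]; simp

/-- For complex structures, invariance of `T^*ω` means skewness with respect to it, which is a linear
condition. -/
theorem isPhaseStable_isCompatible {G : X → Type*} [∀ x, AddCommGroup (G x)] [∀ x, Module ℝ (G x)]
    [∀ x, TopologicalSpace (G x)] {T : ∀ x, E x →L[ℝ] G x} {ω : ∀ x, G x →L[ℝ] G x →L[ℝ] ℝ}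
    (hω : ∀ x v, ω x v v = 0) : IsPhaseStable ME fun x => IsCompatible (ω x) (T x) := by
  refine (isPhaseStable_isTame hω).and fun x A hA hno => ?_
  have h1 : ∀ u v, ω x (T x (A u)) (T x v) = -ω x (T x u) (T x (A v)) := by
    refine convexHull_min
      (t := {A : E x →L[ℝ] E x | ∀ u v, ω x (T x (A u)) (T x v) = -ω x (T x u) (T x (A v))})
      (fun J hJ => (IsCompatible.skew hJ.1).1 hJ.2) ?_ hA
    intro A hA B hB a b _ _ _ u v
    have hA1 := hA u v
    have hB1 := hB u v
    simp only [FunLike.coe_add, FunLike.coe_smul, Pi.add_apply, Pi.smul_apply, map_add, map_smul,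
      smul_eq_mul]
    rw [hA1, hB1]
    ring
  refine (IsCompatible.skew fun v => fiberPhase_apply_fiberPhase hno v).2 ?_
  exact (fiberPhase_isPhase hno).skew (T := (T x : E x →ₗ[ℝ] G x)) (ω := toBilin (ω x))
    (skew_of_alternating (hω x)) h1

/-- If all `J i` induce the same structure on the image of `T`, then so does the phase of a convex
combination. -/
theorem map_fiberPhase_sum {W ι : Type*} [AddCommGroup W] [Module ℝ W] [TopologicalSpace W]
    {x : X} {T : E x →L[ℝ] W} {s : Finset ι} {w : ι → ℝ} (hw : IsWeight s w)
    {J : ι → E x →L[ℝ] E x} {K : E x →L[ℝ] E x} (hK : ∀ v, K (K v) = -v)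
    (hKT : ∀ v, T v = 0 → T (K v) = 0) (h : ∀ i ∈ s, ∀ v, T (J i v) = T (K v))
    (hno : NoRealEigenvalue ((∑ i ∈ s, w i • J i : E x →L[ℝ] E x) : E x →ₗ[ℝ] E x)) (v : E x) :
    T (fiberPhase ME x (∑ i ∈ s, w i • J i) v) = T (K v) := by
  let N := LinearMap.ker (T : E x →ₗ[ℝ] W)
  let K' : (E x ⧸ N) →ₗ[ℝ] (E x ⧸ N) := N.mapQ N (K : E x →ₗ[ℝ] E x) fun v hv => hKT v hv
  have hK' : ∀ v, K' (K' v) = -v := by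
    intro v
    obtain ⟨v, rfl⟩ := N.mkQ_surjective v
    change N.mkQ (K (K v)) = -N.mkQ v
    rw [hK, map_neg]
  have hmk : ∀ a b : E x, N.mkQ a = N.mkQ b ↔ T a = T b := by
    intro a b
    rw [Submodule.mkQ_apply, Submodule.mkQ_apply, Submodule.Quotient.eq, LinearMap.mem_ker,
      ← sub_eq_zero (b := T b), ← map_sub]
    rfl
  refine (hmk _ _).1 ?_
  refine (fiberPhase_isPhase (ME := ME) hno).intertwine (isPhase_self hK')
    (noRealEigenvalue_of_sq hK') (T := N.mkQ) (fun v => ?_) v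
  change N.mkQ ((∑ i ∈ s, w i • J i) v) = N.mkQ (K v)
  rw [hmk]
  simp only [FunLike.coe_sum, Finset.sum_apply, map_sum, FunLike.coe_smul, Pi.smul_apply, map_smul]
  rw [Finset.sum_congr rfl fun j hj => by rw [h j hj v], ← Finset.sum_smul, hw.sum_eq_one, one_smul]

/-- The segment from a vertex `J i` to the convex combination consists of operators without real
eigenvalues, so its phases form a path of complex structures that starts at `J i`. -/
theorem inducesOrientation_fiberPhase_sum {ι : Type*} {n : ℕ} {x : X}
    {o : Orientation ℝ (E x) (Fin n × Fin 2)} {s : Finset ι} {w : ι → ℝ} (hw : IsWeight s w)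
    {J : ι → E x →L[ℝ] E x} (hJ : ∀ i ∈ s, ∀ v, J i (J i v) = -v)
    (ho : ∀ i ∈ s, InducesOrientation o (J i))
    (hno : ∀ w, IsWeight s w →
      NoRealEigenvalue ((∑ i ∈ s, w i • J i : E x →L[ℝ] E x) : E x →ₗ[ℝ] E x)) :
    InducesOrientation o (fiberPhase ME x (∑ i ∈ s, w i • J i)) := by
  classical
  have := finiteDimensional_fiber ME (E := E) x
  obtain ⟨i, hi⟩ : s.Nonempty := by
    rw [Finset.nonempty_iff_ne_empty]
    rintro rfl
    simpa using hw.sum_eq_one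
  let u : I → ι → ℝ := fun r k => (1 - (r : ℝ)) * (if k = i then 1 else 0) + r * w k
  have hu : ∀ r, IsWeight s (u r) := by
    intro r
    refine ⟨fun k hk => ?_, ?_⟩
    · exact add_nonneg (mul_nonneg (sub_nonneg.2 r.2.2) (by split_ifs <;> simp))
        (mul_nonneg r.2.1 (hw.nonneg k hk))
    · simp only [u, Finset.sum_add_distrib, ← Finset.mul_sum, hw.sum_eq_one]
      simp [hi]
  let e := fiberEquiv ME x x (mem_baseSet_trivializationAt ME E x)
  have key := inducesOrientation_of_path e (o := o)
    (J := fun r => fiberPhase ME x (∑ k ∈ s, u r k • J k)) ?_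
    (fun r v => fiberPhase_apply_fiberPhase (hno _ (hu r)) v) ?_
  · simpa [u] using key
  · have h1 : ∀ r, (e : E x →L[ℝ] ME) ∘L fiberPhase ME x (∑ k ∈ s, u r k • J k) ∘L
        (e.symm : ME →L[ℝ] E x) = phase (inCoord ME x x (∑ k ∈ s, u r k • J k)) := by
      intro r
      rw [← inCoord_fiberPhase (mem_baseSet_trivializationAt ME E x) (hno _ (hu r)), inCoord_eq]
    simp only [h1, inCoord_sum]
    refine continuousOn_phase.comp_continuous ?_ fun r => ?_
    · fun_prop
    · have := inCoord_noRealEigenvalue (mem_baseSet_trivializationAt ME E x) (hno _ (hu r))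
      rwa [inCoord_sum] at this
  · have h1 : ∑ k ∈ s, u 0 k • J k = J i := by
      simp [u, hi]
    change InducesOrientation o (fiberPhase ME x (∑ k ∈ s, u 0 k • J k))
    rw [h1, fiberPhase_of_sq (hJ i hi)]
    exact ho i hi

/-- Convergence of the induced structures along a sequence of regular points passes to phases of
convex combinations. -/
theorem ExtendsAlong.fiberPhase_sum {ι : Type*} {T : ∀ x, E x →L[ℝ] F x}
    {ωF : ∀ x, F x →L[ℝ] F x →L[ℝ] ℝ} (hω : ∀ x v, ωF x v v = 0) {s : Finset ι}
    {w : ι → X → ℝ} {J : ι → ∀ x, E x →L[ℝ] E x} {K : ∀ x, E x →L[ℝ] E x} {q : ℕ → X} {x₀ : X}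
    (hq : Tendsto q atTop (𝓝 x₀)) (hreg : ∀ k, IsRegular T (q k))
    (hwc : ∀ i ∈ s, ContinuousAt (w i) x₀) (hw : ∀ᶠ x in 𝓝 x₀, IsWeight s fun i => w i x)
    (htame : ∀ᶠ x in 𝓝 x₀, ∀ i ∈ s, IsTame (ωF x) (T x) (J i x))
    (hno : ∀ᶠ x in 𝓝 x₀, NoRealEigenvalue
      ((∑ i ∈ s, w i x • J i x : E x →L[ℝ] E x) : E x →ₗ[ℝ] E x))
    (hK : ∀ᶠ x in 𝓝 x₀, K x = fiberPhase ME x (∑ i ∈ s, w i x • J i x))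
    (h : ∀ i ∈ s, ExtendsAlong MF T ωF q x₀ (J i)) : ExtendsAlong MF T ωF q x₀ K := by
  choose! B B' hB hBt hB' hBtame using h
  have hw₀ := hw.self_of_nhds
  have hlim := tendsto_sum (ME := MF) (E := F) (p := q) (w := fun i k => w i (q k)) (A := B) hq
    (fun i hi => (hwc i hi).tendsto.comp hq) hBt
  have hno₀ := (hw₀.isTame_sum hBtame).noRealEigenvalue (hω x₀)
  have hBall : ∀ᶠ k in atTop, ∀ i ∈ s, ∀ v, B i k (T (q k) v) = T (q k) (J i (q k) v) :=
    (Filter.eventually_all_finset s).2 hB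
  have hTA : ∀ᶠ k in atTop, ∀ v, T (q k) ((∑ i ∈ s, w i (q k) • J i (q k)) v) =
      (∑ i ∈ s, w i (q k) • B i k) (T (q k) v) := by
    filter_upwards [hBall] with k hk v
    simp only [FunLike.coe_sum, Finset.sum_apply, map_sum,
      FunLike.coe_smul, Pi.smul_apply, map_smul]
    exact Finset.sum_congr rfl fun i hi => by rw [hk i hi]
  have hnoB : ∀ᶠ k in atTop, NoRealEigenvalue
      ((∑ i ∈ s, w i (q k) • B i k : F (q k) →L[ℝ] F (q k)) : F (q k) →ₗ[ℝ] F (q k)) := by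
    filter_upwards [hTA, hq.eventually hw, hq.eventually htame] with k hk hwk hJ
    refine IsTame.noRealEigenvalue (hω (q k)) fun u hu => ?_
    obtain ⟨v, rfl⟩ := hreg k u
    have := hwk.isTame_sum hJ v hu
    rwa [hk] at this
  refine ⟨fun k => fiberPhase MF (q k) (∑ i ∈ s, w i (q k) • B i k),
    fiberPhase MF x₀ (∑ i ∈ s, w i x₀ • B' i), ?_, tendsto_fiberPhase hlim hno₀ hnoB,
    fiberPhase_apply_fiberPhase hno₀, ?_⟩
  · filter_upwards [hTA, hnoB, hq.eventually hno, hq.eventually hK] with k h1 h2 h3 h4 v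
    rw [h4]
    exact ((fiberPhase_isPhase h3).intertwine (fiberPhase_isPhase (ME := MF) h2) h2
      (T := (T (q k) : E (q k) →ₗ[ℝ] F (q k))) h1 v).symm
  · exact isPhaseStable_isTame (T := fun x => ContinuousLinearMap.id ℝ (F x)) hω x₀ _
      (hw₀.sum_mem_convexHull fun i hi => ⟨hB' i hi, hBtame i hi⟩) hno₀

end Fiber

/-! ### Splicing complex structures -/

section Splicing

set_option linter.unusedSectionVars false

variable {X : Type*} [TopologicalSpace X]
  {ME : Type*} [NormedAddCommGroup ME] [NormedSpace ℝ ME] [FiniteDimensional ℝ ME]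
  {E : X → Type*} [∀ x, AddCommGroup (E x)] [∀ x, Module ℝ (E x)]
  [TopologicalSpace (TotalSpace ME E)] [∀ x, TopologicalSpace (E x)]
  [∀ x, IsTopologicalAddGroup (E x)] [∀ x, ContinuousSMul ℝ (E x)]
  [FiberBundle ME E] [VectorBundle ℝ ME E]
  {MF : Type*} [NormedAddCommGroup MF] [NormedSpace ℝ MF] [FiniteDimensional ℝ MF]
  {F : X → Type*} [∀ x, AddCommGroup (F x)] [∀ x, Module ℝ (F x)]
  [TopologicalSpace (TotalSpace MF F)] [∀ x, TopologicalSpace (F x)]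
  [∀ x, IsTopologicalAddGroup (F x)] [∀ x, ContinuousSMul ℝ (F x)]
  [FiberBundle MF F] [VectorBundle ℝ MF F]

theorem pushforward_eq_iff {V W : Type*} [AddCommGroup V] [Module ℝ V] [TopologicalSpace V]
    [AddCommGroup W] [Module ℝ W] [TopologicalSpace W] {ω : W →L[ℝ] W →L[ℝ] ℝ} {T : V →L[ℝ] W}
    {J K : V →L[ℝ] V} (hJ : ∀ v, J (J v) = -v) (hJT : IsTame ω T J) (hK : ∀ v, K (K v) = -v)
    (hKT : IsTame ω T K) : pushforward T J = pushforward T K ↔ ∀ v, T (J v) = T (K v) := by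
  refine ⟨fun h v => ?_, fun h => ?_⟩
  · rw [← pushforward_apply hJ hJT v, h, pushforward_apply hK hKT]
  · funext w
    exact Subtype.ext (h _)

/-- If `A` is near each point a convex combination of complex structures `J i`, `i ∈ s x₀`, with the
required properties, and these agree at `x₀` or are controlled there, then the phase of `A` is a
complex structure with the required properties. -/
theorem isGlobal_fiberPhase {n : ℕ} (hE : finrank ℝ ME = 2 * n) (hF : finrank ℝ MF + 2 = 2 * n)
    {oE : ∀ x, Orientation ℝ (E x) (Fin n × Fin 2)} {T : ∀ x, E x →L[ℝ] F x}
    (hT : Continuous fun x => TotalSpace.mk' (ME →L[ℝ] MF) (E := fun y => E y →L[ℝ] F y) x (T x))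
    {ωF : ∀ x, F x →L[ℝ] F x →L[ℝ] ℝ} (hω : ∀ x v, ωF x v v = 0)
    {R : ∀ x, (E x →L[ℝ] E x) → Prop} (hR : IsPhaseStable ME R)
    (hRt : ∀ x J, R x J → IsTame (ωF x) (T x) J) {C D S : Set X} {q : X → ℕ → X}
    (hq : ∀ x ∈ S, (∀ k, IsRegular T (q x k)) ∧ Tendsto (q x) atTop (𝓝 x))
    {JC : ∀ x, E x →L[ℝ] E x} {JD : ∀ x, range (T x) → range (T x)}
    {ι : Type*} (s : X → Finset ι) {w : ι → X → ℝ} {J : ι → ∀ x, E x →L[ℝ] E x}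
    {A : ∀ x, E x →L[ℝ] E x}
    (hw : ∀ x₀, ∀ᶠ x in 𝓝 x₀, IsWeight (s x₀) (fun i => w i x) ∧ A x = ∑ i ∈ s x₀, w i x • J i x)
    (hwc : ∀ x₀, ∀ i ∈ s x₀, ContinuousAt (w i) x₀)
    (hJ : ∀ x₀, ∀ i ∈ s x₀, ∃ N ∈ 𝓝 x₀, IsComplexStructureOn ME oE N (J i) ∧ ∀ x ∈ N, R x (J i x))
    (hJS : ∀ x₀ ∈ S, ∀ i ∈ s x₀, ExtendsAlong MF T ωF (q x₀) x₀ (J i))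
    (hJC : ∀ x₀ ∈ C, ∀ i ∈ s x₀, J i x₀ = JC x₀)
    (hJD : ∀ x₀ ∈ D, ∀ i ∈ s x₀, pushforward (T x₀) (J i x₀) = JD x₀)
    (hctrl : ∀ x₀ ∉ C, IsControlled ME MF T ωF (s x₀) J x₀) :
    (∀ x, NoRealEigenvalue (A x : E x →ₗ[ℝ] E x)) ∧
      IsGlobal ME oE T R C D JC JD (fun x => fiberPhase ME x (A x)) ∧
      IsExtendible MF T ωF S q univ (fun x => fiberPhase ME x (A x)) := by
  have hfam : ∀ x₀, ∀ᶠ x in 𝓝 x₀, IsTameFamily (oE x) (ωF x) (T x) (s x₀) (fun i => J i x) := by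
    intro x₀
    have h1 : ∀ i ∈ s x₀, ∀ᶠ x in 𝓝 x₀, (∀ v, J i x (J i x v) = -v) ∧
        InducesOrientation (oE x) (J i x) ∧ IsTame (ωF x) (T x) (J i x) := by
      intro i hi
      obtain ⟨N, hN, h1, h2⟩ := hJ x₀ i hi
      filter_upwards [hN] with x hx using ⟨h1.sq x hx, h1.orientation x hx, hRt _ _ (h2 x hx)⟩
    filter_upwards [(Filter.eventually_all_finset _).2 h1] with x hx
    exact ⟨fun i hi => (hx i hi).1, fun i hi => (hx i hi).2.1, fun i hi => (hx i hi).2.2⟩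
  have hcont : ∀ x₀, ∀ i ∈ s x₀, ContinuousAt
      (fun x => TotalSpace.mk' (ME →L[ℝ] ME) (E := fun y => E y →L[ℝ] E y) x (J i x)) x₀ := by
    intro x₀ i hi
    obtain ⟨N, hN, h1, -⟩ := hJ x₀ i hi
    exact h1.continuousOn.continuousAt hN
  have hne : ∀ x₀, ∃ k, k ∈ s x₀ := by
    intro x₀
    have h1 := (hw x₀).self_of_nhds.1.sum_eq_one
    by_contra hcon
    push Not at hcon
    rw [Finset.eq_empty_of_forall_notMem hcon] at h1
    simp at h1
  have hno : ∀ x₀, ∀ u, IsWeight (s x₀) u → NoRealEigenvalue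
      ((∑ i ∈ s x₀, u i • J i x₀ : E x₀ →L[ℝ] E x₀) : E x₀ →ₗ[ℝ] E x₀) := by
    intro x₀ u hu
    by_cases hx : x₀ ∈ C
    · obtain ⟨k, hk⟩ := hne x₀
      rw [Finset.sum_congr rfl fun i hi => by rw [hJC x₀ hx i hi, ← hJC x₀ hx k hk],
        ← Finset.sum_smul, hu.sum_eq_one, one_smul]
      exact noRealEigenvalue_of_sq ((hfam x₀).self_of_nhds.sq k hk)
    · exact (hctrl x₀ hx).noRealEigenvalue hE hF hT hω (hfam x₀) (hcont x₀) hu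
  have hA : ∀ x₀, A x₀ = ∑ i ∈ s x₀, w i x₀ • J i x₀ := fun x₀ => (hw x₀).self_of_nhds.2
  have hw₀ : ∀ x₀, IsWeight (s x₀) (fun i => w i x₀) := fun x₀ => (hw x₀).self_of_nhds.1
  have hnoA : ∀ x, NoRealEigenvalue (A x : E x →ₗ[ℝ] E x) := by
    intro x
    rw [hA]
    exact hno x _ (hw₀ x)
  have hR₀ : ∀ x, ∀ i ∈ s x, R x (J i x) := by
    intro x i hi
    obtain ⟨N, hN, -, h2⟩ := hJ x i hi
    exact h2 x (mem_of_mem_nhds hN)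
  refine ⟨hnoA, ⟨⟨?_, fun x _ => fiberPhase_apply_fiberPhase (hnoA x), fun x _ => ?_⟩,
    fun x => ?_, fun x hx => ?_, fun x hx => ?_⟩, ?_⟩
  · refine (continuous_iff_continuousAt.2 fun x₀ => ?_).continuousOn
    refine tendsto_fiberPhase (p := id) (A := A) ?_ (hnoA x₀) (Eventually.of_forall hnoA)
    have h1 := tendsto_sum (p := id) (s := s x₀) (w := w) (A := J) (l := 𝓝 x₀) tendsto_id
      (fun i hi => hwc x₀ i hi) (fun i hi => hcont x₀ i hi)
    rw [hA x₀]
    refine h1.congr' ?_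
    filter_upwards [hw x₀] with x hx
    rw [hx.2]
  · rw [hA x]
    exact inducesOrientation_fiberPhase_sum (hw₀ x) (hfam x).self_of_nhds.sq
      (hfam x).self_of_nhds.orientation (hno x)
  · refine hR x _ ?_ (hnoA x)
    rw [hA x]
    exact (hw₀ x).sum_mem_convexHull fun i hi => ⟨(hfam x).self_of_nhds.sq i hi, hR₀ x i hi⟩
  · obtain ⟨k, hk⟩ := hne x
    have h1 : A x = JC x := by
      rw [hA x, Finset.sum_congr rfl fun i hi => by rw [hJC x hx i hi],
        ← Finset.sum_smul, (hw₀ x).sum_eq_one, one_smul]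
    rw [h1, fiberPhase_of_sq]
    rw [← hJC x hx k hk]
    exact (hfam x).self_of_nhds.sq k hk
  · obtain ⟨k, hk⟩ := hne x
    have hf := (hfam x).self_of_nhds
    rw [← hJD x hx k hk]
    funext u
    refine Subtype.ext ?_
    change T x (fiberPhase ME x (A x) _) = T x (J k x _)
    have hnoA' := hnoA x
    rw [hA x] at hnoA' ⊢
    refine map_fiberPhase_sum (hw₀ x) (hf.sq k hk)
      (fun v hv => (hf.tame k hk).map_eq_zero (hf.sq k hk) hv) (fun i hi => ?_) hnoA' _
    exact (pushforward_eq_iff (hf.sq i hi) (hf.tame i hi) (hf.sq k hk) (hf.tame k hk)).1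
      ((hJD x hx i hi).trans (hJD x hx k hk).symm)
  · rintro x ⟨hx, -⟩
    refine ExtendsAlong.fiberPhase_sum (ME := ME) (E := E)
      (K := fun x => fiberPhase ME x (A x)) hω (hq x hx).2 (hq x hx).1 (hwc x)
      ((hw x).mono fun y hy => hy.1) ((hfam x).mono fun y hy => hy.tame) ?_ ?_ (hJS x hx)
    · filter_upwards [hw x] with y hy
      rw [← hy.2]
      exact hnoA y
    · filter_upwards [hw x] with y hy
      rw [hy.2]

/-- The domain, shrunk away from `C` or `D`, of the local structure with index `i`; the index `none`
stands for the structure near `C`. -/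
def localDomain (C D U V : Set X) (W : X → Set X) : Option X → Set X
  | none => U
  | some a => {x | a ∉ U ∧ x ∈ W a ∧ x ∉ C ∧ (x ∈ D → a ∈ V)}

/-- All local structures as one family; the index `none` stands for the structure near `C`. -/
def localFamily (JC : ∀ x, E x →L[ℝ] E x) (Jloc : X → ∀ x, E x →L[ℝ] E x) :
    Option X → ∀ x, E x →L[ℝ] E x
  | none => JC
  | some a => Jloc a

theorem IsComplexStructureOn.mono {n : ℕ} {oE : ∀ x, Orientation ℝ (E x) (Fin n × Fin 2)}
    {N N' : Set X} {J : ∀ x, E x →L[ℝ] E x} (h : IsComplexStructureOn ME oE N J) (hN : N' ⊆ N) :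
    IsComplexStructureOn ME oE N' J :=
  ⟨h.continuousOn.mono hN, fun x hx => h.sq x (hN hx), fun x hx => h.orientation x (hN hx)⟩

namespace IsLocalData

variable {n : ℕ} {oE : ∀ x, Orientation ℝ (E x) (Fin n × Fin 2)} {T : ∀ x, E x →L[ℝ] F x}
  {R : ∀ x, (E x →L[ℝ] E x) → Prop} {C D U V : Set X} {W : X → Set X}
  {JC : ∀ x, E x →L[ℝ] E x} {Jloc : X → ∀ x, E x →L[ℝ] E x}

theorem isOpen_localDomain (h : IsLocalData ME oE T R C D U V W JC Jloc) (hC : IsClosed C)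
    (hD : IsClosed D) : ∀ i, IsOpen (localDomain C D U V W i)
  | none => h.isOpen_U
  | some a => by
    by_cases ha : a ∈ U
    · have : localDomain C D U V W (some a) = ∅ := by
        ext x; simp [localDomain, ha]
      rw [this]; exact isOpen_empty
    · by_cases hV : a ∈ V
      · have : localDomain C D U V W (some a) = W a ∩ Cᶜ := by
          ext x; simp [localDomain, ha, hV]
        rw [this]; exact (h.isOpen_W a ha).inter hC.isOpen_compl
      · have : localDomain C D U V W (some a) = W a ∩ (Cᶜ ∩ Dᶜ) := by
          ext x; simp [localDomain, ha, hV]; tauto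
        rw [this]
        exact (h.isOpen_W a ha).inter (hC.isOpen_compl.inter hD.isOpen_compl)

theorem exists_mem_localDomain (h : IsLocalData ME oE T R C D U V W JC Jloc) (x : X) :
    ∃ i, x ∈ localDomain C D U V W i := by
  by_cases hx : x ∈ U
  · exact ⟨none, hx⟩
  · exact ⟨some x, hx, h.mem_W x hx, fun hxC => hx (h.subset_U hxC), fun hxD => h.subset_V hxD⟩

theorem complex (h : IsLocalData ME oE T R C D U V W JC Jloc) :
    ∀ i, IsComplexStructureOn ME oE (localDomain C D U V W i) (localFamily JC Jloc i)
  | none => h.complex_C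
  | some a => by
    by_cases ha : a ∈ U
    · exact ⟨fun x hx => absurd ha hx.1, fun x hx => absurd ha hx.1, fun x hx => absurd ha hx.1⟩
    · exact (h.complex_W a ha).mono fun x hx => hx.2.1

theorem rel (h : IsLocalData ME oE T R C D U V W JC Jloc) :
    ∀ i, ∀ x ∈ localDomain C D U V W i, R x (localFamily JC Jloc i x)
  | none => h.rel_C
  | some a => fun x hx => h.rel_W a hx.1 x hx.2.1

theorem pushforward_eq (h : IsLocalData ME oE T R C D U V W JC Jloc) {x : X} (hx : x ∈ D) :
    ∀ i, x ∈ localDomain C D U V W i →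
      pushforward (T x) (localFamily JC Jloc i x) = imageStructure T U JC Jloc x
  | none => fun hi => by
    have hi : x ∈ U := hi
    simp [imageStructure, hi, localFamily]
  | some a => fun hi => by
    by_cases hU : x ∈ U
    · simpa [imageStructure, hU, localFamily] using h.agree_C a ⟨hi.2.2.2 hx, hi.1⟩ x ⟨hi.2.1, hU⟩
    · simpa [imageStructure, hU, localFamily] using h.agree_W a ⟨hi.2.2.2 hx, hi.1⟩ x
        ⟨h.subset_V hx, hU⟩ x ⟨hi.2.1, h.mem_W x hU⟩

/-- Two local structures whose shrunk domains share a point of `D` induce the same structure on the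
image of `T` wherever both are defined. -/
theorem map_eq (h : IsLocalData ME oE T R C D U V W JC Jloc) {ωF : ∀ x, F x →L[ℝ] F x →L[ℝ] ℝ}
    (hRt : ∀ x J, R x J → IsTame (ωF x) (T x) J) {x₀ x : X} (hx₀ : x₀ ∈ D) {i j : Option X}
    (hi₀ : x₀ ∈ localDomain C D U V W i) (hj₀ : x₀ ∈ localDomain C D U V W j)
    (hi : x ∈ localDomain C D U V W i) (hj : x ∈ localDomain C D U V W j) (v : E x) :
    T x (localFamily JC Jloc i x v) = T x (localFamily JC Jloc j x v) := by
  refine (pushforward_eq_iff ((h.complex i).sq x hi) (hRt _ _ (h.rel i x hi))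
    ((h.complex j).sq x hj) (hRt _ _ (h.rel j x hj))).1 ?_ v
  rcases i with _ | a <;> rcases j with _ | b
  · rfl
  · exact (h.agree_C b ⟨hj₀.2.2.2 hx₀, hj₀.1⟩ x ⟨hj.2.1, hi⟩).symm
  · exact h.agree_C a ⟨hi₀.2.2.2 hx₀, hi₀.1⟩ x ⟨hi.2.1, hj⟩
  · exact h.agree_W a ⟨hi₀.2.2.2 hx₀, hi₀.1⟩ b ⟨hj₀.2.2.2 hx₀, hj₀.1⟩ x ⟨hi.2.1, hj.2.1⟩

/-- The phase of the sum of the local structures, weighted by a partition of unity, is a global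
structure. -/
theorem exists_isGlobal [TopologicalSpace.MetrizableSpace X]
    (h : IsLocalData ME oE T R C D U V W JC Jloc)
    (hE : finrank ℝ ME = 2 * n) (hF : finrank ℝ MF + 2 = 2 * n)
    (hT : Continuous fun x => TotalSpace.mk' (ME →L[ℝ] MF) (E := fun y => E y →L[ℝ] F y) x (T x))
    (hC : IsClosed C) (hD : IsClosed D) (hdense : Cᶜ ⊆ closure {x | x ∉ C ∧ IsRegular T x})
    {ωF : ∀ x, F x →L[ℝ] F x →L[ℝ] ℝ} (hω : ∀ x v, ωF x v v = 0)
    (hR : IsPhaseStable ME R) (hRt : ∀ x J, R x J → IsTame (ωF x) (T x) J)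
    {S : Set X} {q : X → ℕ → X}
    (hq : ∀ x ∈ S, (∀ k, IsRegular T (q x k)) ∧ Tendsto (q x) atTop (𝓝 x))
    (hS : ∀ x ∉ D, IsWrapped ME T x ∨ finrank ℝ ME ≤ 4 ∨ x ∈ S)
    (hext : IsExtendible MF T ωF S q U JC)
    (hext' : ∀ a ∉ U, IsExtendible MF T ωF S q (W a) (Jloc a)) :
    ∃ J, IsGlobal ME oE T R C D JC (imageStructure T U JC Jloc) J ∧
      IsExtendible MF T ωF S q univ J := by
  let _ := TopologicalSpace.metrizableSpaceMetric X
  obtain ⟨ρ, hρ⟩ := PartitionOfUnity.exists_isSubordinate isClosed_univ (localDomain C D U V W)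
    (h.isOpen_localDomain hC hD) fun x _ => mem_iUnion.2 (h.exists_mem_localDomain x)
  have hmem : ∀ x, ∀ i ∈ ρ.fintsupport x, x ∈ localDomain C D U V W i := fun x i hi =>
    hρ i ((ρ.mem_fintsupport_iff x i).1 hi)
  refine ⟨_, (isGlobal_fiberPhase (MF := MF) hE hF hT hω hR hRt hq ρ.fintsupport
    (w := fun i x => ρ i x) (J := localFamily JC Jloc)
    (A := fun x => ∑ i ∈ ρ.finsupport x, ρ i x • localFamily JC Jloc i x) (fun x₀ => ?_)
    (fun x₀ i _ => (ρ i).continuous.continuousAt)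
    (fun x₀ i hi => ⟨_, (h.isOpen_localDomain hC hD i).mem_nhds (hmem x₀ i hi), h.complex i,
      h.rel i⟩) (fun x₀ hx₀ i hi => ?_) (fun x₀ hx₀ i hi => ?_)
    (fun x₀ hx₀ i hi => h.pushforward_eq hx₀ i (hmem x₀ i hi)) fun x₀ hx₀ => ?_).2⟩
  · filter_upwards [ρ.eventually_finsupport_subset x₀] with x hx
    refine ⟨⟨fun i _ => ρ.nonneg i x, ρ.sum_finsupport' (mem_univ x) hx⟩, ?_⟩
    refine Finset.sum_subset hx fun i _ hi => ?_
    rw [ρ.mem_finsupport, Function.notMem_support] at hi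
    rw [hi, zero_smul]
  · have := hmem x₀ i hi
    rcases i with _ | a
    · exact hext x₀ ⟨hx₀, this⟩
    · exact hext' a this.1 x₀ ⟨hx₀, this.2.1⟩
  · have := hmem x₀ i hi
    rcases i with _ | a
    · rfl
    · exact absurd hx₀ this.2.2.1
  · have hreg : x₀ ∈ closure {y | IsRegular T y} :=
      closure_mono (fun y hy => hy.2) (hdense hx₀)
    by_cases hx : x₀ ∈ D
    · refine Or.inr (Or.inr (Or.inl ?_))
      have h1 : ∀ i ∈ ρ.fintsupport x₀, ∀ᶠ y in 𝓝 x₀, y ∈ localDomain C D U V W i := fun i hi =>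
        (h.isOpen_localDomain hC hD i).mem_nhds (hmem x₀ i hi)
      refine ((mem_closure_iff_frequently.1 hreg).and_eventually
        ((Filter.eventually_all_finset _).2 h1)).mono fun y hy => ⟨hy.1, fun i hi j hj => ?_⟩
      exact h.map_eq hRt hx (hmem x₀ i hi) (hmem x₀ j hj) (hy.2 i hi) (hy.2 j hj)
    · rcases hS x₀ hx with h1 | h1 | h1
      · exact Or.inl h1
      · exact Or.inr (Or.inl ⟨h1, hreg⟩)
      · refine Or.inr (Or.inr (Or.inr ⟨q x₀, (hq x₀ h1).1, (hq x₀ h1).2, fun i hi => ?_⟩))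
        have := hmem x₀ i hi
        rcases i with _ | a
        · exact hext x₀ ⟨h1, this⟩
        · exact hext' a this.1 x₀ ⟨h1, this.2.1⟩

end IsLocalData

end Splicing

/-! ### Contracting spaces of complex structures -/

section Contraction

set_option linter.unusedSectionVars false

variable {X : Type*} [TopologicalSpace X]
  {ME : Type*} [NormedAddCommGroup ME] [NormedSpace ℝ ME] [FiniteDimensional ℝ ME]
  {E : X → Type*} [∀ x, AddCommGroup (E x)] [∀ x, Module ℝ (E x)]
  [TopologicalSpace (TotalSpace ME E)] [∀ x, TopologicalSpace (E x)]
  [∀ x, IsTopologicalAddGroup (E x)] [∀ x, ContinuousSMul ℝ (E x)]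
  [FiberBundle ME E] [VectorBundle ℝ ME E]
  {MF : Type*} [NormedAddCommGroup MF] [NormedSpace ℝ MF] [FiniteDimensional ℝ MF]
  {F : X → Type*} [∀ x, AddCommGroup (F x)] [∀ x, Module ℝ (F x)]
  [TopologicalSpace (TotalSpace MF F)] [∀ x, TopologicalSpace (F x)]
  [∀ x, IsTopologicalAddGroup (F x)] [∀ x, ContinuousSMul ℝ (F x)]
  [FiberBundle MF F] [VectorBundle ℝ MF F]

theorem IsWeaklyContractible.of_contractibleSpace {Y : Type*} [TopologicalSpace Y]
    [ContractibleSpace Y] : IsWeaklyContractible Y :=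
  ⟨inferInstance, fun _ f => (id_nullhomotopic Y).comp_left f⟩

/-- The weights `1 - r` and `r`. -/
def pairWeight (r : ℝ) (b : Bool) : ℝ := bif b then r else 1 - r

/-- The family consisting of `v₀` and `v₁`. -/
def pairFamily {V : Type*} (v₀ v₁ : V) (b : Bool) : V := bif b then v₁ else v₀

theorem isWeight_pairWeight (r : I) : IsWeight Finset.univ (pairWeight r) := by
  refine ⟨fun b _ => ?_, by simp [pairWeight]⟩
  cases b
  · exact sub_nonneg.2 r.2.2
  · exact r.2.1

/-- The convex combination `(1 - r) J₀ + r J`, written as a sum over the family of both structures. -/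
def interpolate {V : Type*} [AddCommGroup V] [Module ℝ V] (r : ℝ) (J₀ J : V) : V :=
  ∑ b, pairWeight r b • pairFamily J₀ J b

theorem interpolate_zero {V : Type*} [AddCommGroup V] [Module ℝ V] (J₀ J : V) :
    interpolate 0 J₀ J = J₀ := by
  simp [interpolate, pairWeight, pairFamily]

theorem interpolate_one {V : Type*} [AddCommGroup V] [Module ℝ V] (J₀ J : V) :
    interpolate 1 J₀ J = J := by
  simp [interpolate, pairWeight, pairFamily]

/-- The pairs of a parameter `r` and an endomorphism `τ` of a fiber for which `(1 - r) J₀ + r τ` has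
no real eigenvalues. -/
def interpolationDomain (ME : Type*) [NormedAddCommGroup ME] [NormedSpace ℝ ME]
    {E : X → Type*} [∀ x, AddCommGroup (E x)] [∀ x, Module ℝ (E x)]
    [TopologicalSpace (TotalSpace ME E)] [∀ x, TopologicalSpace (E x)]
    [∀ x, IsTopologicalAddGroup (E x)] [∀ x, ContinuousSMul ℝ (E x)]
    [FiberBundle ME E] [VectorBundle ℝ ME E] (J₀ : ∀ x, E x →L[ℝ] E x) :
    Set (I × TotalSpace (ME →L[ℝ] ME) fun x => E x →L[ℝ] E x) :=
  {m | NoRealEigenvalue (interpolate (m.1 : ℝ) (J₀ m.2.proj) m.2.2 :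
    E m.2.proj →ₗ[ℝ] E m.2.proj)}

theorem continuous_fiberPhase_interpolate {J₀ : ∀ x, E x →L[ℝ] E x}
    (hJ₀ : Continuous fun x =>
      TotalSpace.mk' (ME →L[ℝ] ME) (E := fun y => E y →L[ℝ] E y) x (J₀ x)) :
    Continuous fun m : interpolationDomain ME J₀ =>
      TotalSpace.mk' (ME →L[ℝ] ME) (E := fun y => E y →L[ℝ] E y) m.1.2.proj
        (fiberPhase ME m.1.2.proj (interpolate (m.1.1 : ℝ) (J₀ m.1.2.proj) m.1.2.2)) := by
  have hp : Continuous fun m : interpolationDomain ME J₀ => m.1.2.proj :=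
    (FiberBundle.continuous_proj (ME →L[ℝ] ME) fun x => E x →L[ℝ] E x).comp
      (continuous_snd.comp continuous_subtype_val)
  refine continuous_iff_continuousAt.2 fun m₀ => ?_
  refine tendsto_fiberPhase (p := fun m : interpolationDomain ME J₀ => m.1.2.proj) ?_ m₀.2
    (Eventually.of_forall fun m => m.2)
  refine tendsto_sum (p := fun m : interpolationDomain ME J₀ => m.1.2.proj)
    (s := Finset.univ) (w := fun b m => pairWeight m.1.1 b)
    (A := fun b m => pairFamily (J₀ m.1.2.proj) m.1.2.2 b)
    (A₀ := pairFamily (J₀ m₀.1.2.proj) m₀.1.2.2) hp.continuousAt (fun b _ => ?_) fun b _ => ?_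
  · refine Continuous.continuousAt (f := fun m : interpolationDomain ME J₀ => pairWeight m.1.1 b) ?_
    cases b <;> simp only [pairWeight, cond_true, cond_false] <;> fun_prop
  · cases b
    · exact (hJ₀.comp hp).continuousAt
    · exact (continuous_snd.comp continuous_subtype_val).continuousAt

/-- At points of `int D` outside `C` the structures `J₀` and `J` induce the same structure on the image
of `T` nearby; hence only points outside `int D` have to be wrapped or otherwise controlled. -/
theorem isGlobal_interpolate {n : ℕ} (hE : finrank ℝ ME = 2 * n) (hF : finrank ℝ MF + 2 = 2 * n)
    {oE : ∀ x, Orientation ℝ (E x) (Fin n × Fin 2)} {T : ∀ x, E x →L[ℝ] F x}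
    (hT : Continuous fun x => TotalSpace.mk' (ME →L[ℝ] MF) (E := fun y => E y →L[ℝ] F y) x (T x))
    {C D : Set X} (hdense : Cᶜ ⊆ closure {x | x ∉ C ∧ IsRegular T x})
    {ωF : ∀ x, F x →L[ℝ] F x →L[ℝ] ℝ} (hω : ∀ x v, ωF x v v = 0)
    {R : ∀ x, (E x →L[ℝ] E x) → Prop}
    (hR : IsPhaseStable ME R) (hRt : ∀ x J, R x J → IsTame (ωF x) (T x) J)
    {S : Set X} {q : X → ℕ → X}
    (hq : ∀ x ∈ S, (∀ k, IsRegular T (q x k)) ∧ Tendsto (q x) atTop (𝓝 x))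
    (hS : ∀ x ∉ C, x ∉ interior D → IsWrapped ME T x ∨ finrank ℝ ME ≤ 4 ∨ x ∈ S)
    {JC : ∀ x, E x →L[ℝ] E x} {JD : ∀ x, range (T x) → range (T x)}
    {J₀ J : ∀ x, E x →L[ℝ] E x}
    (h₀ : IsGlobal ME oE T R C D JC JD J₀ ∧ IsExtendible MF T ωF S q univ J₀)
    (h : IsGlobal ME oE T R C D JC JD J ∧ IsExtendible MF T ωF S q univ J) (r : I) :
    (∀ x, NoRealEigenvalue (interpolate (r : ℝ) (J₀ x) (J x) : E x →ₗ[ℝ] E x)) ∧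
      IsGlobal ME oE T R C D JC JD (fun x => fiberPhase ME x (interpolate (r : ℝ) (J₀ x) (J x))) ∧
      IsExtendible MF T ωF S q univ
        (fun x => fiberPhase ME x (interpolate (r : ℝ) (J₀ x) (J x))) := by
  have hb : ∀ b, IsGlobal ME oE T R C D JC JD (fun x => pairFamily (J₀ x) (J x) b) ∧
      IsExtendible MF T ωF S q univ (fun x => pairFamily (J₀ x) (J x) b) := by
    intro b
    cases b
    · exact h₀
    · exact h
  have hmap : ∀ x ∈ D, ∀ b b' v,
      T x (pairFamily (J₀ x) (J x) b v) = T x (pairFamily (J₀ x) (J x) b' v) := by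
    intro x hx b b'
    have hb₁ := (hb b).1
    have hb₂ := (hb b').1
    exact (pushforward_eq_iff (hb₁.complex.sq x trivial) (hRt _ _ (hb₁.rel x))
      (hb₂.complex.sq x trivial) (hRt _ _ (hb₂.rel x))).1
      ((hb₁.eq_D x hx).trans (hb₂.eq_D x hx).symm)
  refine isGlobal_fiberPhase hE hF hT hω hR hRt hq (fun _ => Finset.univ)
    (w := fun b _ => pairWeight r b) (J := fun b x => pairFamily (J₀ x) (J x) b)
    (fun x₀ => Eventually.of_forall fun x => ⟨isWeight_pairWeight r, rfl⟩)
    (fun _ _ _ => continuousAt_const) (fun x₀ b _ => ⟨univ, univ_mem, (hb b).1.complex,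
      fun x _ => (hb b).1.rel x⟩) (fun x₀ hx₀ b _ => (hb b).2 x₀ ⟨hx₀, trivial⟩)
    (fun x₀ hx₀ b _ => (hb b).1.eq_C x₀ hx₀) (fun x₀ hx₀ b _ => (hb b).1.eq_D x₀ hx₀)
    fun x₀ hx₀ => ?_
  have hreg : x₀ ∈ closure {y | IsRegular T y} :=
    closure_mono (fun y hy => hy.2) (hdense hx₀)
  by_cases hx : x₀ ∈ interior D
  · refine Or.inr (Or.inr (Or.inl ?_))
    exact ((mem_closure_iff_frequently.1 hreg).and_eventually
      (mem_interior_iff_mem_nhds.1 hx)).mono fun y hy => ⟨hy.1, fun b _ b' _ => hmap y hy.2 b b'⟩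
  · rcases hS x₀ hx₀ hx with h1 | h1 | h1
    · exact Or.inl h1
    · exact Or.inr (Or.inl ⟨h1, hreg⟩)
    · exact Or.inr (Or.inr (Or.inr ⟨q x₀, (hq x₀ h1).1, (hq x₀ h1).2,
        fun b _ => (hb b).2 x₀ ⟨h1, trivial⟩⟩))

/-- If the phases of all segments issuing from `J₀` exist and have property `P`, then the sections
with property `P` contract to `J₀`. -/
theorem contractibleSpace_sectionSpace {P : (∀ x, E x →L[ℝ] E x) → Prop}
    {J₀ : ∀ x, E x →L[ℝ] E x} (h₀ : P J₀)
    (hc : Continuous fun x =>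
      TotalSpace.mk' (ME →L[ℝ] ME) (E := fun y => E y →L[ℝ] E y) x (J₀ x))
    (hsq : ∀ J, P J → ∀ x v, J x (J x v) = -v)
    (h : ∀ J, P J → ∀ r : I,
      (∀ x, NoRealEigenvalue (interpolate (r : ℝ) (J₀ x) (J x) : E x →ₗ[ℝ] E x)) ∧
      P fun x => fiberPhase ME x (interpolate (r : ℝ) (J₀ x) (J x))) :
    ContractibleSpace (sectionSpace ME P) := by
  choose sec hsec hP using fun f : sectionSpace ME P => f.2
  -- the map `(r, f) ↦ (x ↦ (r, f x))`
  let G : I × sectionSpace ME P → C(X, interpolationDomain ME J₀) := fun p =>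
    ⟨fun x => ⟨(p.1, p.2.1 x), by
      rw [hsec p.2 x]
      exact (h _ (hP p.2) p.1).1 x⟩, by fun_prop⟩
  have hG : Continuous G := by
    let incl : C(interpolationDomain ME J₀,
      I × TotalSpace (ME →L[ℝ] ME) fun x => E x →L[ℝ] E x) := ⟨Subtype.val, continuous_subtype_val⟩
    rw [(ContinuousMap.isInducing_postcomp incl IsInducing.subtypeVal).continuous_iff]
    change Continuous fun p : I × sectionSpace ME P => (ContinuousMap.const X p.1).prodMk p.2.1
    exact ContinuousMap.continuous_prodMk_const.comp
      (continuous_fst.prodMk (continuous_subtype_val.comp continuous_snd))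
  let Ψ : C(interpolationDomain ME J₀, TotalSpace (ME →L[ℝ] ME) fun x => E x →L[ℝ] E x) :=
    ⟨_, continuous_fiberPhase_interpolate hc⟩
  have hval : ∀ p : I × sectionSpace ME P, ∀ x, (Ψ.comp (G p)) x =
      TotalSpace.mk' (ME →L[ℝ] ME) (E := fun y => E y →L[ℝ] E y) x
        (fiberPhase ME x (interpolate (p.1 : ℝ) (J₀ x) (sec p.2 x))) := by
    intro p x
    change TotalSpace.mk' (ME →L[ℝ] ME) (E := fun y => E y →L[ℝ] E y) (p.2.1 x).proj
      (fiberPhase ME (p.2.1 x).proj (interpolate (p.1 : ℝ) (J₀ (p.2.1 x).proj) (p.2.1 x).2)) = _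
    rw [hsec p.2 x]
  let H : C(I × sectionSpace ME P, sectionSpace ME P) :=
    ⟨fun p => ⟨Ψ.comp (G p), _, hval p, (h _ (hP p.2) p.1).2⟩,
      ((ContinuousMap.continuous_postcomp Ψ).comp hG).subtype_mk _⟩
  let f₀ : sectionSpace ME P := ⟨⟨_, hc⟩, J₀, fun _ => rfl, h₀⟩
  rw [contractible_iff_id_nullhomotopic]
  refine ⟨f₀, ContinuousMap.Homotopic.symm ⟨⟨H, fun f => ?_, fun f => ?_⟩⟩⟩
  · refine Subtype.ext (ContinuousMap.ext fun x => ?_)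
    refine (hval (0, f) x).trans ?_
    rw [Icc.coe_zero, interpolate_zero, fiberPhase_of_sq (hsq _ h₀ x)]
    rfl
  · refine Subtype.ext (ContinuousMap.ext fun x => ?_)
    refine (hval (1, f) x).trans ?_
    rw [Icc.coe_one, interpolate_one, fiberPhase_of_sq (hsq _ (hP f) x)]
    exact (hsec f x).symm

end Contraction

/-! ### Wrapped points and collars -/

section Collars

set_option linter.unusedSectionVars false

variable {X : Type*} [TopologicalSpace X]
  {ME : Type*} [NormedAddCommGroup ME] [NormedSpace ℝ ME] [FiniteDimensional ℝ ME]
  {E : X → Type*} [∀ x, AddCommGroup (E x)] [∀ x, Module ℝ (E x)]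
  [TopologicalSpace (TotalSpace ME E)] [∀ x, TopologicalSpace (E x)]
  [∀ x, IsTopologicalAddGroup (E x)] [∀ x, ContinuousSMul ℝ (E x)]
  [FiberBundle ME E] [VectorBundle ℝ ME E]
  {MF : Type*} [NormedAddCommGroup MF] [NormedSpace ℝ MF] [FiniteDimensional ℝ MF]
  {F : X → Type*} [∀ x, AddCommGroup (F x)] [∀ x, Module ℝ (F x)]
  [TopologicalSpace (TotalSpace MF F)] [∀ x, TopologicalSpace (F x)]
  [∀ x, IsTopologicalAddGroup (F x)] [∀ x, ContinuousSMul ℝ (F x)]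
  [FiberBundle MF F] [VectorBundle ℝ MF F]

theorem isWrapped_of_isRegular {T : ∀ x, E x →L[ℝ] F x} {n : ℕ} (hE : finrank ℝ ME = 2 * n)
    (hF : finrank ℝ MF + 2 = 2 * n) {x : X} (hx : IsRegular T x) : IsWrapped ME T x := by
  rw [IsWrapped, finrank_ker_of_isRegular hE hF hx]
  omega

namespace Collar

variable {T : ∀ x, E x →L[ℝ] F x} {ωF : ∀ x, F x →L[ℝ] F x →L[ℝ] ℝ} {S : Set X}
  (K : Collar ME MF T ωF S)

theorem notMem_of_pos (hS : IsClosed S) {p : I × frontier S} (hp : 0 < p.1) : K.toFun p ∉ S := by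
  intro h
  have h1 : K.toFun p ∈ frontier S :=
    hS.frontier_eq ▸ ⟨h, K.range_subset (mem_range_self p)⟩
  have h2 := K.isEmbedding.injective (K.map_zero ⟨_, h1⟩)
  exact hp.ne (congrArg Prod.fst h2)

theorem range_mem_nhds (hS : IsClosed S) {p : I × frontier S} (hp : 0 < p.1) (hp1 : p.1 < 1) :
    range K.toFun ∈ 𝓝 (K.toFun p) := by
  have hmem : K.toFun p ∈ (interior S)ᶜ := K.range_subset (mem_range_self p)
  have h1 : (⟨K.toFun p, hmem⟩ : ↥(interior S)ᶜ) ∈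
      interior (((↑) : ↥(interior S)ᶜ → X) ⁻¹' range K.toFun) := by
    refine (self_sdiff_frontier _).subset ⟨mem_range_self p, ?_⟩
    rw [K.map_one]
    rintro ⟨p', ⟨hp', -⟩, h⟩
    have := K.isEmbedding.injective h
    rw [this] at hp'
    exact hp1.ne hp'
  rw [mem_interior_iff_mem_nhds, preimage_coe_mem_nhds_subtype, nhdsWithin_eq_nhds.2] at h1
  · exact h1
  · exact mem_of_superset (hS.isOpen_compl.mem_nhds (K.notMem_of_pos hS hp))
      (compl_subset_compl.2 interior_subset)

theorem map_eq_zero_iff (p : I × frontier S) (v : E p.2) :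
    T (K.toFun p) (K.idE p v) = 0 ↔ T p.2 v = 0 := by
  rw [K.T_const, (K.idF p).map_eq_zero_iff]

theorem isRegular_iff (p : I × frontier S) : IsRegular T (K.toFun p) ↔ IsRegular T p.2 := by
  refine ⟨fun h w => ?_, fun h w => ?_⟩
  · obtain ⟨u, hu⟩ := h (K.idF p w)
    obtain ⟨v, rfl⟩ := (K.idE p).surjective u
    exact ⟨v, (K.idF p).injective (by rw [← K.T_const, hu])⟩
  · obtain ⟨w, rfl⟩ := (K.idF p).surjective w
    obtain ⟨v, rfl⟩ := h w
    exact ⟨K.idE p v, K.T_const p v⟩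

/-- The identification of `E` along the collar with `E|∂S` is continuous in both directions. -/
theorem continuous_symm : Continuous fun a : TotalSpace ME (K.toFun *ᵖ E) =>
    TotalSpace.mk' ME (a.proj.2 : X) ((K.idE a.proj).symm a.2) := by
  refine continuous_iff_continuousAt.2 fun a₀ => ?_
  have hproj := Pullback.continuous_proj ME E K.toFun
  refine ContinuousAt.clm_apply_of_inCoordinates (F₁ := ME) (E₁ := E) (F₂ := ME) (E₂ := E)
    (m₀ := a₀) (b₁ := fun a : TotalSpace ME (K.toFun *ᵖ E) => K.toFun a.proj)
    (b₂ := fun a : TotalSpace ME (K.toFun *ᵖ E) => (a.proj.2 : X))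
    (v := fun a : TotalSpace ME (K.toFun *ᵖ E) => (a.2 : E (K.toFun a.proj)))
    (ϕ := fun a => ((K.idE a.proj).symm : E (K.toFun a.proj) →L[ℝ] E a.proj.2)) ?_
    (Pullback.continuous_lift ME E K.toFun).continuousAt
    (continuous_subtype_val.comp (continuous_snd.comp hproj)).continuousAt
  let p₀ := a₀.proj
  let M : I × frontier S → (ME →L[ℝ] ME) := fun p =>
    ContinuousLinearMap.inCoordinates ME E ME E (p₀.2 : X) p.2 (K.toFun p₀) (K.toFun p) (K.idE p)
  let N : I × frontier S → (ME →L[ℝ] ME) := fun p =>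
    ContinuousLinearMap.inCoordinates ME E ME E (K.toFun p₀) (K.toFun p) (p₀.2 : X) p.2
      ((K.idE p).symm : E (K.toFun p) →L[ℝ] E p.2)
  suffices h : ContinuousAt N p₀ from
    ContinuousAt.comp_of_eq (f := fun a : TotalSpace ME (K.toFun *ᵖ E) => a.proj) h
      hproj.continuousAt rfl
  have hK : Continuous K.toFun := K.isEmbedding.continuous
  have h1 : ∀ᶠ p in 𝓝 p₀, (p.2 : X) ∈ (trivializationAt ME E (p₀.2 : X)).baseSet :=
    eventually_mem_baseSet (by exact (continuous_subtype_val.comp continuous_snd).tendsto p₀)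
  have h2 : ∀ᶠ p in 𝓝 p₀, K.toFun p ∈ (trivializationAt ME E (K.toFun p₀)).baseSet :=
    eventually_mem_baseSet (hK.tendsto p₀)
  have hinv : ∀ᶠ p in 𝓝 p₀, ∃ e : ME ≃L[ℝ] ME, M p = e ∧ N p = e.symm := by
    filter_upwards [h1, h2] with p hp1 hp2
    refine ⟨((fiberEquiv ME _ _ hp1).symm.trans (K.idE p)).trans (fiberEquiv ME _ _ hp2), ?_, ?_⟩
    · simp only [M]
      rw [ContinuousLinearMap.inCoordinates_eq hp1 hp2]
      rfl
    · simp only [N]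
      rw [ContinuousLinearMap.inCoordinates_eq hp2 hp1]
      rfl
  have hM : ContinuousAt M p₀ := by
    rw [continuousAt_clm_apply]
    intro m
    have h3 : ContinuousAt (fun p : I × frontier S => TotalSpace.mk' ME (p.2 : X)
        ((trivializationAt ME E (p₀.2 : X)).symm p.2 m)) p₀ := by
      have h4 := ((trivializationAt ME E (p₀.2 : X)).toOpenPartialHomeomorph.continuousAt_symm
        (x := ((p₀.2 : X), m)) ((trivializationAt ME E (p₀.2 : X)).mem_target.2
          h1.self_of_nhds)).comp_of_eq (x := p₀)
        (f := fun p : I × frontier S => ((p.2 : X), m)) (by fun_prop) rfl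
      refine h4.congr ?_
      filter_upwards [h1] with p hp
      exact ((trivializationAt ME E (p₀.2 : X)).mk_symm hp m).symm
    let g : I × frontier S → I × {v : TotalSpace ME E // v.proj ∈ frontier S} := fun p =>
      (p.1, ⟨TotalSpace.mk' ME (p.2 : X) ((trivializationAt ME E (p₀.2 : X)).symm p.2 m), p.2.2⟩)
    have hg : ContinuousAt g p₀ :=
      continuousAt_fst.prodMk (IsInducing.subtypeVal.continuousAt_iff.2 h3)
    have h5 : ContinuousAt (fun p : I × frontier S => TotalSpace.mk' ME (K.toFun p)
        (K.idE p ((trivializationAt ME E (p₀.2 : X)).symm p.2 m))) p₀ :=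
      K.idE_continuous.continuousAt.comp hg
    have h6 : ContinuousAt (fun p : I × frontier S =>
        (trivializationAt ME E (K.toFun p₀) (TotalSpace.mk' ME (K.toFun p)
        (K.idE p ((trivializationAt ME E (p₀.2 : X)).symm p.2 m)))).2) p₀ :=
      continuousAt_snd.comp (((trivializationAt ME E (K.toFun p₀)).continuousAt
        ((Trivialization.mem_source _).2 (mem_baseSet_trivializationAt ME E (K.toFun p₀)))).comp_of_eq
          h5 rfl)
    refine h6.congr ?_
    filter_upwards [h1, h2] with p hp1 hp2
    rw [trivializationAt_snd hp2]
    simp only [M]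
    rw [ContinuousLinearMap.inCoordinates_eq hp1 hp2]
    simp only [ContinuousLinearMap.coe_comp, Function.comp_apply, ContinuousLinearEquiv.coe_coe]
    rw [Trivialization.symm_continuousLinearEquivAt_eq, Trivialization.symmL_apply _ hp1]
    rfl
  obtain ⟨e, he, -⟩ := hinv.self_of_nhds
  have : CompleteSpace ME := FiniteDimensional.complete ℝ ME
  have h7 : ContinuousAt (fun p => ContinuousLinearMap.inverse (M p)) p₀ :=
    ((contDiffAt_map_inverse (n := 0) e).continuousAt).comp_of_eq hM he
  refine h7.congr ?_
  filter_upwards [hinv] with p ⟨e, he, he'⟩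
  rw [he, he', ContinuousLinearMap.inverse_equiv]

theorem isInducing_lift : IsInducing (Pullback.lift (F := ME) (E := E) K.toFun) := by
  refine ⟨le_antisymm (Pullback.continuous_lift ME E K.toFun).le_induced ?_⟩
  rw [Pullback.TotalSpace.topologicalSpace, pullbackTopology_def]
  refine le_inf ?_ le_rfl
  rw [K.isEmbedding.eq_induced, induced_compose]
  have h : K.toFun ∘ TotalSpace.proj = TotalSpace.proj ∘ Pullback.lift (F := ME) (E := E) K.toFun :=
    rfl
  rw [h, ← induced_compose]
  exact induced_mono (FiberBundle.continuous_proj ME E).le_induced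

theorem mem_limitKernel (hS : IsClosed S) {p : I × frontier S} (hp : 0 < p.1) (hp1 : p.1 < 1)
    {v : E p.2} (hv : TotalSpace.mk' ME (K.toFun p) (K.idE p v) ∈ limitKernel ME T) :
    TotalSpace.mk' ME (p.2 : X) v ∈ limitKernel ME T := by
  let a₀ : TotalSpace ME (K.toFun *ᵖ E) := ⟨p, K.idE p v⟩
  have h1 : ∃ᶠ τ in 𝓝 (Pullback.lift K.toFun a₀),
      IsRegular T τ.proj ∧ T τ.proj τ.2 = 0 := mem_closure_iff_frequently.1 hv
  have h2 : ∃ᶠ a in 𝓝 a₀, IsRegular T (K.toFun a.proj) ∧ T (K.toFun a.proj) a.2 = 0 := by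
    rw [K.isInducing_lift.nhds_eq_comap, frequently_comap]
    refine (h1.and_eventually ((FiberBundle.continuous_proj ME E).continuousAt.preimage_mem_nhds
      (K.range_mem_nhds hS hp hp1))).mono ?_
    rintro ⟨x, u⟩ ⟨h, p', rfl⟩
    exact ⟨⟨p', u⟩, rfl, h⟩
  have h3 := (K.continuous_symm.tendsto a₀).frequently (p := fun τ : TotalSpace ME E =>
    IsRegular T τ.proj ∧ T τ.proj τ.2 = 0) (h2.mono fun a ha => ⟨(K.isRegular_iff a.proj).1 ha.1, by
      refine (K.map_eq_zero_iff a.proj _).1 ?_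
      change T _ (K.idE a.proj ((K.idE a.proj).symm (id a.2 : E (K.toFun a.proj)))) = 0
      rw [(K.idE a.proj).apply_symm_apply]
      exact ha.2⟩)
  have h4 : (K.idE p).symm (K.idE p v) = v := (K.idE p).symm_apply_apply v
  have h5 := mem_closure_iff_frequently.2 h3
  change TotalSpace.mk' ME (p.2 : X) ((K.idE p).symm (K.idE p v)) ∈ limitKernel ME T at h5
  rwa [h4] at h5

/-- The kernel of `T` and the limits of kernels at regular points are constant along the lines of a
collar; so a boundary point is wrapped if the interior points of its line are. -/
theorem isWrapped_of_isWrapped (hS : IsClosed S) {p : I × frontier S} (hp : 0 < p.1)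
    (hp1 : p.1 < 1) (h : IsWrapped ME T (K.toFun p)) : IsWrapped ME T (p.2 : X) := by
  have := finiteDimensional_fiber ME (E := E) (p.2 : X)
  have h1 : finrank ℝ (LinearMap.ker (T p.2 : E p.2 →ₗ[ℝ] F p.2)) =
      finrank ℝ (LinearMap.ker (T (K.toFun p) : E (K.toFun p) →ₗ[ℝ] F (K.toFun p))) := by
    have hmap : (LinearMap.ker (T p.2 : E p.2 →ₗ[ℝ] F p.2)).map
        ((K.idE p).toLinearEquiv : E p.2 →ₗ[ℝ] E (K.toFun p)) =
        LinearMap.ker (T (K.toFun p) : E (K.toFun p) →ₗ[ℝ] F (K.toFun p)) := by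
      ext u
      obtain ⟨v, rfl⟩ := (K.idE p).surjective u
      constructor
      · rintro ⟨v', hv', h'⟩
        rw [← (K.idE p).injective h']
        exact (K.map_eq_zero_iff p v').2 hv'
      · exact fun hv => ⟨v, (K.map_eq_zero_iff p v).1 hv, rfl⟩
    rw [← hmap, LinearEquiv.finrank_map_eq]
  have h2 : finrank ℝ (Submodule.span ℝ
        {v : E (K.toFun p) | TotalSpace.mk' ME (K.toFun p) v ∈ limitKernel ME T}) ≤
      finrank ℝ (Submodule.span ℝ
        {v : E p.2 | TotalSpace.mk' ME (p.2 : X) v ∈ limitKernel ME T}) := by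
    rw [← LinearEquiv.finrank_map_eq (K.idE p).toLinearEquiv (Submodule.span ℝ
        {v : E p.2 | TotalSpace.mk' ME (p.2 : X) v ∈ limitKernel ME T}), Submodule.map_span]
    have := finiteDimensional_fiber ME (E := E) (K.toFun p)
    refine Submodule.finrank_mono (Submodule.span_mono fun u hu => ?_)
    obtain ⟨v, rfl⟩ := (K.idE p).surjective u
    exact ⟨v, K.mem_limitKernel hS hp hp1 hu, rfl⟩
  rw [IsWrapped] at h ⊢
  omega

theorem isWrapped_of_forall_notMem (K : Collar ME MF T ωF S) (hS : IsClosed S)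
    (h : ∀ x ∉ S, IsWrapped ME T x) {y : X} (hy : y ∈ frontier S) : IsWrapped ME T y := by
  let t : I := ⟨1 / 2, by norm_num, by norm_num⟩
  have ht : 0 < t := by
    rw [← Subtype.coe_lt_coe]; norm_num [t]
  have ht1 : t < 1 := by
    rw [← Subtype.coe_lt_coe]; norm_num [t]
  exact K.isWrapped_of_isWrapped hS (p := (t, ⟨y, hy⟩)) ht ht1 (h _ (K.notMem_of_pos hS ht))

end Collar

end Collars

/-! ### Existence and contractibility -/

section Conclusion

set_option linter.unusedSectionVars false

variable {X : Type*} [TopologicalSpace X]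
  {ME : Type*} [NormedAddCommGroup ME] [NormedSpace ℝ ME] [FiniteDimensional ℝ ME]
  {E : X → Type*} [∀ x, AddCommGroup (E x)] [∀ x, Module ℝ (E x)]
  [TopologicalSpace (TotalSpace ME E)] [∀ x, TopologicalSpace (E x)]
  [∀ x, IsTopologicalAddGroup (E x)] [∀ x, ContinuousSMul ℝ (E x)]
  [FiberBundle ME E] [VectorBundle ℝ ME E]
  {MF : Type*} [NormedAddCommGroup MF] [NormedSpace ℝ MF] [FiniteDimensional ℝ MF]
  {F : X → Type*} [∀ x, AddCommGroup (F x)] [∀ x, Module ℝ (F x)]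
  [TopologicalSpace (TotalSpace MF F)] [∀ x, TopologicalSpace (F x)]
  [∀ x, IsTopologicalAddGroup (F x)] [∀ x, ContinuousSMul ℝ (F x)]
  [FiberBundle MF F] [VectorBundle ℝ MF F]

namespace IsLocalData

variable {n : ℕ} {oE : ∀ x, Orientation ℝ (E x) (Fin n × Fin 2)} {T : ∀ x, E x →L[ℝ] F x}
  {R : ∀ x, (E x →L[ℝ] E x) → Prop} {C D U V : Set X} {W : X → Set X}
  {JC : ∀ x, E x →L[ℝ] E x} {Jloc : X → ∀ x, E x →L[ℝ] E x}

/-- The set `S` consists of the points at which the structures are required to be extendible along the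
sequences `q`. For contractibility the points of the frontier of `D` also have to be controlled, as
`D` need not contain a neighborhood of them. -/
theorem exists_and_contractible [TopologicalSpace.MetrizableSpace X]
    (h : IsLocalData ME oE T R C D U V W JC Jloc)
    (hE : finrank ℝ ME = 2 * n) (hF : finrank ℝ MF + 2 = 2 * n)
    (hT : Continuous fun x => TotalSpace.mk' (ME →L[ℝ] MF) (E := fun y => E y →L[ℝ] F y) x (T x))
    (hC : IsClosed C) (hD : IsClosed D) (hdense : Cᶜ ⊆ closure {x | x ∉ C ∧ IsRegular T x})
    {ωF : ∀ x, F x →L[ℝ] F x →L[ℝ] ℝ} (hω : ∀ x v, ωF x v v = 0)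
    (hR : IsPhaseStable ME R) (hRt : ∀ x J, R x J → IsTame (ωF x) (T x) J)
    {S : Set X} {q : X → ℕ → X}
    (hq : ∀ x ∈ S, (∀ k, IsRegular T (q x k)) ∧ Tendsto (q x) atTop (𝓝 x))
    (hS : ∀ x ∉ D, IsWrapped ME T x ∨ finrank ℝ ME ≤ 4 ∨ x ∈ S)
    (hext : IsExtendible MF T ωF S q U JC)
    (hext' : ∀ a ∉ U, IsExtendible MF T ωF S q (W a) (Jloc a)) :
    (∃ J, IsGlobal ME oE T R C D JC (imageStructure T U JC Jloc) J ∧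
      IsExtendible MF T ωF S q univ J) ∧
    ((D ≠ C → ∀ x ∈ frontier D, IsWrapped ME T x ∨ finrank ℝ ME ≤ 4) →
      SectionsContractible ME C fun J =>
        IsGlobal ME oE T R C D JC (imageStructure T U JC Jloc) J ∧
        IsExtendible MF T ωF S q univ J) := by
  have hex := h.exists_isGlobal hE hF hT hC hD hdense hω hR hRt hq hS hext hext'
  refine ⟨hex, fun hfr => ?_⟩
  obtain ⟨J₀, h₀⟩ := hex
  have key : ContractibleSpace (sectionSpace ME fun J =>
      IsGlobal ME oE T R C D JC (imageStructure T U JC Jloc) J ∧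
      IsExtendible MF T ωF S q univ J) := by
    refine contractibleSpace_sectionSpace (J₀ := J₀) h₀
      (continuousOn_univ.1 h₀.1.complex.continuousOn)
      (fun J hJ x => hJ.1.complex.sq x trivial) fun J hJ r => ?_
    refine isGlobal_interpolate hE hF hT hdense hω hR hRt hq (fun x hxC hxD => ?_) h₀ hJ r
    by_cases hx : x ∈ D
    · have h1 := hfr (fun hDC => hxC (hDC ▸ hx)) x (hD.frontier_eq ▸ ⟨hx, hxD⟩)
      exact h1.imp id Or.inl
    · exact hS x hx
  exact ⟨fun _ => IsWeaklyContractible.of_contractibleSpace, fun _ => key⟩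

/-- The case without extendibility conditions. -/
theorem exists_and_contractible_of_wrapped [TopologicalSpace.MetrizableSpace X]
    (h : IsLocalData ME oE T R C D U V W JC Jloc)
    (hE : finrank ℝ ME = 2 * n) (hF : finrank ℝ MF + 2 = 2 * n)
    (hT : Continuous fun x => TotalSpace.mk' (ME →L[ℝ] MF) (E := fun y => E y →L[ℝ] F y) x (T x))
    (hC : IsClosed C) (hD : IsClosed D) (hdense : Cᶜ ⊆ closure {x | x ∉ C ∧ IsRegular T x})
    {ωF : ∀ x, F x →L[ℝ] F x →L[ℝ] ℝ} (hω : ∀ x v, ωF x v v = 0)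
    (hR : IsPhaseStable ME R) (hRt : ∀ x J, R x J → IsTame (ωF x) (T x) J)
    (hS : ∀ x ∉ D, IsWrapped ME T x ∨ finrank ℝ ME ≤ 4) :
    (∃ J, IsGlobal ME oE T R C D JC (imageStructure T U JC Jloc) J) ∧
    ((D ≠ C → ∀ x ∈ frontier D, IsWrapped ME T x ∨ finrank ℝ ME ≤ 4) →
      SectionsContractible ME C (IsGlobal ME oE T R C D JC (imageStructure T U JC Jloc))) := by
  have key := h.exists_and_contractible hE hF hT hC hD hdense hω hR hRt (S := ∅)
    (q := fun x _ => x) (fun x hx => hx.elim) (fun x hx => (hS x hx).imp id Or.inl)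
    (fun x hx => hx.1.elim) (fun a _ x hx => hx.1.elim)
  have hiff : ∀ J, (IsGlobal ME oE T R C D JC (imageStructure T U JC Jloc) J ∧
      IsExtendible MF T ωF ∅ (fun x _ => x) univ J) =
      IsGlobal ME oE T R C D JC (imageStructure T U JC Jloc) J := fun J =>
    propext ⟨fun hJ => hJ.1, fun hJ => ⟨hJ, fun x hx => hx.1.elim⟩⟩
  simp only [hiff] at key
  exact key

/-- If also a form on `E` tames the given structures, it is taken as part of the fiberwise
condition. -/
theorem exists_and_contractible_of_tame [TopologicalSpace.MetrizableSpace X]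
    (h : IsLocalData ME oE T R C univ U V W JC Jloc)
    (hE : finrank ℝ ME = 2 * n) (hF : finrank ℝ MF + 2 = 2 * n)
    (hT : Continuous fun x => TotalSpace.mk' (ME →L[ℝ] MF) (E := fun y => E y →L[ℝ] F y) x (T x))
    (hC : IsClosed C) (hdense : Cᶜ ⊆ closure {x | x ∉ C ∧ IsRegular T x})
    {ωF : ∀ x, F x →L[ℝ] F x →L[ℝ] ℝ} (hω : ∀ x v, ωF x v v = 0)
    (hR : IsPhaseStable ME R) (hRt : ∀ x J, R x J → IsTame (ωF x) (T x) J)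
    {ωE : ∀ x, E x →L[ℝ] E x →L[ℝ] ℝ} (hωE : ∀ x v, ωE x v v = 0)
    (htame : LocallyTame ωE U W JC Jloc) :
    (∃ J, IsGlobal ME oE T R C univ JC (imageStructure T U JC Jloc) J ∧ GloballyTame ωE J) ∧
    SectionsContractible ME C fun J =>
      IsGlobal ME oE T R C univ JC (imageStructure T U JC Jloc) J ∧ GloballyTame ωE J := by
  have h' : IsLocalData ME oE T
      (fun x J => R x J ∧ IsTame (ωE x) (ContinuousLinearMap.id ℝ (E x)) J)
      C univ U V W JC Jloc :=
    { h with
      rel_C := fun x hx => ⟨h.rel_C x hx, htame.1 x hx⟩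
      rel_W := fun a ha x hx => ⟨h.rel_W a ha x hx, htame.2 a ha x hx⟩ }
  have key := h'.exists_and_contractible_of_wrapped hE hF hT hC isClosed_univ hdense hω
    (hR.and (isPhaseStable_isTame hωE)) (fun x J hJ => hRt x J hJ.1)
    (fun x hx => (hx trivial).elim)
  have hiff : ∀ J, IsGlobal ME oE T
      (fun x J => R x J ∧ IsTame (ωE x) (ContinuousLinearMap.id ℝ (E x)) J) C univ JC
      (imageStructure T U JC Jloc) J ↔
      (IsGlobal ME oE T R C univ JC (imageStructure T U JC Jloc) J ∧ GloballyTame ωE J) := fun J =>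
    ⟨fun hJ => ⟨{ hJ with rel := fun x => (hJ.rel x).1 }, fun x => (hJ.rel x).2⟩,
      fun hJ => { hJ.1 with rel := fun x => ⟨hJ.1.rel x, hJ.2 x⟩ }⟩
  have heq := funext fun J => propext (hiff J)
  rw [heq] at key
  exact ⟨key.1, key.2 fun _ x hx => by simp at hx⟩

end IsLocalData

end Conclusion

end Splice

end

theorem lemma3p2
    {X : Type*} [TopologicalSpace X] [TopologicalSpace.MetrizableSpace X]
    {ME : Type*} [NormedAddCommGroup ME] [NormedSpace ℝ ME] [FiniteDimensional ℝ ME]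
    {E : X → Type*} [∀ x, AddCommGroup (E x)] [∀ x, Module ℝ (E x)]
    [TopologicalSpace (TotalSpace ME E)] [∀ x, TopologicalSpace (E x)]
    [∀ x, IsTopologicalAddGroup (E x)] [∀ x, ContinuousSMul ℝ (E x)]
    [FiberBundle ME E] [VectorBundle ℝ ME E]
    {MF : Type*} [NormedAddCommGroup MF] [NormedSpace ℝ MF] [FiniteDimensional ℝ MF]
    {F : X → Type*} [∀ x, AddCommGroup (F x)] [∀ x, Module ℝ (F x)]
    [TopologicalSpace (TotalSpace MF F)] [∀ x, TopologicalSpace (F x)]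
    [∀ x, IsTopologicalAddGroup (F x)] [∀ x, ContinuousSMul ℝ (F x)]
    [FiberBundle MF F] [VectorBundle ℝ MF F]
    -- fiber dimensions `2n` and `2n - 2`, fiber orientations
    (n : ℕ) (hE : finrank ℝ ME = 2 * n) (hF : finrank ℝ MF + 2 = 2 * n)
    (oE : ∀ x, Orientation ℝ (E x) (Fin n × Fin 2)) (hoE : Splice.IsFiberOrientation ME oE)
    (oF : ∀ x, Orientation ℝ (F x) (Fin (n - 1) × Fin 2)) (hoF : Splice.IsFiberOrientation MF oF)
    -- the section `T` of `Hom(E, F)`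
    (T : ∀ x, E x →L[ℝ] F x)
    (hT : Continuous fun x => TotalSpace.mk' (ME →L[ℝ] MF) x (T x))
    (C D : Set X) (hC : IsClosed C) (hD : IsClosed D) (hCD : C ⊆ D)
    (hdense : Cᶜ ⊆ closure {x | x ∉ C ∧ Splice.IsRegular T x})
    -- the nondegenerate 2-form on `F`
    (ωF : ∀ x, F x →L[ℝ] F x →L[ℝ] ℝ) (hωF : Splice.IsTwoForm MF ωF)
    (hnd : ∀ x v, (∀ w, ωF x v w = 0) → v = 0)
    (hor : ∀ x, Splice.FormInducesOrientation (oF x) (ωF x)) :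
    -- compatible structures
    (∀ (U V : Set X) (W : X → Set X) (JC : ∀ x, E x →L[ℝ] E x)
        (Jloc : X → ∀ x, E x →L[ℝ] E x),
      Splice.IsLocalData ME oE T (fun x => Splice.IsCompatible (ωF x) (T x)) C D U V W JC Jloc →
      -- (a), and (c) in case (a)
      ((3 ≤ n → ∀ x ∉ D, ¬ Splice.IsRegular T x → Splice.IsWrapped ME T x) →
        (∃ J, Splice.IsGlobal ME oE T (fun x => Splice.IsCompatible (ωF x) (T x)) C D JC
          (Splice.imageStructure T U JC Jloc) J) ∧
        (Splice.HasCollars ME MF T ωF C D (Splice.imageStructure T U JC Jloc)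
            (fun _ => True) ∅ →
          Splice.SectionsContractible ME C
            (Splice.IsGlobal ME oE T (fun x => Splice.IsCompatible (ωF x) (T x)) C D JC
              (Splice.imageStructure T U JC Jloc)))) ∧
      -- (b), and (c) in case (b)
      (D = univ → ∀ ωE : ∀ x, E x →L[ℝ] E x →L[ℝ] ℝ, Splice.IsTwoForm ME ωE →
        Splice.LocallyTame ωE U W JC Jloc →
        (∃ J, Splice.IsGlobal ME oE T (fun x => Splice.IsCompatible (ωF x) (T x)) C D JC
          (Splice.imageStructure T U JC Jloc) J ∧ Splice.GloballyTame ωE J) ∧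
        (Splice.HasCollars ME MF T ωF C D (Splice.imageStructure T U JC Jloc)
            (fun K => K.FormConst ωE) ∅ →
          Splice.SectionsContractible ME C (fun J =>
            Splice.IsGlobal ME oE T (fun x => Splice.IsCompatible (ωF x) (T x)) C D JC
              (Splice.imageStructure T U JC Jloc) J ∧ Splice.GloballyTame ωE J))) ∧
      -- the addendum: `n = 3`, unwrapped critical points allowed off `D`
      (n = 3 → ∀ q : X → ℕ → X,
        (∀ x ∈ Splice.unwrappedCritical ME T \ D,
          (∀ i, Splice.IsRegular T (q x i)) ∧ Tendsto (q x) atTop (𝓝 x)) →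
        Splice.IsExtendible MF T ωF (Splice.unwrappedCritical ME T \ D) q U JC →
        (∀ a ∉ U,
          Splice.IsExtendible MF T ωF (Splice.unwrappedCritical ME T \ D) q (W a) (Jloc a)) →
        (∃ J, Splice.IsGlobal ME oE T (fun x => Splice.IsCompatible (ωF x) (T x)) C D JC
          (Splice.imageStructure T U JC Jloc) J ∧
          Splice.IsExtendible MF T ωF (Splice.unwrappedCritical ME T \ D) q univ J) ∧
        (Splice.HasCollars ME MF T ωF C D (Splice.imageStructure T U JC Jloc)
            (fun _ => True) (Splice.unwrappedCritical ME T) →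
          Splice.SectionsContractible ME C (fun J =>
            Splice.IsGlobal ME oE T (fun x => Splice.IsCompatible (ωF x) (T x)) C D JC
              (Splice.imageStructure T U JC Jloc) J ∧
            Splice.IsExtendible MF T ωF (Splice.unwrappedCritical ME T \ D) q univ J)))) ∧
    -- taming instead of compatibility everywhere, when `D = X`
    (D = univ → ∀ (U V : Set X) (W : X → Set X) (JC : ∀ x, E x →L[ℝ] E x)
        (Jloc : X → ∀ x, E x →L[ℝ] E x),
      Splice.IsLocalData ME oE T (fun x => Splice.IsTame (ωF x) (T x)) C D U V W JC Jloc →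
      ((∃ J, Splice.IsGlobal ME oE T (fun x => Splice.IsTame (ωF x) (T x)) C D JC
          (Splice.imageStructure T U JC Jloc) J) ∧
        (Splice.HasCollars ME MF T ωF C D (Splice.imageStructure T U JC Jloc)
            (fun _ => True) ∅ →
          Splice.SectionsContractible ME C
            (Splice.IsGlobal ME oE T (fun x => Splice.IsTame (ωF x) (T x)) C D JC
              (Splice.imageStructure T U JC Jloc)))) ∧
      (∀ ωE : ∀ x, E x →L[ℝ] E x →L[ℝ] ℝ, Splice.IsTwoForm ME ωE →
        Splice.LocallyTame ωE U W JC Jloc →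
        (∃ J, Splice.IsGlobal ME oE T (fun x => Splice.IsTame (ωF x) (T x)) C D JC
          (Splice.imageStructure T U JC Jloc) J ∧ Splice.GloballyTame ωE J) ∧
        (Splice.HasCollars ME MF T ωF C D (Splice.imageStructure T U JC Jloc)
            (fun K => K.FormConst ωE) ∅ →
          Splice.SectionsContractible ME C (fun J =>
            Splice.IsGlobal ME oE T (fun x => Splice.IsTame (ωF x) (T x)) C D JC
              (Splice.imageStructure T U JC Jloc) J ∧ Splice.GloballyTame ωE J)))) := by
  have hT' : Continuous fun x =>
      TotalSpace.mk' (ME →L[ℝ] MF) (E := fun y => E y →L[ℝ] F y) x (T x) := hT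
  have hω := hωF.alternating
  have hcompat : Splice.IsPhaseStable ME fun x => Splice.IsCompatible (ωF x) (T x) :=
    Splice.isPhaseStable_isCompatible hω
  have htame : Splice.IsPhaseStable ME fun x => Splice.IsTame (ωF x) (T x) :=
    Splice.isPhaseStable_isTame hω
  refine ⟨fun U V W JC Jloc hloc => ⟨fun hwr => ?_, ?_, ?_⟩, ?_⟩
  · have hS : ∀ x ∉ D, Splice.IsWrapped ME T x ∨ finrank ℝ ME ≤ 4 := by
      intro x hx
      by_cases hn : 3 ≤ n
      · refine Or.inl ?_
        by_cases hreg : Splice.IsRegular T x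
        · exact Splice.isWrapped_of_isRegular hE hF hreg
        · exact hwr hn x hx hreg
      · exact Or.inr (by omega)
    have key := hloc.exists_and_contractible_of_wrapped hE hF hT' hC hD hdense hω hcompat
      (fun x J hJ => hJ.1) hS
    refine ⟨key.1, fun hcol => key.2 fun hDC x hx => ?_⟩
    obtain ⟨K, -, -, hK⟩ := hcol
    obtain ⟨-, L, -⟩ := hK hDC
    by_cases h4 : finrank ℝ ME ≤ 4
    · exact Or.inr h4
    · exact Or.inl (L.isWrapped_of_forall_notMem hD (fun y hy => (hS y hy).resolve_right h4) hx)
  · rintro rfl ωE hωE hE_tame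
    have key := hloc.exists_and_contractible_of_tame hE hF hT' hC hdense hω hcompat
      (fun x J hJ => hJ.1) hωE.alternating hE_tame
    exact ⟨key.1, fun _ => key.2⟩
  · intro hn q hq hext hext'
    have hwr : ∀ x, x ∉ Splice.unwrappedCritical ME T → Splice.IsWrapped ME T x := by
      intro x hx
      by_contra hw
      exact hx ⟨fun hreg => hw (Splice.isWrapped_of_isRegular hE hF hreg), hw⟩
    have key := hloc.exists_and_contractible hE hF hT' hC hD hdense hω hcompat
      (fun x J hJ => hJ.1) hq (fun x hx => ?_) hext hext'
    · refine ⟨key.1, fun hcol => key.2 fun hDC x hx => Or.inl (hwr x ?_)⟩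
      obtain ⟨K, -, -, hK⟩ := hcol
      obtain ⟨-, L, -, hL⟩ := hK hDC
      exact disjoint_left.1 hL ⟨(0, ⟨x, hx⟩), L.map_zero _⟩
    · by_cases hu : x ∈ Splice.unwrappedCritical ME T
      · exact Or.inr (Or.inr ⟨hu, hx⟩)
      · exact Or.inl (hwr x hu)
  · rintro rfl U V W JC Jloc hloc
    refine ⟨?_, fun ωE hωE hE_tame => ?_⟩
    · have key := hloc.exists_and_contractible_of_wrapped hE hF hT' hC hD hdense hω htame
        (fun x J hJ => hJ) (fun x hx => (hx trivial).elim)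
      exact ⟨key.1, fun _ => key.2 fun _ x hx => by simp at hx⟩
    · have key := hloc.exists_and_contractible_of_tame hE hF hT' hC hdense hω htame
        (fun x J hJ => hJ) hωE.alternating hE_tame
      exact ⟨key.1, fun _ => key.2⟩
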